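/- Let $\mathbb H=\{\tau\in\mathbb C:\operatorname{Im}\tau>0\}$ and $q=e^{2\pi i\tau}$, and let $\eta(\tau)=q^{1/24}\prod_{n\ge1}(1-q^n)$, with $q^{1/24}=e^{2\pi i\tau/24}$, be the Dedekind eta function. For $\tau\in\mathbb H$ and $\operatorname{Re}s>0$ put $$G_2(s,\tau)=\frac12\sum_{(m,n)\in\mathbb Z^2\setminus\{(0,0)\}}\frac{1}{(m\tau+n)^2}\,\frac{(\operatorname{Im}\tau)^s}{|m\tau+n|^{2s}},\qquad G_2^*(\tau)=\lim_{s\to0,\ \operatorname{Re}s>0}G_2(s,\tau),$$ and, for a positive integer $N$, $G_{2,N}(\tau)=N\,G_2^*(N\tau)-G_2^*(\tau)$. Let $$u_6(\tau)=\frac{6\,\eta(2\tau)\eta(6\tau)^5+\eta(\tau)^5\eta(3\tau)}{12\,\eta(2\tau)\eta(6\tau)^5+\eta(\tau)^5\eta(3\tau)},$$ a meromorphic function on $\mathbb H$. Then the following hold. (1) For every $\tau\in\mathbb H$ at which the denominator of $u_6(\tau)$ and $G_{2,2}(\tau)$ are nonzero, $6u_6(\tau)^2-6u_6(\tau)-3\neq0$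 and $$\frac{G_{2,2}(3\tau)}{G_{2,2}(\tau)}=\frac{-2u_6(\tau)^2-2u_6(\tau)+1}{6u_6(\tau)^2-6u_6(\tau)-3}.$$ (2) For every $\tau\in\mathbb H$ at which the denominator of $u_6(\tau)$ and $G_{2,3}(\tau)$ are nonzero, $$\frac{G_{2,3}(2\tau)}{G_{2,3}(\tau)}=u_6(\tau)^2.$$ (3) For every $\tau\in\mathbb H$ at which the denominators of $u_6(\tau)$ and $u_6(3\tau)$ are nonzero, $x=u_6(\tau)$ and $y=u_6(3\tau)$ satisfy $$16x^3y^3-12(x^3y+xy^3)+12x^2y^2-5(x^3-y^3)-3(x^2y-xy^2)-6(x^2+y^2)+6xy+2=0.$$ (4) The denominator of $u_6$ does not vanish at the four points below, and $$u_6\Big(\frac{3+\sqrt{-15}}6\Big)=\frac{\sqrt5}2,\qquad u_6\Big(\frac i{\sqrt2}\Big)=\frac15+\frac{3\sqrt6}{10},$$ $$u_6(i)=\frac{3^{3/4}\sqrt2-1+\sqrt3}4,\qquad u_6\Big(\frac i3\Big)=\frac{3^{3/4}\sqrt2+1-\sqrt3}4.$$ -/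

import Mathlib

open Filter Topology

/-- The non-holomorphic Eisenstein series `G_k(s, τ)` of weight `k`, half of the sum over all
integer pairs `(m, n) ≠ (0, 0)`; it is absolutely convergent for `Re (2 s + k) > 2` and
`Im τ > 0`. -/
noncomputable def nonholEisenstein (k : ℕ) (s τ : ℂ) : ℂ :=
  (1 / 2) * ∑' p : {p : ℤ × ℤ // p ≠ (0, 0)},
    (1 / ((p.1.1 : ℂ) * τ + (p.1.2 : ℂ)) ^ k) *
      ((τ.im : ℂ) ^ s / ((‖(p.1.1 : ℂ) * τ + (p.1.2 : ℂ)‖ : ℝ) : ℂ) ^ (2 * s))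

/-- The almost holomorphic Eisenstein series `G₂^*(τ)` of weight two: the limit of `G_2(s, τ)` as
`s → 0` within the half-plane `Re s > 0`. -/
noncomputable def G2star (τ : ℂ) : ℂ :=
  limUnder (𝓝[{s : ℂ | 0 < s.re}] 0) (fun s : ℂ => nonholEisenstein 2 s τ)

/-- The weight two Eisenstein series `G_{2,N}(τ) = N G₂^*(N τ) - G₂^*(τ)` on `Γ₀(N)`. -/
noncomputable def G2level (N : ℕ) (τ : ℂ) : ℂ :=
  (N : ℂ) * G2star ((N : ℂ) * τ) - G2star τ

/-- The numerator of the function `u₆`. -/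
noncomputable def u6Num (τ : ℂ) : ℂ :=
  6 * ModularForm.eta (2 * τ) * ModularForm.eta (6 * τ) ^ 5
    + ModularForm.eta τ ^ 5 * ModularForm.eta (3 * τ)

/-- The denominator of the function `u₆`; it has zeros in the upper half-plane, and these are the
poles of `u₆`. -/
noncomputable def u6Den (τ : ℂ) : ℂ :=
  12 * ModularForm.eta (2 * τ) * ModularForm.eta (6 * τ) ^ 5
    + ModularForm.eta τ ^ 5 * ModularForm.eta (3 * τ)

/-- The hauptmodul `u₆` as a quotient of combinations of eta products. -/
noncomputable def u6 (τ : ℂ) : ℂ := u6Num τ / u6Den τ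

open Asymptotics

/-! ### A Liouville principle on the upper half-plane -/

/-! Let a(q) = ∑ q^(m²+mn+n²) be the theta function of the hexagonal lattice. Everything rests on
u₆(τ) = a(q²)/a(q) (`u6_eq`), which replaces the eta quotients by a weight one form whose Fricke
transformation comes from Poisson summation (`cubicA_fricke`).

The bridge is that a(q) − a(q²), 2a(q²) − a(q), a(q) + a(q²), a(q) + 2a(q²) are 6, 1, 2, 3 times eta
quotients of level six, each vanishing at a single cusp. The Atkin–Lehner involutions W₆ and W₃
permute the 24th powers of the four ratios of theta side to eta side. Hence the product of the four
functions ratio²⁴ − 1 is invariant under W₆, W₃ and τ ↦ τ + 1. It is bounded at i∞ and one factor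
tends to 0 there, while every orbit meets Im τ ≥ 1/10; the maximum principle then makes it zero
(`eq_zero_of_atkin_lehner_six`). So one factor vanishes identically, by permutation all do
(`ratios_pow_eq_one`), and each ratio is a constant root of unity, equal to 1 by positivity on the
imaginary axis. The same argument at level three expresses b(q) and c(q) by eta functions
(`cubicB_eq`, `cubicC_eq`).

For (1) and (2), Hecke's trick gives G₂^* = ζ(2)E₂ − const/Im τ (`G2star_eq`), and the second term
cancels in G_{2,N}. The Liouville principle identifies 3E₂(3τ) − E₂(τ) with 2a(q)² (`eisThree_eq`),
and 2E₂(2τ) − E₂(τ), together with its value at 3τ, with quadratic forms in a(q), a(q²)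
(`eisTwo_eq`). Dividing by a(q)² gives both ratios.

For (3), the eta formulas make u₆(τ) and u₆(3τ) rational functions of b(q) : b(q²), and the modular
equation becomes a polynomial identity. For (4), at each of three points on the imaginary axis the
Fricke involution turns a value of b or c into a known multiple of a(q), so that a cubic relation
becomes an equation for u₆, whose root is selected by 1/2 < u₆ < 1. At (3+√−15)/6 a Hecke relation
for the prime 2 is used together with the quadratic equation of the point. -/

lemma isOpen_im_pos : IsOpen {z : ℂ | 0 < z.im} := isOpen_lt continuous_const Complex.continuous_im

lemma isPreconnected_im_pos : IsPreconnected {z : ℂ | 0 < z.im} :=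
  (convex_halfSpace_im_gt 0).isPreconnected

/-- The filter of neighbourhoods of the cusp `i∞`. -/
def cuspFilter : Filter ℂ := comap Complex.im atTop

instance cuspFilter_neBot : cuspFilter.NeBot := by
  refine comap_neBot fun t ht => ?_
  obtain ⟨M, hM⟩ := mem_atTop_sets.1 ht
  exact ⟨M * Complex.I, by simpa using hM M le_rfl⟩

lemma eventually_im_ge (M : ℝ) : ∀ᶠ z in cuspFilter, M ≤ z.im :=
  (eventually_ge_atTop M).comap _

lemma eventually_im_pos : ∀ᶠ z in cuspFilter, 0 < z.im :=
  (eventually_im_ge 1).mono fun _ h => one_pos.trans_le h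

lemma add_int_eq_of_periodic {f : ℂ → ℂ} (hper : ∀ τ : ℂ, 0 < τ.im → f (τ + 1) = f τ)
    {τ : ℂ} (hτ : 0 < τ.im) (n : ℤ) : f (τ + n) = f τ := by
  induction n using Int.induction_on with
  | zero => simp
  | succ i ih =>
    rw [← ih, ← hper (τ + (i : ℤ)) (by simpa using hτ)]
    push_cast; ring_nf
  | pred i ih =>
    rw [← ih, ← hper (τ + ((-(i : ℤ) - 1 : ℤ) : ℂ)) (by simpa using hτ)]
    push_cast; ring_nf

lemma exists_abs_re_le_half {f : ℂ → ℂ} (hper : ∀ τ : ℂ, 0 < τ.im → f (τ + 1) = f τ)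
    {τ : ℂ} (hτ : 0 < τ.im) : ∃ τ' : ℂ, |τ'.re| ≤ 1 / 2 ∧ τ'.im = τ.im ∧ f τ' = f τ := by
  refine ⟨τ + ((-round τ.re : ℤ) : ℂ), ?_, by simp, add_int_eq_of_periodic hper hτ _⟩
  simpa [← sub_eq_add_neg] using abs_sub_round τ.re

/-- A nonzero value f(τ) is larger in modulus than everything above some height M. Periodicity and
`hmove` bring all values of at least that modulus into a compact rectangle, so |f| has a global
maximum, f is constant, and the limit at the cusp contradicts f(τ) ≠ 0. -/
theorem eq_zero_of_tendsto_zero_of_reduction {f : ℂ → ℂ} {c : ℝ} (hc : 0 < c)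
    (hf : DifferentiableOn ℂ f {z | 0 < z.im})
    (hper : ∀ τ : ℂ, 0 < τ.im → f (τ + 1) = f τ)
    (hmove : ∀ τ : ℂ, 0 < τ.im → ∃ τ' : ℂ, c ≤ τ'.im ∧ f τ' = f τ)
    (hlim : Tendsto f cuspFilter (𝓝 0)) {τ : ℂ} (hτ : 0 < τ.im) : f τ = 0 := by
  by_contra hne
  have hε : 0 < ‖f τ‖ := norm_pos_iff.2 hne
  obtain ⟨M, hM⟩ : ∃ M : ℝ, ∀ z : ℂ, M ≤ z.im → ‖f z‖ < ‖f τ‖ := by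
    have h := hlim.norm.eventually (gt_mem_nhds (by rwa [norm_zero]))
    rw [cuspFilter, eventually_comap] at h
    obtain ⟨M, hM⟩ := eventually_atTop.1 h
    exact ⟨M, fun z hz => hM z.im hz z rfl⟩
  set K : Set ℂ := Set.Icc (-(1 / 2)) (1 / 2) ×ℂ Set.Icc c M with hK
  have hKc : IsCompact K := isCompact_Icc.reProdIm isCompact_Icc
  have key : ∀ z : ℂ, 0 < z.im → ‖f τ‖ ≤ ‖f z‖ → ∃ w ∈ K, f w = f z := by
    intro z hz hzτ
    obtain ⟨z', hz', e⟩ := hmove z hz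
    obtain ⟨w, hw1, hw2, hw3⟩ := exists_abs_re_le_half hper (hc.trans_le hz')
    refine ⟨w, ⟨abs_le.1 hw1, ?_, ?_⟩, hw3.trans e⟩
    · simpa [hw2] using hz'
    · by_contra h
      have := hM w (not_le.1 h).le
      rw [hw3, e] at this
      exact absurd hzτ (not_le.2 this)
  have hKsub : K ⊆ {z | 0 < z.im} := fun z hz => hc.trans_le hz.2.1
  obtain ⟨w₀, hw₀, hw₀'⟩ := key τ hτ le_rfl
  obtain ⟨z₁, hz₁, hmax⟩ := hKc.exists_isMaxOn ⟨w₀, hw₀⟩ (hf.continuousOn.mono hKsub).norm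
  have hge : ‖f τ‖ ≤ ‖f z₁‖ := by rw [← hw₀']; exact hmax hw₀
  have hmax' : IsMaxOn (norm ∘ f) {z | 0 < z.im} z₁ := by
    intro z hz
    by_cases h : ‖f τ‖ ≤ ‖f z‖
    · obtain ⟨w, hw, e⟩ := key z hz h
      simpa [e] using hmax hw
    · exact (not_le.1 h).le.trans hge
  have hconst := Complex.eqOn_of_isPreconnected_of_isMaxOn_norm isPreconnected_im_pos
    isOpen_im_pos hf (hKsub hz₁) hmax'
  have h2 : Tendsto f cuspFilter (𝓝 (f z₁)) :=
    tendsto_const_nhds.congr' (eventually_im_pos.mono fun z hz => (hconst hz).symm)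
  have h0 := tendsto_nhds_unique h2 hlim
  rw [h0, norm_zero] at hge
  exact absurd hge (not_le.2 hε)

/-- If points below height `c` can be raised by a fixed factor, every point can be raised to
height `c`. -/
lemma exists_im_ge_of_step {f : ℂ → ℂ} {c r : ℝ} (hr : 1 < r)
    (hstep : ∀ τ : ℂ, 0 < τ.im → τ.im < c → ∃ τ' : ℂ, r * τ.im ≤ τ'.im ∧ f τ' = f τ)
    (τ : ℂ) (hτ : 0 < τ.im) : ∃ τ' : ℂ, c ≤ τ'.im ∧ f τ' = f τ := by
  have key : ∀ n : ℕ, ∀ τ : ℂ, 0 < τ.im → c ≤ r ^ n * τ.im → ∃ τ' : ℂ, c ≤ τ'.im ∧ f τ' = f τ := by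
    intro n
    induction n with
    | zero => exact fun τ _ h => ⟨τ, by simpa using h, rfl⟩
    | succ n ih =>
      intro τ hτ h
      by_cases hc : c ≤ τ.im
      · exact ⟨τ, hc, rfl⟩
      · obtain ⟨τ₁, h₁, e₁⟩ := hstep τ hτ (not_le.1 hc)
        have hpos : 0 < τ₁.im := (mul_pos (one_pos.trans hr) hτ).trans_le h₁
        obtain ⟨τ', h', e'⟩ := ih τ₁ hpos (by
          calc c ≤ r ^ n * (r * τ.im) := by rw [← mul_assoc, ← pow_succ]; exact h
            _ ≤ _ := by gcongr)
        exact ⟨τ', h', e'.trans e₁⟩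
  obtain ⟨n, hn⟩ := pow_unbounded_of_one_lt (c / τ.im) hr
  exact key n τ hτ ((div_le_iff₀ hτ).1 hn.le)

lemma im_fricke (N : ℝ) (τ : ℂ) : (-1 / ((N : ℂ) * τ)).im = τ.im / (N * Complex.normSq τ) := by
  rw [Complex.div_im]
  simp only [map_mul, Complex.normSq_ofReal]
  simp
  rcases eq_or_ne N 0 with rfl | hN
  · simp
  · field_simp

lemma im_fricke_pos {N : ℝ} (hN : 0 < N) {τ : ℂ} (hτ : 0 < τ.im) :
    0 < (-1 / ((N : ℂ) * τ)).im := by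
  rw [im_fricke]
  have : 0 < Complex.normSq τ := Complex.normSq_pos.2 (by rintro rfl; simp at hτ)
  positivity

lemma im_atkin_lehner (τ : ℂ) :
    ((3 * τ - 2) / (6 * τ - 3)).im = τ.im / (3 * Complex.normSq (2 * τ - 1)) := by
  have e : (6 * τ - 3 : ℂ) = 3 * (2 * τ - 1) := by ring
  rw [e, Complex.div_im]
  simp only [map_mul, Complex.normSq_ofNat]
  simp
  rcases eq_or_ne (Complex.normSq (2 * τ - 1)) 0 with h | h
  · simp [h]
  · field_simp
    ring

/-- With |Re w| ≤ 1/2 and Im w < 1/10 one has 3|w|² ≤ 9/10, so the Fricke involution raises the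
imaginary part by a factor at least 10/9. -/
theorem eq_zero_of_fricke_three {f : ℂ → ℂ} (hf : DifferentiableOn ℂ f {z | 0 < z.im})
    (hper : ∀ τ : ℂ, 0 < τ.im → f (τ + 1) = f τ)
    (hW : ∀ τ : ℂ, 0 < τ.im → f (-1 / (3 * τ)) = f τ)
    (hlim : Tendsto f cuspFilter (𝓝 0)) {τ : ℂ} (hτ : 0 < τ.im) : f τ = 0 := by
  refine eq_zero_of_tendsto_zero_of_reduction (c := 1 / 10) (by norm_num) hf hper ?_ hlim hτ
  refine exists_im_ge_of_step (r := 10 / 9) (by norm_num) fun τ hτ hc => ?_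
  obtain ⟨w, hw1, hw2, hw3⟩ := exists_abs_re_le_half hper hτ
  have hw : 0 < w.im := by rwa [hw2]
  refine ⟨-1 / (3 * w), ?_, (hW w hw).trans hw3⟩
  have := im_fricke 3 w
  push_cast at this
  rw [this, ← hw2, le_div_iff₀ (by
    have : 0 < Complex.normSq w := Complex.normSq_pos.2 (by rintro rfl; simp at hw)
    positivity)]
  rw [Complex.normSq_apply]
  rw [← hw2] at hc
  obtain ⟨h1, h2⟩ := abs_le.1 hw1
  have : w.re * w.re + w.im * w.im ≤ 3 / 10 := by nlinarith
  nlinarith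

/-- The strip |Re w| ≤ 1/2 is too wide for W₆ alone: near Re w = ±1/2 the number 6|w|² may exceed 1.
There W₃, which divides the imaginary part by 3|2w − 1|², does the raising, after a unit translation
if Re w is negative. -/
theorem eq_zero_of_atkin_lehner_six {f : ℂ → ℂ} (hf : DifferentiableOn ℂ f {z | 0 < z.im})
    (hper : ∀ τ : ℂ, 0 < τ.im → f (τ + 1) = f τ)
    (hW₆ : ∀ τ : ℂ, 0 < τ.im → f (-1 / (6 * τ)) = f τ)
    (hW₃ : ∀ τ : ℂ, 0 < τ.im → f ((3 * τ - 2) / (6 * τ - 3)) = f τ)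
    (hlim : Tendsto f cuspFilter (𝓝 0)) {τ : ℂ} (hτ : 0 < τ.im) : f τ = 0 := by
  refine eq_zero_of_tendsto_zero_of_reduction (c := 1 / 10) (by norm_num) hf hper ?_ hlim hτ
  refine exists_im_ge_of_step (r := 10 / 9) (by norm_num) fun τ hτ hc => ?_
  obtain ⟨w, hw1, hw2, hw3⟩ := exists_abs_re_le_half hper hτ
  have hw : 0 < w.im := by rwa [hw2]
  rw [← hw2] at hc
  obtain ⟨h1, h2⟩ := abs_le.1 hw1
  have hne : ∀ z : ℂ, 0 < z.im → 0 < Complex.normSq z :=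
    fun z hz => Complex.normSq_pos.2 (by rintro rfl; simp at hz)
  have near : ∀ z : ℂ, 0 < z.im → z.im < 1 / 10 → 1 / 3 ≤ z.re → z.re ≤ 2 / 3 →
      10 / 9 * z.im ≤ ((3 * z - 2) / (6 * z - 3)).im := by
    intro z hz hz' h1 h2
    rw [im_atkin_lehner, le_div_iff₀ (by
      have := hne (2 * z - 1) (by simpa using hz)
      positivity)]
    have : Complex.normSq (2 * z - 1) ≤ 2 / 10 := by
      rw [Complex.normSq_apply]
      simp
      nlinarith
    nlinarith
  by_cases hA : |w.re| ≤ 1 / 3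
  · obtain ⟨h1, h2⟩ := abs_le.1 hA
    refine ⟨-1 / (6 * w), ?_, (hW₆ w hw).trans hw3⟩
    have := im_fricke 6 w
    push_cast at this
    rw [this, ← hw2, le_div_iff₀ (by have := hne w hw; positivity)]
    have : Complex.normSq w ≤ 14 / 100 := by
      rw [Complex.normSq_apply]
      nlinarith
    nlinarith
  · rcases le_total 0 w.re with h0 | h0
    · rw [abs_of_nonneg h0, not_le] at hA
      exact ⟨_, by rw [← hw2]; exact near w hw hc hA.le (by linarith), (hW₃ w hw).trans hw3⟩
    · rw [abs_of_nonpos h0, not_le] at hA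
      have hw' : 0 < (w + 1).im := by simpa using hw
      refine ⟨_, ?_, (hW₃ (w + 1) hw').trans ((hper w hw).trans hw3)⟩
      have := near (w + 1) hw' (by simpa using hc) (by simp; linarith) (by simp; linarith)
      simpa [hw2] using this

/-! ### Holomorphic functions on the upper half-plane -/

/-- By the identity theorem, holomorphic functions on a connected open set form an integral domain.
-/
lemma eq_zero_or_eq_zero_of_mul_eq_zero_im_pos {f g : ℂ → ℂ}
    (hf : DifferentiableOn ℂ f {z | 0 < z.im}) (hg : DifferentiableOn ℂ g {z | 0 < z.im})
    (h : ∀ τ : ℂ, 0 < τ.im → f τ * g τ = 0) :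
    (∀ τ : ℂ, 0 < τ.im → f τ = 0) ∨ ∀ τ : ℂ, 0 < τ.im → g τ = 0 := by
  by_contra! hcon
  obtain ⟨⟨z, hz, hfz⟩, w, hw, hgw⟩ := hcon
  have hnhds : {z : ℂ | 0 < z.im} ∈ 𝓝 z := isOpen_im_pos.mem_nhds hz
  have h1 : ∀ᶠ t in 𝓝 z, f t ≠ 0 :=
    (hf.continuousOn.continuousAt hnhds).eventually_ne hfz
  have h2 : g =ᶠ[𝓝 z] 0 := by
    filter_upwards [h1, hnhds] with t ht ht'
    exact (mul_eq_zero.1 (h t ht')).resolve_left ht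
  exact hgw ((hg.analyticOnNhd isOpen_im_pos).eqOn_zero_of_preconnected_of_eventuallyEq_zero
    isPreconnected_im_pos hz h2 hw)

/-- A holomorphic function some power of which is `1` is constant. -/
lemma eq_of_pow_eq_one_im_pos {f : ℂ → ℂ} {n : ℕ} (hn : n ≠ 0)
    (hf : DifferentiableOn ℂ f {z | 0 < z.im}) (h : ∀ τ : ℂ, 0 < τ.im → f τ ^ n = 1)
    {z w : ℂ} (hz : 0 < z.im) (hw : 0 < w.im) : f z = f w := by
  have hS : {x : ℂ | x ^ n = 1}.Finite := by
    have h0 : (Polynomial.X ^ n - 1 : Polynomial ℂ) ≠ 0 :=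
      Polynomial.X_pow_sub_C_ne_zero (Nat.pos_of_ne_zero hn) 1
    refine (Polynomial.finite_setOfPred_isRoot h0).subset fun x hx => ?_
    have : x ^ n = 1 := hx
    simp [Polynomial.IsRoot, this]
  have hdisc : IsDiscrete {x : ℂ | x ^ n = 1} := hS.isDiscrete
  exact isPreconnected_im_pos.constant_of_mapsTo hdisc hf.continuousOn (fun τ hτ => h τ hτ) hz hw

/-! ### The cubic theta function -/

/-- The exponent `m² + mn + n²`. -/
def hexForm (p : ℤ × ℤ) : ℤ := p.1 ^ 2 + p.1 * p.2 + p.2 ^ 2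

/-- The summand of the cubic theta function. -/
noncomputable def cubicTerm (τ : ℂ) (p : ℤ × ℤ) : ℂ :=
  Complex.exp (2 * Real.pi * Complex.I * τ * hexForm p)

/-- The theta function of the hexagonal lattice, `∑ q ^ (m² + mn + n²)`. -/
noncomputable def cubicA (τ : ℂ) : ℂ := ∑' p : ℤ × ℤ, cubicTerm τ p

lemma norm_cubicTerm (τ : ℂ) (p : ℤ × ℤ) :
    ‖cubicTerm τ p‖ = Real.exp (-2 * Real.pi * τ.im * hexForm p) := by
  rw [cubicTerm, Complex.norm_exp]
  congr 1
  simp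

/-- Twice the form is m² + n² + (m + n)². Comparison with |m| + |n| reduces all summability to
geometric series. -/
lemma hexForm_ge (p : ℤ × ℤ) : p.1.natAbs + p.2.natAbs ≤ 2 * hexForm p := by
  obtain ⟨m, n⟩ := p
  simp only [hexForm, Int.natCast_natAbs]
  have h1 : |m| ≤ m ^ 2 := by rw [← sq_abs]; rcases eq_or_ne m 0 with rfl | h; · simp
                              nlinarith [Int.one_le_abs h]
  have h2 : |n| ≤ n ^ 2 := by rw [← sq_abs]; rcases eq_or_ne n 0 with rfl | h; · simp
                              nlinarith [Int.one_le_abs h]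
  nlinarith [sq_nonneg (m + n)]

lemma hexForm_nonneg (p : ℤ × ℤ) : 0 ≤ hexForm p := by
  have := hexForm_ge p
  omega

lemma hexForm_pos {p : ℤ × ℤ} (hp : p ≠ 0) : 1 ≤ hexForm p := by
  have := hexForm_ge p
  have : p.1 ≠ 0 ∨ p.2 ≠ 0 := by
    by_contra! h
    exact hp (Prod.ext h.1 h.2)
  omega

lemma summable_pow_natAbs {r : ℝ} (h0 : 0 ≤ r) (h1 : r < 1) :
    Summable fun n : ℤ => r ^ n.natAbs := by
  refine Summable.of_nat_of_neg ?_ ?_ <;> simpa using summable_geometric_of_lt_one h0 h1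

lemma summable_exp_hexForm {t : ℝ} (ht : 0 < t) :
    Summable fun p : ℤ × ℤ => Real.exp (-t * hexForm p) := by
  have h1 : Real.exp (-(t / 2)) < 1 := by rw [Real.exp_lt_one_iff]; linarith
  have hs := summable_pow_natAbs (Real.exp_pos _).le h1
  refine Summable.of_nonneg_of_le (fun _ => (Real.exp_pos _).le) (fun p => ?_)
    (hs.mul_of_nonneg hs (fun _ => by positivity) (fun _ => by positivity))
  rw [← pow_add, ← Real.exp_nat_mul, Real.exp_le_exp]
  have : ((p.1.natAbs + p.2.natAbs : ℕ) : ℝ) ≤ 2 * hexForm p := by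
    have h := (Int.cast_le (R := ℝ)).2 (hexForm_ge p)
    rw [Nat.cast_add, Nat.cast_natAbs, Nat.cast_natAbs]
    push_cast at h ⊢
    exact h
  nlinarith

lemma summable_norm_cubicTerm {τ : ℂ} (hτ : 0 < τ.im) : Summable fun p => ‖cubicTerm τ p‖ := by
  simp_rw [norm_cubicTerm]
  convert summable_exp_hexForm (t := 2 * Real.pi * τ.im) (by positivity) using 3
  ring

lemma summable_cubicTerm {τ : ℂ} (hτ : 0 < τ.im) : Summable (cubicTerm τ) :=
  (summable_norm_cubicTerm hτ).of_norm

lemma differentiableOn_cubicA : DifferentiableOn ℂ cubicA {z | 0 < z.im} := by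
  intro z hz
  have hz' : 0 < z.im := hz
  -- On the half-plane Im w > Im z / 2 the terms are dominated by the summable family with exponent
  -- π · Im z.
  have hopen : IsOpen {w : ℂ | z.im / 2 < w.im} := isOpen_lt continuous_const Complex.continuous_im
  have := Complex.differentiableOn_tsum_of_summable_norm (F := fun p τ => cubicTerm τ p)
    (summable_exp_hexForm (t := Real.pi * z.im) (by positivity))
    (fun p => by unfold cubicTerm; fun_prop) hopen (fun p w hw => by
      rw [norm_cubicTerm, Real.exp_le_exp]
      have hw' : z.im / 2 < w.im := hw
      have : (0 : ℝ) ≤ hexForm p := by exact_mod_cast hexForm_nonneg p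
      have h2 := mul_le_mul_of_nonneg_left hw'.le (mul_nonneg Real.pi_pos.le this)
      nlinarith)
  exact (this.differentiableAt (hopen.mem_nhds (by simpa using hz'))).differentiableWithinAt

lemma cubicTerm_add_one (τ : ℂ) (p : ℤ × ℤ) : cubicTerm (τ + 1) p = cubicTerm τ p := by
  rw [cubicTerm, cubicTerm, Complex.exp_eq_exp_iff_exists_int]
  exact ⟨hexForm p, by ring⟩

lemma cubicA_add_one (τ : ℂ) : cubicA (τ + 1) = cubicA τ := by
  simp only [cubicA, cubicTerm_add_one]

lemma cubicA_sub_one (τ : ℂ) : cubicA (τ - 1) = cubicA τ := by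
  rw [← cubicA_add_one, sub_add_cancel]

/-- The transformation law of the cubic theta function under the Fricke involution. -/
theorem cubicA_fricke {τ : ℂ} (hτ : 0 < τ.im) :
    cubicA (-1 / (3 * τ)) = -Complex.I * √3 * τ * cubicA τ := by
  have h0 : τ ≠ 0 := by rintro rfl; simp at hτ
  have hs := summable_cubicTerm hτ
  have hW : 0 < (-1 / (3 * τ)).im := by
    simpa using im_fricke_pos (N := 3) (by norm_num) hτ
  set c₁ : ℂ := 1 / (-Complex.I * (2 * τ)) ^ (1 / 2 : ℂ)
  set c₂ : ℂ := 1 / (-Complex.I * (3 * τ / 2)) ^ (1 / 2 : ℂ)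
  -- the summand after the first Poisson summation
  set g : ℤ → ℤ → ℂ := fun n k => Complex.exp (2 * Real.pi * Complex.I * τ * n ^ 2
    - Real.pi * Complex.I * n ^ 2 * τ / 2 + Real.pi * Complex.I * n * k
    - Real.pi * Complex.I * k ^ 2 / (2 * τ)) with hg
  have hcomm : ∀ x y z w : ℂ, x * (y * z * w) = y * (x * z * w) := by intros; ring
  -- For fixed n the sum over m is a Jacobi theta value at (nτ, 2τ), whose functional equation is
  -- the first Poisson summation.
  have e1 : ∀ n : ℤ, ∑' m : ℤ, cubicTerm τ (n, m) = c₁ * ∑' k : ℤ, g n k := by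
    intro n
    have : ∀ m : ℤ, cubicTerm τ (n, m) =
        Complex.exp (2 * Real.pi * Complex.I * τ * n ^ 2) * jacobiTheta₂_term m (n * τ) (2 * τ) := by
      intro m
      rw [cubicTerm, jacobiTheta₂_term, ← Complex.exp_add, hexForm]
      push_cast
      ring_nf
    simp_rw [this]
    rw [tsum_mul_left]
    change _ * jacobiTheta₂ _ _ = _
    rw [jacobiTheta₂_functional_equation, jacobiTheta₂, hcomm, ← tsum_mul_left]
    congr 1
    refine tsum_congr fun k => ?_
    simp only [hg]
    rw [jacobiTheta₂_term, ← Complex.exp_add, ← Complex.exp_add]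
    congr 1
    field_simp
    ring
  -- For fixed k the sum over n is again a Jacobi theta value, now at (k/2, 3τ/2). The sign in (k,
  -- −j) makes the cross term of the dual form positive and is removed by reflection.
  have e2 : ∀ k : ℤ, ∑' n : ℤ, g n k = c₂ * ∑' j : ℤ, cubicTerm (-1 / (3 * τ)) (k, -j) := by
    intro k
    have : ∀ n : ℤ, g n k = Complex.exp (-Real.pi * Complex.I * k ^ 2 / (2 * τ)) *
        jacobiTheta₂_term n (k / 2) (3 * τ / 2) := by
      intro n
      simp only [hg]
      rw [jacobiTheta₂_term, ← Complex.exp_add]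
      congr 1
      field_simp
      ring
    simp_rw [this]
    rw [tsum_mul_left]
    change _ * jacobiTheta₂ _ _ = _
    rw [jacobiTheta₂_functional_equation, jacobiTheta₂, hcomm, ← tsum_mul_left]
    congr 1
    refine tsum_congr fun j => ?_
    rw [cubicTerm, jacobiTheta₂_term, ← Complex.exp_add, ← Complex.exp_add, hexForm]
    congr 1
    push_cast
    field_simp
    ring
  -- The cross term exp(πi n k) has modulus 1, so the norm is a product of two one-variable theta
  -- terms; this justifies exchanging the two sums.
  have hgs : Summable (Function.uncurry g) := by
    have h1 : 0 < (3 * τ / 2).im := by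
      rw [mul_div_right_comm, show (3 / 2 : ℂ) = ((3 / 2 : ℝ) : ℂ) by push_cast; rfl,
        Complex.im_ofReal_mul]
      positivity
    have h2 : 0 < (-1 / (2 * τ)).im := by simpa using im_fricke_pos (N := 2) (by norm_num) hτ
    refine Summable.of_norm (((((summable_jacobiTheta₂_term_iff 0 _).2 h1).norm.mul_norm
      ((summable_jacobiTheta₂_term_iff 0 _).2 h2).norm)).congr fun p => ?_)
    obtain ⟨n, k⟩ := p
    have : g n k = jacobiTheta₂_term n 0 (3 * τ / 2) * jacobiTheta₂_term k 0 (-1 / (2 * τ)) *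
        Complex.exp (((Real.pi * n * k : ℝ) : ℂ) * Complex.I) := by
      simp only [hg]
      rw [jacobiTheta₂_term, jacobiTheta₂_term, ← Complex.exp_add, ← Complex.exp_add]
      congr 1
      push_cast
      field_simp
      ring
    rw [Function.uncurry_apply_pair, this, norm_mul _ (Complex.exp _), Complex.norm_exp_ofReal_mul_I,
      mul_one]
  have e3 : cubicA τ = c₁ * (c₂ * cubicA (-1 / (3 * τ))) := by
    have hs' : Summable fun p : ℤ × ℤ => cubicTerm (-1 / (3 * τ)) (p.1, -p.2) :=
      (Equiv.prodCongr (Equiv.refl ℤ) (Equiv.neg ℤ)).summable_iff.2 (summable_cubicTerm hW)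
    rw [cubicA, hs.tsum_prod]
    simp_rw [e1]
    rw [tsum_mul_left, ← (hgs.tsum_comm : _ = ∑' n, ∑' k, g n k)]
    simp_rw [e2]
    rw [tsum_mul_left, ← hs'.tsum_prod, cubicA]
    congr 2
    exact (Equiv.prodCongr (Equiv.refl ℤ) (Equiv.neg ℤ)).tsum_eq (cubicTerm (-1 / (3 * τ)))
  have hw0 : -Complex.I * τ ≠ 0 := by simp [h0]
  -- The two principal square roots multiply correctly because their arguments are positive real
  -- multiples of the same number −iτ.
  have hc : c₁ * c₂ * (√3 * (-Complex.I * τ)) = 1 := by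
    have e : (-Complex.I * (2 * τ)) ^ (1 / 2 : ℂ) * (-Complex.I * (3 * τ / 2)) ^ (1 / 2 : ℂ) =
        √3 * (-Complex.I * τ) := by
      rw [show -Complex.I * (2 * τ) = ((2 : ℝ) : ℂ) * (-Complex.I * τ) by push_cast; ring,
        show -Complex.I * (3 * τ / 2) = ((3 / 2 : ℝ) : ℂ) * (-Complex.I * τ) by push_cast; ring,
        Complex.cpow_def_of_ne_zero (by simp [h0]), Complex.cpow_def_of_ne_zero (by simp [h0]),
        Complex.log_ofReal_mul (by norm_num) hw0, Complex.log_ofReal_mul (by norm_num) hw0,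
        ← Complex.exp_add, show (√3 : ℝ) = Real.exp (Real.log 3 / 2) by
          rw [← Real.log_sqrt (by norm_num), Real.exp_log (by positivity)]]
      rw [show ((Real.log 2 : ℝ) + Complex.log (-Complex.I * τ)) * (1 / 2) +
        ((Real.log (3 / 2) : ℝ) + Complex.log (-Complex.I * τ)) * (1 / 2) =
        ((Real.log 3 / 2 : ℝ) : ℂ) + Complex.log (-Complex.I * τ) by
          rw [Real.log_div (by norm_num) (by norm_num)]; push_cast; ring,
        Complex.exp_add, Complex.exp_log hw0, Complex.ofReal_exp]
    rw [← e]
    have h1 : (-Complex.I * (2 * τ)) ^ (1 / 2 : ℂ) ≠ 0 := by simp [Complex.cpow_eq_zero_iff, h0]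
    have h2 : (-Complex.I * (3 * τ / 2)) ^ (1 / 2 : ℂ) ≠ 0 := by
      simp [Complex.cpow_eq_zero_iff, h0]
    simp only [c₁, c₂]
    field_simp
  rw [e3]
  linear_combination (-cubicA (-1 / (3 * τ))) * hc

/-! ### The nome and the behaviour of the cubic theta function at i∞. -/

/-- The nome `q = exp (2 π i τ)`. -/
noncomputable def nome (τ : ℂ) : ℂ := Complex.exp (2 * Real.pi * Complex.I * τ)

lemma nome_ne_zero (τ : ℂ) : nome τ ≠ 0 := Complex.exp_ne_zero _

lemma norm_nome (τ : ℂ) : ‖nome τ‖ = Real.exp (-2 * Real.pi * τ.im) := by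
  rw [nome, Complex.norm_exp]
  congr 1
  simp

lemma nome_nat_mul (n : ℕ) (τ : ℂ) : nome (n * τ) = nome τ ^ n := by
  rw [nome, nome, ← Complex.exp_nat_mul]
  ring_nf

lemma tendsto_nome : Tendsto nome cuspFilter (𝓝 0) := by
  rw [tendsto_zero_iff_norm_tendsto_zero]
  simp_rw [norm_nome]
  refine Real.tendsto_exp_atBot.comp ?_
  exact Tendsto.const_mul_atTop_of_neg (by linarith [Real.pi_pos]) tendsto_comap

lemma tendsto_nat_mul_cuspFilter {n : ℕ} (hn : 0 < n) :
    Tendsto (fun τ : ℂ => (n : ℂ) * τ) cuspFilter cuspFilter := by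
  refine tendsto_comap_iff.2 ?_
  have : (Complex.im ∘ fun τ : ℂ => (n : ℂ) * τ) = fun τ : ℂ => (n : ℝ) * τ.im := by
    ext τ; simp
  rw [this]
  exact Tendsto.const_mul_atTop (by exact_mod_cast hn) tendsto_comap

lemma tendsto_div_nat_cuspFilter {n : ℕ} (hn : 0 < n) :
    Tendsto (fun τ : ℂ => τ / n) cuspFilter cuspFilter := by
  refine tendsto_comap_iff.2 ?_
  have : (Complex.im ∘ fun τ : ℂ => τ / n) = fun τ : ℂ => τ.im / (n : ℝ) := by
    ext τ; simp
  rw [this]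
  exact Tendsto.atTop_div_const (by exact_mod_cast hn) tendsto_comap

lemma cubicA_sub_one_isBigO : (fun τ => cubicA τ - 1) =O[cuspFilter] nome := by
  set S := ∑' p : ℤ × ℤ, Real.exp (2 * Real.pi) * Real.exp (-(2 * Real.pi) * hexForm p)
  have hS : Summable fun p : ℤ × ℤ =>
      Real.exp (2 * Real.pi) * Real.exp (-(2 * Real.pi) * hexForm p) :=
    (summable_exp_hexForm (by positivity)).mul_left _
  refine Asymptotics.IsBigO.of_bound S ?_
  filter_upwards [eventually_im_ge 1] with τ hτ
  have hτ0 : 0 < τ.im := one_pos.trans_le hτ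
  have e : cubicA τ - 1 = ∑' p : ℤ × ℤ, if p = 0 then 0 else cubicTerm τ p := by
    rw [cubicA, (summable_cubicTerm hτ0).tsum_eq_add_tsum_ite 0]
    simp [cubicTerm, hexForm]
  rw [e, norm_nome, ← tsum_mul_right]
  refine tsum_of_norm_bounded (hS.mul_right _).hasSum fun p => ?_
  split_ifs with hp
  · simp; positivity
  -- One factor |q| is split off from |q|^h with h ≥ 1; the remaining power is at most exp(−2π(h −
  -- 1)) since Im τ ≥ 1.
  · rw [norm_cubicTerm, ← Real.exp_add, ← Real.exp_add, Real.exp_le_exp]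
    have h1 : (1 : ℝ) ≤ hexForm p := by exact_mod_cast hexForm_pos hp
    have := mul_nonneg Real.pi_pos.le (mul_nonneg (sub_nonneg.2 h1) (sub_nonneg.2 hτ))
    nlinarith

lemma tendsto_cubicA : Tendsto cubicA cuspFilter (𝓝 1) := by
  have := (cubicA_sub_one_isBigO.trans_tendsto tendsto_nome).add_const 1
  simpa using this

/-! ### The companion theta functions b and c, and relations from sublattices. -/

/-- The second cubic theta function. -/
noncomputable def cubicB (τ : ℂ) : ℂ := (3 * cubicA (3 * τ) - cubicA τ) / 2

/-- The third cubic theta function. -/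
noncomputable def cubicC (τ : ℂ) : ℂ := (cubicA (τ / 3) - cubicA τ) / 2

/-- A similarity g scaling the form by N identifies the part of the series supported on its image,
at τ/N, with the whole series at τ. -/
lemma tsum_cubicTerm_sublattice {τ : ℂ} {g : ℤ × ℤ → ℤ × ℤ} (hg : Function.Injective g) {N : ℕ}
    (hN : N ≠ 0) (hform : ∀ p, hexForm (g p) = N * hexForm p) (s : ℤ × ℤ → Prop)
    [DecidablePred s] (hs : ∀ p, s p ↔ p ∈ Set.range g) :
    ∑' p, (if s p then cubicTerm (τ / N) p else 0) = cubicA τ := by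
  rw [cubicA, ← hg.tsum_eq (f := fun p => if s p then cubicTerm (τ / N) p else 0)]
  · refine tsum_congr fun p => ?_
    rw [if_pos ((hs _).2 ⟨p, rfl⟩), cubicTerm, cubicTerm, hform]
    congr 1
    push_cast
    field_simp
  · intro p hp
    rw [← hs]
    by_contra h
    simp [h] at hp

/-- The pairs with 3 ∣ m − n are the image of a similarity of norm 3, so they contribute exactly the
subtracted copy of a(q). -/
lemma cubicC_eq_tsum {τ : ℂ} (hτ : 0 < τ.im) :
    cubicC τ = ∑' p : ℤ × ℤ, (if (3 : ℤ) ∣ p.1 - p.2 then 0 else cubicTerm (τ / 3) p) / 2 := by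
  have h3 : 0 < (τ / 3).im := by
    rw [show τ / 3 = τ / ((3 : ℝ) : ℂ) by push_cast; rfl, Complex.div_ofReal_im]; positivity
  have hinj : Function.Injective fun p : ℤ × ℤ => (p.1 + 2 * p.2, p.1 - p.2) := by
    rintro ⟨a, b⟩ ⟨c, d⟩ h
    simp only [Prod.mk.injEq] at h ⊢
    omega
  have h := tsum_cubicTerm_sublattice (τ := τ) (N := 3) hinj (by norm_num)
    (fun p => by simp only [hexForm]; push_cast; ring) (fun p => (3 : ℤ) ∣ p.1 - p.2) (fun p => by
      constructor
      · rintro ⟨k, hk⟩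
        exact ⟨(p.2 + k, k), Prod.ext (by simp; omega) (by simp)⟩
      · rintro ⟨x, rfl⟩
        exact ⟨x.2, by ring⟩)
  push_cast at h
  rw [tsum_div_const, cubicC, ← h, cubicA, ← Summable.tsum_sub (summable_cubicTerm h3)]
  · congr 1
    refine tsum_congr fun p => ?_
    split_ifs <;> simp
  · refine Summable.of_norm_bounded (summable_norm_cubicTerm h3) fun p => ?_
    split_ifs <;> simp

/-- The form is congruent to (m − n)² mod 3, so every exponent that survives in c is 1 mod 3. -/
lemma cubicC_add_one {τ : ℂ} (hτ : 0 < τ.im) :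
    cubicC (τ + 1) = Complex.exp (2 * Real.pi * Complex.I / 3) * cubicC τ := by
  rw [cubicC_eq_tsum hτ, cubicC_eq_tsum (by simpa using hτ), ← tsum_mul_left]
  refine tsum_congr fun p => ?_
  split_ifs with h
  · simp
  · rw [← mul_div_assoc]
    congr 1
    rw [cubicTerm, cubicTerm, ← Complex.exp_add, Complex.exp_eq_exp_iff_exists_int]
    obtain ⟨k, hk⟩ : (3 : ℤ) ∣ hexForm p - 1 := by
      obtain ⟨m, n⟩ := p
      simp only [hexForm] at h ⊢
      have h1 : (m - n) % 3 = 1 ∨ (m - n) % 3 = 2 := by omega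
      rcases h1 with h1 | h1
      · obtain ⟨j, hj⟩ : ∃ j, m = n + 3 * j + 1 := ⟨(m - n) / 3, by omega⟩
        exact ⟨n ^ 2 + 3 * n * j + 3 * j ^ 2 + n + 2 * j, by rw [hj]; ring⟩
      · obtain ⟨j, hj⟩ : ∃ j, m = n + 3 * j + 2 := ⟨(m - n) / 3, by omega⟩
        exact ⟨n ^ 2 + 3 * n * j + 3 * j ^ 2 + 2 * n + 4 * j + 1, by rw [hj]; ring⟩
    refine ⟨k, ?_⟩
    have : (hexForm p : ℂ) = 3 * k + 1 := by
      have : hexForm p = 3 * k + 1 := by omega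
      rw [this]; push_cast; ring
    rw [this]
    ring

/-- Averaging over τ/2 and (τ+1)/2 keeps the even exponents. The form is even only when m and n both
are, which leaves a(q⁴) in the variable of τ/2. -/
lemma two_mul_cubicA_two_mul {τ : ℂ} (hτ : 0 < τ.im) :
    2 * cubicA (2 * τ) = cubicA (τ / 2) + cubicA ((τ + 1) / 2) := by
  have h2 : ∀ z : ℂ, 0 < z.im → 0 < (z / 2).im := fun z hz => by
    rw [show z / 2 = z / ((2 : ℝ) : ℂ) by push_cast; rfl, Complex.div_ofReal_im]; positivity
  have hinj : Function.Injective fun p : ℤ × ℤ => (2 * p.1, 2 * p.2) := by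
    rintro ⟨a, b⟩ ⟨c, d⟩ h
    simp only [Prod.mk.injEq] at h ⊢
    omega
  have h := tsum_cubicTerm_sublattice (τ := 2 * τ) (N := 4) hinj (by norm_num)
    (fun p => by simp only [hexForm]; push_cast; ring) (fun p => (2 : ℤ) ∣ p.1 ∧ (2 : ℤ) ∣ p.2)
    (fun p => by
      constructor
      · rintro ⟨⟨k, hk⟩, l, hl⟩
        exact ⟨(k, l), Prod.ext hk.symm hl.symm⟩
      · rintro ⟨x, rfl⟩
        exact ⟨⟨x.1, rfl⟩, x.2, rfl⟩)
  have hd : 2 * τ / (4 : ℕ) = τ / 2 := by push_cast; ring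
  rw [hd] at h
  rw [← h, ← tsum_mul_left, cubicA, cubicA, ← Summable.tsum_add (summable_cubicTerm (h2 _ hτ))
    (summable_cubicTerm (h2 _ (by simpa using hτ)))]
  refine tsum_congr fun p => ?_
  have e : cubicTerm ((τ + 1) / 2) p =
      cubicTerm (τ / 2) p * Complex.exp (Real.pi * Complex.I * hexForm p) := by
    rw [cubicTerm, cubicTerm, ← Complex.exp_add]
    congr 1
    ring
  have e2 : Complex.exp (Real.pi * Complex.I * hexForm p) = (-1) ^ (hexForm p) := by
    rw [mul_comm, Complex.exp_int_mul, Complex.exp_pi_mul_I]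
  rw [e, e2]
  split_ifs with hp
  · have : Even (hexForm p) := by
      obtain ⟨⟨k, hk⟩, l, hl⟩ := hp
      rw [hexForm, hk, hl]
      exact ⟨2 * k ^ 2 + 2 * k * l + 2 * l ^ 2, by ring⟩
    rw [this.neg_one_zpow]
    ring
  · have : Odd (hexForm p) := by
      obtain ⟨m, n⟩ := p
      rw [← Int.not_even_iff_odd]
      simp only [hexForm, ← even_iff_two_dvd] at hp ⊢
      simp only [Int.even_add, Int.even_pow, Int.even_mul]
      tauto
    rw [this.neg_one_zpow]
    ring

/-! ### The cubic theta function on the imaginary axis -/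

/-- The values of the cubic theta function on the imaginary axis. -/
noncomputable def cubicAImag (y : ℝ) : ℝ := ∑' p : ℤ × ℤ, Real.exp (-(2 * Real.pi * y) * hexForm p)

lemma cubicA_I_mul (y : ℝ) : cubicA (Complex.I * y) = cubicAImag y := by
  rw [cubicA, cubicAImag, Complex.ofReal_tsum]
  refine tsum_congr fun p => ?_
  rw [cubicTerm, Complex.ofReal_exp]
  congr 1
  push_cast
  linear_combination (2 * Real.pi * y * hexForm p) * Complex.I_sq

lemma cubicAImag_pos {y : ℝ} (hy : 0 < y) : 0 < cubicAImag y :=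
  (summable_exp_hexForm (by positivity)).tsum_pos (fun _ => (Real.exp_pos _).le) 0 (Real.exp_pos _)

lemma cubicAImag_lt {x y : ℝ} (hx : 0 < x) (hxy : x < y) : cubicAImag y < cubicAImag x := by
  have hy := hx.trans hxy
  refine Summable.tsum_lt_tsum (i := (1, 0)) (fun p => ?_) ?_
    (summable_exp_hexForm (by positivity)) (summable_exp_hexForm (by positivity))
  · have : (0 : ℝ) ≤ hexForm p := by exact_mod_cast hexForm_nonneg p
    rw [Real.exp_le_exp]
    have := mul_nonneg (mul_nonneg Real.pi_pos.le (sub_nonneg.2 hxy.le)) this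
    nlinarith
  · rw [Real.exp_lt_exp]
    simp only [hexForm]
    have := mul_pos Real.pi_pos (sub_pos.2 hxy)
    norm_num
    nlinarith

/-! ### The discriminant and the Eisenstein series of weight two -/

/-- The 24th power of the Dedekind eta function. -/
noncomputable def etaPow (τ : ℂ) : ℂ := ModularForm.eta τ ^ 24

/-- The Eisenstein series `E₂`, as a function on `ℂ`. -/
noncomputable def eisE2 (τ : ℂ) : ℂ := EisensteinSeries.E2 (UpperHalfPlane.ofComplex τ)

lemma etaPow_ne_zero {τ : ℂ} (hτ : 0 < τ.im) : etaPow τ ≠ 0 :=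
  pow_ne_zero _ (ModularForm.eta_ne_zero hτ)

lemma differentiableOn_eta : DifferentiableOn ℂ ModularForm.eta {z | 0 < z.im} := fun _ hz =>
  (ModularForm.differentiableAt_eta_of_mem_upperHalfPlaneSet hz).differentiableWithinAt

lemma differentiableOn_etaPow : DifferentiableOn ℂ etaPow {z | 0 < z.im} :=
  differentiableOn_eta.pow 24

lemma differentiableOn_eisE2 : DifferentiableOn ℂ eisE2 {z | 0 < z.im} :=
  UpperHalfPlane.mdifferentiable_iff.1 E2_mdifferentiable

/-- The matrix with entries `a, b, c, d` as an element of `SL(2, ℤ)`. -/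
def slMatrix {a b c d : ℤ} (h : a * d - b * c = 1) : Matrix.SpecialLinearGroup (Fin 2) ℤ :=
  ⟨!![a, b; c, d], by rw [Matrix.det_fin_two_of, h]⟩

lemma coe_slMatrix_smul {a b c d : ℤ} (h : a * d - b * c = 1) (z : UpperHalfPlane) :
    ((slMatrix h • z : UpperHalfPlane) : ℂ) = (a * z + b) / (c * z + d) := by
  rw [UpperHalfPlane.specialLinearGroup_apply]
  simp [slMatrix]

lemma denom_slMatrix {a b c d : ℤ} (h : a * d - b * c = 1) (z : UpperHalfPlane) :
    UpperHalfPlane.denom (slMatrix h) z = c * z + d := by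
  rw [ModularGroup.denom_apply]
  simp [slMatrix]

lemma im_moebius_pos {a b c d : ℤ} (h : a * d - b * c = 1) {τ : ℂ} (hτ : 0 < τ.im) :
    0 < ((a * τ + b) / (c * τ + d)).im := by
  have := coe_slMatrix_smul h ⟨τ, hτ⟩
  rw [← UpperHalfPlane.coe_mk τ hτ, ← this]
  exact UpperHalfPlane.im_pos _

lemma moebius_denom_ne_zero {a b c d : ℤ} (h : a * d - b * c = 1) {τ : ℂ} (hτ : 0 < τ.im) :
    (c * τ + d : ℂ) ≠ 0 := by
  intro h0
  have := im_moebius_pos h hτ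
  rw [h0] at this
  simp at this

theorem etaPow_moebius {a b c d : ℤ} (h : a * d - b * c = 1) {τ : ℂ} (hτ : 0 < τ.im) :
    etaPow ((a * τ + b) / (c * τ + d)) = (c * τ + d) ^ 12 * etaPow τ := by
  have key := congrFun (SlashInvariantForm.slash_action_generators_SL2Z
    ModularForm.discriminant_S_invariant ModularForm.discriminant_T_invariant
    (slMatrix h)) ⟨τ, hτ⟩
  have hne := moebius_denom_ne_zero h hτ
  rw [ModularForm.SL_slash_apply, ModularForm.discriminant, coe_slMatrix_smul h,
    denom_slMatrix] at key
  simp [ModularForm.discriminant] at key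
  rw [etaPow, etaPow, ← key, mul_left_comm, mul_inv_cancel₀ (pow_ne_zero 12 hne), mul_one]

/-- The constant in the quasi-modularity of `E₂`. -/
noncomputable def quasiPeriod : ℂ := -(1 / (2 * riemannZeta 2) * (2 * Real.pi * Complex.I))

theorem eisE2_moebius {a b c d : ℤ} (h : a * d - b * c = 1) {τ : ℂ} (hτ : 0 < τ.im) :
    eisE2 ((a * τ + b) / (c * τ + d)) =
      (c * τ + d) ^ 2 * eisE2 τ + quasiPeriod * (c * (c * τ + d)) := by
  have key := congrFun (EisensteinSeries.E2_slash_action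
    (slMatrix h)) ⟨τ, hτ⟩
  have hne := moebius_denom_ne_zero h hτ
  have e : UpperHalfPlane.ofComplex ((a * τ + b) / (c * τ + d)) =
      slMatrix h •
        (⟨τ, hτ⟩ : UpperHalfPlane) := by
    rw [UpperHalfPlane.ofComplex_apply_of_im_pos (im_moebius_pos h hτ)]
    ext1
    exact (coe_slMatrix_smul h ⟨τ, hτ⟩).symm
  rw [ModularForm.SL_slash_apply, ← e, denom_slMatrix] at key
  have hD : EisensteinSeries.D2 (slMatrix h) ⟨τ, hτ⟩ = 2 * Real.pi * Complex.I * c / (c * τ + d) := by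
    rw [EisensteinSeries.D2, denom_slMatrix]
    simp [slMatrix]
  rw [Pi.sub_apply, Pi.smul_apply, hD, smul_eq_mul, zpow_neg] at key
  rw [eisE2, eisE2, UpperHalfPlane.ofComplex_apply_of_im_pos hτ, quasiPeriod]
  have e2 : ∀ x y : ℂ, x * ((c * τ + d) ^ 2)⁻¹ = y → x = (c * τ + d) ^ 2 * y := by
    rintro x y rfl
    field_simp
  rw [e2 _ _ key]
  field_simp
  ring

lemma etaPow_add_one {τ : ℂ} (hτ : 0 < τ.im) : etaPow (τ + 1) = etaPow τ := by
  simpa using etaPow_moebius (a := 1) (b := 1) (c := 0) (d := 1) (by norm_num) hτ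

lemma etaPow_neg_inv {τ : ℂ} (hτ : 0 < τ.im) : etaPow (-1 / τ) = τ ^ 12 * etaPow τ := by
  simpa using etaPow_moebius (a := 0) (b := -1) (c := 1) (d := 0) (by norm_num) hτ

lemma eisE2_add_one {τ : ℂ} (hτ : 0 < τ.im) : eisE2 (τ + 1) = eisE2 τ := by
  simpa using eisE2_moebius (a := 1) (b := 1) (c := 0) (d := 1) (by norm_num) hτ

lemma eisE2_neg_inv {τ : ℂ} (hτ : 0 < τ.im) :
    eisE2 (-1 / τ) = τ ^ 2 * eisE2 τ + quasiPeriod * τ := by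
  simpa using eisE2_moebius (a := 0) (b := -1) (c := 1) (d := 0) (by norm_num) hτ

lemma tendsto_coe_comap_atImInfty {f : ℂ → ℂ} {l : Filter ℂ}
    (h : Tendsto (fun z : UpperHalfPlane => f z) UpperHalfPlane.atImInfty l) :
    Tendsto f cuspFilter l := by
  intro s hs
  obtain ⟨M, hM⟩ := (UpperHalfPlane.atImInfty_mem _).1 (h hs)
  have : ∀ᶠ τ in cuspFilter, f τ ∈ s := by
    filter_upwards [eventually_im_ge M, eventually_im_pos] with τ h1 h2
    exact hM ⟨τ, h2⟩ h1
  exact this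

lemma tendsto_etaPow_div_nome : Tendsto (fun τ => etaPow τ / nome τ) cuspFilter (𝓝 1) := by
  refine tendsto_coe_comap_atImInfty
    (ModularForm.tendsto_atImInfty_tprod_one_sub_eta_q_pow.congr fun z => ?_)
  rw [eq_div_iff (nome_ne_zero _), mul_comm]
  have := ModularForm.discriminant_eq_q_prod z
  rw [ModularForm.discriminant] at this
  rw [etaPow, this]
  simp [nome, Function.Periodic.qParam]

lemma etaPow_isTheta : etaPow =Θ[cuspFilter] nome := by
  have h := tendsto_etaPow_div_nome
  have he : ∀ᶠ τ in cuspFilter, nome τ ≠ 0 := Eventually.of_forall nome_ne_zero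
  exact Asymptotics.IsEquivalent.isTheta
    ((Asymptotics.isEquivalent_iff_tendsto_one he).2 h)

lemma eisE2_sub_one_isBigO : (fun τ => eisE2 τ - 1) =O[cuspFilter] nome := by
  have hsum : Summable fun n : ℕ => (ArithmeticFunction.sigma 1 (n + 1) : ℝ) *
      Real.exp (-2 * Real.pi) ^ n := by
    have h := (EisensteinSeries.summable_sigma_mul_cexp_pow (k := 2) one_le_two
      UpperHalfPlane.I).norm
    refine (((summable_nat_add_iff 1).2 h).mul_left (Real.exp (2 * Real.pi))).congr fun n => ?_
    have hn : ‖Complex.exp (2 * Real.pi * Complex.I * UpperHalfPlane.I)‖ =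
        Real.exp (-2 * Real.pi) := by
      have := norm_nome UpperHalfPlane.I
      simpa [nome] using this
    rw [norm_mul, norm_pow, hn, Complex.norm_natCast, pow_succ]
    have : Real.exp (2 * Real.pi) * Real.exp (-2 * Real.pi) = 1 := by
      rw [← Real.exp_add]; simp
    linear_combination ((ArithmeticFunction.sigma 1 (n + 1) : ℝ) *
      Real.exp (-2 * Real.pi) ^ n) * this
  refine Asymptotics.IsBigO.of_bound
    (∑' n : ℕ, 24 * ((ArithmeticFunction.sigma 1 (n + 1) : ℝ) * Real.exp (-2 * Real.pi) ^ n)) ?_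
  filter_upwards [eventually_im_ge 1] with τ hτ
  have hτ0 : 0 < τ.im := one_pos.trans_le hτ
  have h := EisensteinSeries.hasSum_qExpansion_E2 (z := ⟨τ, hτ0⟩)
  -- Dropping the constant term shifts the index, and every remaining term then carries a factor q.
  rw [← hasSum_nat_add_iff' 1] at h
  have e : eisE2 τ = EisensteinSeries.E2 ⟨τ, hτ0⟩ := by
    rw [eisE2, UpperHalfPlane.ofComplex_apply_of_im_pos hτ0]
  simp at h
  rw [e, ← h.tsum_eq, ← tsum_mul_right]
  refine tsum_of_norm_bounded ((hsum.mul_left 24).mul_right _).hasSum fun n => ?_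
  have hq : ‖nome τ‖ ≤ Real.exp (-2 * Real.pi) := by
    rw [norm_nome, Real.exp_le_exp]
    nlinarith [Real.pi_pos]
  change ‖-(24 * (ArithmeticFunction.sigma 1 (n + 1) : ℂ) * nome τ ^ (n + 1))‖ ≤ _
  rw [norm_neg, norm_mul, norm_pow, norm_mul, Complex.norm_natCast, pow_succ]
  rw [Complex.norm_ofNat, ← mul_assoc, ← mul_assoc]
  gcongr

/-! ### Transformation tables -/

lemma im_mul_pos {n : ℕ} (hn : 0 < n) {τ : ℂ} (hτ : 0 < τ.im) : 0 < ((n : ℂ) * τ).im := by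
  rw [← Complex.ofReal_natCast, Complex.im_ofReal_mul]
  positivity

lemma im_two_mul_pos {τ : ℂ} (hτ : 0 < τ.im) : 0 < (2 * τ).im := im_mul_pos (n := 2) two_pos hτ
lemma im_three_mul_pos {τ : ℂ} (hτ : 0 < τ.im) : 0 < (3 * τ).im := im_mul_pos (n := 3) three_pos hτ
lemma im_six_mul_pos {τ : ℂ} (hτ : 0 < τ.im) : 0 < (6 * τ).im := im_mul_pos (n := 6) (by norm_num) hτ

lemma im_div_three_pos {τ : ℂ} (hτ : 0 < τ.im) : 0 < (τ / 3).im := by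
  rw [show τ / 3 = τ / ((3 : ℝ) : ℂ) by push_cast; rfl, Complex.div_ofReal_im]
  positivity

lemma ne_zero_of_im_pos {τ : ℂ} (hτ : 0 < τ.im) : τ ≠ 0 := by
  rintro rfl
  simp at hτ

lemma add_int_of_add_one {f : ℂ → ℂ} (hf : ∀ τ : ℂ, 0 < τ.im → f (τ + 1) = f τ) {n : ℕ}
    (hn : 0 < n) {τ : ℂ} (hτ : 0 < τ.im) : f (n * (τ + 1)) = f (n * τ) := by
  have := add_int_eq_of_periodic hf (im_mul_pos hn hτ) n
  rw [← this]
  push_cast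
  ring_nf

lemma cubicA_fricke_six {τ : ℂ} (hτ : 0 < τ.im) :
    cubicA (-1 / (6 * τ)) = -Complex.I * √3 * (2 * τ) * cubicA (2 * τ) := by
  rw [← cubicA_fricke (im_two_mul_pos hτ)]
  ring_nf

lemma cubicA_two_mul_fricke_six {τ : ℂ} (hτ : 0 < τ.im) :
    cubicA (2 * (-1 / (6 * τ))) = -Complex.I * √3 * τ * cubicA τ := by
  rw [← cubicA_fricke hτ]
  congr 1
  have := ne_zero_of_im_pos hτ
  field_simp
  norm_num

lemma sqrt_three_sq : ((√3 : ℝ) : ℂ) ^ 2 = 3 := by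
  rw [← Complex.ofReal_pow, Real.sq_sqrt (by norm_num)]
  norm_num

lemma neg_I_mul_sqrt_three_pow : (-Complex.I * √3) ^ 24 = (3 : ℂ) ^ 12 := by
  rw [show (-Complex.I * √3) ^ 24 = (Complex.I ^ 4) ^ 6 * (((√3 : ℝ) : ℂ) ^ 2) ^ 12 by ring,
    sqrt_three_sq, Complex.I_pow_four]
  norm_num

lemma neg_I_mul_sqrt_three_sq : (-Complex.I * √3) ^ 2 = (-3 : ℂ) := by
  rw [show (-Complex.I * √3) ^ 2 = Complex.I ^ 2 * ((√3 : ℝ) : ℂ) ^ 2 by ring,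
    sqrt_three_sq, Complex.I_sq]
  norm_num

lemma two_mul_sub_one_ne_zero {τ : ℂ} (hτ : 0 < τ.im) : 2 * τ - 1 ≠ 0 :=
  ne_zero_of_im_pos (by simpa using hτ)

lemma three_mul_sub_two_ne_zero {τ : ℂ} (hτ : 0 < τ.im) : 3 * τ - 2 ≠ 0 :=
  ne_zero_of_im_pos (by simpa using hτ)

lemma cubicA_two_mul_atkin_lehner {τ : ℂ} (hτ : 0 < τ.im) :
    cubicA (2 * ((3 * τ - 2) / (6 * τ - 3))) =
      -Complex.I * √3 * (2 * τ - 1) * cubicA (2 * τ) := by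
  have h := two_mul_sub_one_ne_zero hτ
  have e : 2 * ((3 * τ - 2) / (6 * τ - 3)) = -1 / (3 * (2 * τ - 1)) + 1 := by
    rw [show 6 * τ - 3 = 3 * (2 * τ - 1) by ring]
    field_simp
    ring
  rw [e, cubicA_add_one, cubicA_fricke (by simpa using hτ), cubicA_sub_one]

/-- W₃ is a word in τ ↦ τ − 1 and three Fricke involutions of level 3. The resulting sign is
opposite to that of `cubicA_two_mul_atkin_lehner`; this is why W₃ exchanges a(q) − a(q²) with a(q) +
a(q²). -/
lemma cubicA_atkin_lehner {τ : ℂ} (hτ : 0 < τ.im) :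
    cubicA ((3 * τ - 2) / (6 * τ - 3)) = Complex.I * √3 * (2 * τ - 1) * cubicA τ := by
  have h1 := two_mul_sub_one_ne_zero hτ
  have h2 := three_mul_sub_two_ne_zero hτ
  have h0 : τ - 1 ≠ 0 := ne_zero_of_im_pos (by simpa using hτ)
  have p1 : 0 < (τ - 1).im := by simpa using hτ
  have p2 : 0 < (-1 / (3 * (τ - 1)) - 1).im := by
    simpa using im_fricke_pos (N := 3) (by norm_num) p1
  have p3 : 0 < (-1 / (3 * (-1 / (3 * (τ - 1)) - 1)) - 1).im := by
    simpa using im_fricke_pos (N := 3) (by norm_num) p2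
  have n2 : -1 / (3 * (τ - 1)) - 1 = -(3 * τ - 2) / (3 * (τ - 1)) := by
    field_simp
    ring
  have n3 : -1 / (3 * (-1 / (3 * (τ - 1)) - 1)) - 1 = -(2 * τ - 1) / (3 * τ - 2) := by
    rw [n2]
    field_simp
    ring
  have e : (3 * τ - 2) / (6 * τ - 3) = -1 / (3 * (-1 / (3 * (-1 / (3 * (τ - 1)) - 1)) - 1)) := by
    rw [n3, show 6 * τ - 3 = 3 * (2 * τ - 1) by ring]
    field_simp
  rw [e, cubicA_fricke p3, cubicA_sub_one, cubicA_fricke p2, cubicA_sub_one, cubicA_fricke p1,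
    cubicA_sub_one, n3, n2]
  have e3 : (-Complex.I * √3) ^ 3 = -3 * (-Complex.I * √3) := by
    rw [pow_succ, neg_I_mul_sqrt_three_sq]
  rw [show Complex.I * √3 * (2 * τ - 1) * cubicA τ =
    -(-Complex.I * √3 * (2 * τ - 1) * cubicA τ) by ring]
  generalize -Complex.I * ((√3 : ℝ) : ℂ) = k at e3 ⊢
  trans k ^ 3 * (2 * τ - 1) * cubicA τ / 3
  · generalize 3 * τ - 2 = t at h2 ⊢
    generalize τ - 1 = v at h0 ⊢
    field_simp
  · rw [e3]
    ring

/-- Since N = de, the argument is −1/(eτ): the Fricke involution exchanges the scales d and e. -/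
lemma etaPow_scale_fricke {N d e : ℕ} (hN : d * e = N) (hd : 0 < d) (he : 0 < e) {τ : ℂ}
    (hτ : 0 < τ.im) :
    etaPow (d * (-1 / (N * τ))) = (e * τ) ^ 12 * etaPow (e * τ) := by
  rw [← etaPow_neg_inv (im_mul_pos he hτ), ← hN]
  congr 1
  have := ne_zero_of_im_pos hτ
  have hd' : (d : ℂ) ≠ 0 := by exact_mod_cast hd.ne'
  push_cast
  field_simp

/-- Each multiple of W₃τ is an SL(2, ℤ) image of another multiple of τ, so that W₃ exchanges the
scales 1 ↔ 3 and 2 ↔ 6. -/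
lemma etaPow_atkin_lehner {τ : ℂ} (hτ : 0 < τ.im) :
    etaPow ((3 * τ - 2) / (6 * τ - 3)) = (3 * (2 * τ - 1)) ^ 12 * etaPow (3 * τ) := by
  have := etaPow_moebius (a := 1) (b := -2) (c := 2) (d := -3) (by norm_num) (im_three_mul_pos hτ)
  convert this using 2 <;> push_cast <;> ring

lemma etaPow_two_mul_atkin_lehner {τ : ℂ} (hτ : 0 < τ.im) :
    etaPow (2 * ((3 * τ - 2) / (6 * τ - 3))) = (3 * (2 * τ - 1)) ^ 12 * etaPow (6 * τ) := by
  have := etaPow_moebius (a := 1) (b := -4) (c := 1) (d := -3) (by norm_num) (im_six_mul_pos hτ)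
  convert this using 2 <;> push_cast <;> ring

lemma etaPow_three_mul_atkin_lehner {τ : ℂ} (hτ : 0 < τ.im) :
    etaPow (3 * ((3 * τ - 2) / (6 * τ - 3))) = (2 * τ - 1) ^ 12 * etaPow τ := by
  have h1 := two_mul_sub_one_ne_zero hτ
  have := etaPow_moebius (a := 3) (b := -2) (c := 2) (d := -1) (by norm_num) hτ
  convert this using 2
  · rw [show 6 * τ - 3 = 3 * (2 * τ - 1) by ring]
    push_cast
    rw [← sub_eq_add_neg, ← sub_eq_add_neg]
    field_simp
  · push_cast; ring

lemma etaPow_six_mul_atkin_lehner {τ : ℂ} (hτ : 0 < τ.im) :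
    etaPow (6 * ((3 * τ - 2) / (6 * τ - 3))) = (2 * τ - 1) ^ 12 * etaPow (2 * τ) := by
  have h1 := two_mul_sub_one_ne_zero hτ
  have := etaPow_moebius (a := 3) (b := -4) (c := 1) (d := -1) (by norm_num) (im_two_mul_pos hτ)
  convert this using 2
  · rw [show 6 * τ - 3 = 3 * (2 * τ - 1) by ring]
    push_cast
    rw [← sub_eq_add_neg, ← sub_eq_add_neg, one_mul]
    field_simp
    ring
  · push_cast; ring

/-! ### Positive real values -/

/-- A complex number that is a positive real. -/
def IsPosReal (z : ℂ) : Prop := ∃ r : ℝ, 0 < r ∧ z = r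

namespace IsPosReal

variable {z w : ℂ}

lemma mul (hz : IsPosReal z) (hw : IsPosReal w) : IsPosReal (z * w) := by
  obtain ⟨r, hr, rfl⟩ := hz
  obtain ⟨s, hs, rfl⟩ := hw
  exact ⟨r * s, mul_pos hr hs, by push_cast; rfl⟩

lemma div (hz : IsPosReal z) (hw : IsPosReal w) : IsPosReal (z / w) := by
  obtain ⟨r, hr, rfl⟩ := hz
  obtain ⟨s, hs, rfl⟩ := hw
  exact ⟨r / s, div_pos hr hs, by push_cast; rfl⟩

lemma pow (hz : IsPosReal z) (n : ℕ) : IsPosReal (z ^ n) := by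
  obtain ⟨r, hr, rfl⟩ := hz
  exact ⟨r ^ n, pow_pos hr n, by push_cast; rfl⟩

lemma add (hz : IsPosReal z) (hw : IsPosReal w) : IsPosReal (z + w) := by
  obtain ⟨r, hr, rfl⟩ := hz
  obtain ⟨s, hs, rfl⟩ := hw
  exact ⟨r + s, add_pos hr hs, by push_cast; rfl⟩

lemma ofNat (n : ℕ) [n.AtLeastTwo] : IsPosReal (OfNat.ofNat n : ℂ) :=
  ⟨OfNat.ofNat n, Nat.ofNat_pos, by simp⟩

lemma eq_one_of_pow_eq_one (hz : IsPosReal z) {n : ℕ} (hn : n ≠ 0) (h : z ^ n = 1) : z = 1 := by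
  obtain ⟨r, hr, rfl⟩ := hz
  have h' : r ^ n = 1 := by exact_mod_cast h
  rw [(pow_eq_one_iff_of_nonneg hr.le hn).1 h', Complex.ofReal_one]

end IsPosReal

/-- On the imaginary axis the partial products lie in the closed half-line of nonnegative reals, and
the limit is not zero. -/
lemma isPosReal_eta {y : ℝ} (hy : 0 < y) : IsPosReal (ModularForm.eta (Complex.I * y)) := by
  have him : 0 < (Complex.I * y).im := by simpa using hy
  have hne := ModularForm.eta_tprod_ne_zero him
  have hclosed : IsClosed {z : ℂ | 0 ≤ z.re ∧ z.im = 0} :=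
    (isClosed_le continuous_const Complex.continuous_re).inter
      (isClosed_eq Complex.continuous_im continuous_const)
  have hfac : ∀ n : ℕ, ∃ r : ℝ, 0 ≤ r ∧ 1 - ModularForm.eta_q n (Complex.I * y) = r := by
    intro n
    refine ⟨1 - Real.exp (-(2 * Real.pi * (n + 1) * y)), ?_, ?_⟩
    · rw [sub_nonneg, Real.exp_le_one_iff, neg_nonpos]
      positivity
    · rw [ModularForm.eta_q_eq_cexp]
      push_cast
      congr 2
      linear_combination (2 * Real.pi * (n + 1) * y) * Complex.I_sq
  have hmem : ∏' n, (1 - ModularForm.eta_q n (Complex.I * y)) ∈ {z : ℂ | 0 ≤ z.re ∧ z.im = 0} := by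
    refine hclosed.mem_of_tendsto
      (ModularForm.multipliableLocallyUniformlyOn_eta.multipliable him).hasProd
      (Eventually.of_forall fun s => ?_)
    choose r hr hr' using hfac
    simp_rw [hr', ← Complex.ofReal_prod]
    exact ⟨by rw [Complex.ofReal_re]; exact Finset.prod_nonneg fun i _ => hr i,
      Complex.ofReal_im _⟩
  refine IsPosReal.mul ⟨Real.exp (-(2 * Real.pi * y / 24)), Real.exp_pos _, ?_⟩
    ⟨(∏' n, (1 - ModularForm.eta_q n (Complex.I * y))).re, ?_, ?_⟩
  · rw [Function.Periodic.qParam, Complex.ofReal_exp]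
    congr 1
    push_cast
    linear_combination (2 * Real.pi * y / 24) * Complex.I_sq
  · refine lt_of_le_of_ne hmem.1 fun h => hne (Complex.ext h.symm hmem.2)
  · exact Complex.ext (by simp) (by simpa using hmem.2)

lemma isPosReal_cubicA {y : ℝ} (hy : 0 < y) : IsPosReal (cubicA (Complex.I * y)) :=
  ⟨_, cubicAImag_pos hy, cubicA_I_mul y⟩

lemma isPosReal_cubicA_sub {x y : ℝ} (hx : 0 < x) (hxy : x < y) :
    IsPosReal (cubicA (Complex.I * x) - cubicA (Complex.I * y)) :=
  ⟨_, sub_pos.2 (cubicAImag_lt hx hxy), by rw [cubicA_I_mul, cubicA_I_mul]; push_cast; rfl⟩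

lemma tendsto_I_mul : Tendsto (fun y : ℝ => Complex.I * y) atTop cuspFilter := by
  refine tendsto_comap_iff.2 ?_
  have : (Complex.im ∘ fun y : ℝ => Complex.I * y) = id := by ext y; simp
  rw [this]
  exact tendsto_id

lemma tendsto_cubicAImag : Tendsto cubicAImag atTop (𝓝 1) := by
  have := (Complex.continuous_re.tendsto 1).comp (tendsto_cubicA.comp tendsto_I_mul)
  simpa [Function.comp_def, cubicA_I_mul] using this

/-! ### Eta quotients of level six -/

/-- The weight one eta quotient of level 6 vanishing at `i∞`. -/
noncomputable def etaX (τ : ℂ) : ℂ :=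
  ModularForm.eta τ * ModularForm.eta (6 * τ) ^ 6 /
    (ModularForm.eta (2 * τ) ^ 2 * ModularForm.eta (3 * τ) ^ 3)

/-- The weight one eta quotient of level 6 vanishing at the cusp `0`. -/
noncomputable def etaY (τ : ℂ) : ℂ :=
  ModularForm.eta τ ^ 6 * ModularForm.eta (6 * τ) /
    (ModularForm.eta (2 * τ) ^ 3 * ModularForm.eta (3 * τ) ^ 2)

/-- The weight one eta quotient of level 6 vanishing at the cusp `1 / 2`. -/
noncomputable def etaZ (τ : ℂ) : ℂ :=
  ModularForm.eta (2 * τ) ^ 6 * ModularForm.eta (3 * τ) /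
    (ModularForm.eta τ ^ 3 * ModularForm.eta (6 * τ) ^ 2)

/-- The weight one eta quotient of level 6 vanishing at the cusp `1 / 3`. -/
noncomputable def etaV (τ : ℂ) : ℂ :=
  ModularForm.eta (2 * τ) * ModularForm.eta (3 * τ) ^ 6 /
    (ModularForm.eta τ ^ 2 * ModularForm.eta (6 * τ) ^ 3)

/-- The quotient of `a(q) - a(q²)` and `6 etaX`. -/
noncomputable def ratioX (τ : ℂ) : ℂ := (cubicA τ - cubicA (2 * τ)) / (6 * etaX τ)
/-- The quotient of `2 a(q²) - a(q)` and `etaY`. -/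
noncomputable def ratioY (τ : ℂ) : ℂ := (2 * cubicA (2 * τ) - cubicA τ) / etaY τ
/-- The quotient of `a(q) + a(q²)` and `2 etaZ`. -/
noncomputable def ratioZ (τ : ℂ) : ℂ := (cubicA τ + cubicA (2 * τ)) / (2 * etaZ τ)
/-- The quotient of `a(q) + 2 a(q²)` and `3 etaV`. -/
noncomputable def ratioV (τ : ℂ) : ℂ := (cubicA τ + 2 * cubicA (2 * τ)) / (3 * etaV τ)

/-- The 24th power removes the multiplier system of η, leaving only the discriminant, whose
transformation has no root of unity. -/
lemma ratioX_pow (τ : ℂ) : ratioX τ ^ 24 = (cubicA τ - cubicA (2 * τ)) ^ 24 *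
    (etaPow (2 * τ) ^ 2 * etaPow (3 * τ) ^ 3) / (6 ^ 24 * (etaPow τ * etaPow (6 * τ) ^ 6)) := by
  simp only [ratioX, etaX, etaPow, ← mul_div_assoc, div_div_eq_mul_div, div_pow, mul_pow,
    ← pow_mul, Nat.reduceMul]

lemma ratioY_pow (τ : ℂ) : ratioY τ ^ 24 = (2 * cubicA (2 * τ) - cubicA τ) ^ 24 *
    (etaPow (2 * τ) ^ 3 * etaPow (3 * τ) ^ 2) / (etaPow τ ^ 6 * etaPow (6 * τ)) := by
  simp only [ratioY, etaY, etaPow, div_div_eq_mul_div, div_pow, mul_pow,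
    ← pow_mul, Nat.reduceMul]

lemma ratioZ_pow (τ : ℂ) : ratioZ τ ^ 24 = (cubicA τ + cubicA (2 * τ)) ^ 24 *
    (etaPow τ ^ 3 * etaPow (6 * τ) ^ 2) / (2 ^ 24 * (etaPow (2 * τ) ^ 6 * etaPow (3 * τ))) := by
  simp only [ratioZ, etaZ, etaPow, ← mul_div_assoc, div_div_eq_mul_div, div_pow, mul_pow,
    ← pow_mul, Nat.reduceMul]

lemma ratioV_pow (τ : ℂ) : ratioV τ ^ 24 = (cubicA τ + 2 * cubicA (2 * τ)) ^ 24 *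
    (etaPow τ ^ 2 * etaPow (6 * τ) ^ 3) / (3 ^ 24 * (etaPow (2 * τ) * etaPow (3 * τ) ^ 6)) := by
  simp only [ratioV, etaV, etaPow, ← mul_div_assoc, div_div_eq_mul_div, div_pow, mul_pow,
    ← pow_mul, Nat.reduceMul]

section Transform

variable {τ : ℂ}

lemma etaPow_fricke_six (hτ : 0 < τ.im) :
    etaPow (-1 / (6 * τ)) = (6 * τ) ^ 12 * etaPow (6 * τ) ∧
    etaPow (2 * (-1 / (6 * τ))) = (3 * τ) ^ 12 * etaPow (3 * τ) ∧
    etaPow (3 * (-1 / (6 * τ))) = (2 * τ) ^ 12 * etaPow (2 * τ) ∧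
    etaPow (6 * (-1 / (6 * τ))) = τ ^ 12 * etaPow τ := by
  have h1 := etaPow_scale_fricke (N := 6) (d := 1) (e := 6) rfl one_pos (by norm_num) hτ
  have h2 := etaPow_scale_fricke (N := 6) (d := 2) (e := 3) rfl two_pos (by norm_num) hτ
  have h3 := etaPow_scale_fricke (N := 6) (d := 3) (e := 2) rfl three_pos (by norm_num) hτ
  have h6 := etaPow_scale_fricke (N := 6) (d := 6) (e := 1) rfl (by norm_num) one_pos hτ
  simp only [Nat.cast_one, Nat.cast_ofNat, one_mul] at h1 h2 h3 h6
  exact ⟨h1, h2, h3, h6⟩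

lemma etaPow_scales_ne_zero (hτ : 0 < τ.im) :
    etaPow τ ≠ 0 ∧ etaPow (2 * τ) ≠ 0 ∧ etaPow (3 * τ) ≠ 0 ∧ etaPow (6 * τ) ≠ 0 :=
  ⟨etaPow_ne_zero hτ, etaPow_ne_zero (im_two_mul_pos hτ), etaPow_ne_zero (im_three_mul_pos hτ),
    etaPow_ne_zero (im_six_mul_pos hτ)⟩

/-- Up to the common factor −i√3τ, W₆ sends (a(q), a(q²)) to (2a(q²), a(q)) and so permutes the four
linear forms up to scalars. It reverses the scales of the eta quotients, and the numerical constants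
match. -/
lemma ratioX_fricke (hτ : 0 < τ.im) : ratioX (-1 / (6 * τ)) ^ 24 = ratioY τ ^ 24 := by
  obtain ⟨e1, e2, e3, e6⟩ := etaPow_fricke_six hτ
  obtain ⟨n1, n2, n3, n6⟩ := etaPow_scales_ne_zero hτ
  have h0 := ne_zero_of_im_pos hτ
  rw [ratioX_pow, ratioY_pow, e1, e2, e3, e6, cubicA_fricke_six hτ, cubicA_two_mul_fricke_six hτ,
    show -Complex.I * √3 * (2 * τ) * cubicA (2 * τ) - -Complex.I * √3 * τ * cubicA τ =
      -Complex.I * √3 * (τ * (2 * cubicA (2 * τ) - cubicA τ)) by ring, mul_pow,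
    neg_I_mul_sqrt_three_pow]
  generalize 2 * cubicA (2 * τ) - cubicA τ = P
  generalize etaPow τ = d₁ at n1 ⊢
  generalize etaPow (2 * τ) = d₂ at n2 ⊢
  generalize etaPow (3 * τ) = d₃ at n3 ⊢
  generalize etaPow (6 * τ) = d₆ at n6 ⊢
  field

lemma ratioY_fricke (hτ : 0 < τ.im) : ratioY (-1 / (6 * τ)) ^ 24 = ratioX τ ^ 24 := by
  obtain ⟨e1, e2, e3, e6⟩ := etaPow_fricke_six hτ
  obtain ⟨n1, n2, n3, n6⟩ := etaPow_scales_ne_zero hτ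
  have h0 := ne_zero_of_im_pos hτ
  rw [ratioX_pow, ratioY_pow, e1, e2, e3, e6, cubicA_fricke_six hτ, cubicA_two_mul_fricke_six hτ,
    show 2 * (-Complex.I * √3 * τ * cubicA τ) - -Complex.I * √3 * (2 * τ) * cubicA (2 * τ) =
      -Complex.I * √3 * (2 * τ * (cubicA τ - cubicA (2 * τ))) by ring, mul_pow,
    neg_I_mul_sqrt_three_pow]
  generalize cubicA τ - cubicA (2 * τ) = P
  generalize etaPow τ = d₁ at n1 ⊢
  generalize etaPow (2 * τ) = d₂ at n2 ⊢
  generalize etaPow (3 * τ) = d₃ at n3 ⊢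
  generalize etaPow (6 * τ) = d₆ at n6 ⊢
  field

lemma ratioZ_fricke (hτ : 0 < τ.im) : ratioZ (-1 / (6 * τ)) ^ 24 = ratioV τ ^ 24 := by
  obtain ⟨e1, e2, e3, e6⟩ := etaPow_fricke_six hτ
  obtain ⟨n1, n2, n3, n6⟩ := etaPow_scales_ne_zero hτ
  have h0 := ne_zero_of_im_pos hτ
  rw [ratioZ_pow, ratioV_pow, e1, e2, e3, e6, cubicA_fricke_six hτ, cubicA_two_mul_fricke_six hτ,
    show -Complex.I * √3 * (2 * τ) * cubicA (2 * τ) + -Complex.I * √3 * τ * cubicA τ =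
      -Complex.I * √3 * (τ * (cubicA τ + 2 * cubicA (2 * τ))) by ring, mul_pow,
    neg_I_mul_sqrt_three_pow]
  generalize cubicA τ + 2 * cubicA (2 * τ) = P
  generalize etaPow τ = d₁ at n1 ⊢
  generalize etaPow (2 * τ) = d₂ at n2 ⊢
  generalize etaPow (3 * τ) = d₃ at n3 ⊢
  generalize etaPow (6 * τ) = d₆ at n6 ⊢
  field

lemma ratioV_fricke (hτ : 0 < τ.im) : ratioV (-1 / (6 * τ)) ^ 24 = ratioZ τ ^ 24 := by
  obtain ⟨e1, e2, e3, e6⟩ := etaPow_fricke_six hτ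
  obtain ⟨n1, n2, n3, n6⟩ := etaPow_scales_ne_zero hτ
  have h0 := ne_zero_of_im_pos hτ
  rw [ratioZ_pow, ratioV_pow, e1, e2, e3, e6, cubicA_fricke_six hτ, cubicA_two_mul_fricke_six hτ,
    show -Complex.I * √3 * (2 * τ) * cubicA (2 * τ) + 2 * (-Complex.I * √3 * τ * cubicA τ) =
      -Complex.I * √3 * (2 * τ * (cubicA τ + cubicA (2 * τ))) by ring, mul_pow,
    neg_I_mul_sqrt_three_pow]
  generalize cubicA τ + cubicA (2 * τ) = P
  generalize etaPow τ = d₁ at n1 ⊢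
  generalize etaPow (2 * τ) = d₂ at n2 ⊢
  generalize etaPow (3 * τ) = d₃ at n3 ⊢
  generalize etaPow (6 * τ) = d₆ at n6 ⊢
  field

lemma ratioX_atkin_lehner (hτ : 0 < τ.im) :
    ratioX ((3 * τ - 2) / (6 * τ - 3)) ^ 24 = ratioZ τ ^ 24 := by
  obtain ⟨n1, n2, n3, n6⟩ := etaPow_scales_ne_zero hτ
  have h0 := two_mul_sub_one_ne_zero hτ
  rw [ratioX_pow, ratioZ_pow, etaPow_atkin_lehner hτ, etaPow_two_mul_atkin_lehner hτ,
    etaPow_three_mul_atkin_lehner hτ, etaPow_six_mul_atkin_lehner hτ, cubicA_atkin_lehner hτ,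
    cubicA_two_mul_atkin_lehner hτ,
    show Complex.I * √3 * (2 * τ - 1) * cubicA τ - -Complex.I * √3 * (2 * τ - 1) * cubicA (2 * τ) =
      -Complex.I * √3 * (-(2 * τ - 1) * (cubicA τ + cubicA (2 * τ))) by ring, mul_pow,
    neg_I_mul_sqrt_three_pow]
  generalize cubicA τ + cubicA (2 * τ) = P
  generalize 2 * τ - 1 = j at h0 ⊢
  rw [neg_mul, Even.neg_pow (by decide)]
  generalize etaPow τ = d₁ at n1 ⊢
  generalize etaPow (2 * τ) = d₂ at n2 ⊢
  generalize etaPow (3 * τ) = d₃ at n3 ⊢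
  generalize etaPow (6 * τ) = d₆ at n6 ⊢
  field

lemma ratioZ_atkin_lehner (hτ : 0 < τ.im) :
    ratioZ ((3 * τ - 2) / (6 * τ - 3)) ^ 24 = ratioX τ ^ 24 := by
  obtain ⟨n1, n2, n3, n6⟩ := etaPow_scales_ne_zero hτ
  have h0 := two_mul_sub_one_ne_zero hτ
  rw [ratioX_pow, ratioZ_pow, etaPow_atkin_lehner hτ, etaPow_two_mul_atkin_lehner hτ,
    etaPow_three_mul_atkin_lehner hτ, etaPow_six_mul_atkin_lehner hτ, cubicA_atkin_lehner hτ,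
    cubicA_two_mul_atkin_lehner hτ,
    show Complex.I * √3 * (2 * τ - 1) * cubicA τ + -Complex.I * √3 * (2 * τ - 1) * cubicA (2 * τ) =
      -Complex.I * √3 * (-(2 * τ - 1) * (cubicA τ - cubicA (2 * τ))) by ring, mul_pow,
    neg_I_mul_sqrt_three_pow]
  generalize cubicA τ - cubicA (2 * τ) = P
  generalize 2 * τ - 1 = j at h0 ⊢
  rw [neg_mul, Even.neg_pow (by decide)]
  generalize etaPow τ = d₁ at n1 ⊢
  generalize etaPow (2 * τ) = d₂ at n2 ⊢
  generalize etaPow (3 * τ) = d₃ at n3 ⊢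
  generalize etaPow (6 * τ) = d₆ at n6 ⊢
  field

lemma ratioY_atkin_lehner (hτ : 0 < τ.im) :
    ratioY ((3 * τ - 2) / (6 * τ - 3)) ^ 24 = ratioV τ ^ 24 := by
  obtain ⟨n1, n2, n3, n6⟩ := etaPow_scales_ne_zero hτ
  have h0 := two_mul_sub_one_ne_zero hτ
  rw [ratioY_pow, ratioV_pow, etaPow_atkin_lehner hτ, etaPow_two_mul_atkin_lehner hτ,
    etaPow_three_mul_atkin_lehner hτ, etaPow_six_mul_atkin_lehner hτ, cubicA_atkin_lehner hτ,
    cubicA_two_mul_atkin_lehner hτ,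
    show 2 * (-Complex.I * √3 * (2 * τ - 1) * cubicA (2 * τ)) -
        Complex.I * √3 * (2 * τ - 1) * cubicA τ =
      -Complex.I * √3 * ((2 * τ - 1) * (cubicA τ + 2 * cubicA (2 * τ))) by ring, mul_pow,
    neg_I_mul_sqrt_three_pow]
  generalize cubicA τ + 2 * cubicA (2 * τ) = P
  generalize 2 * τ - 1 = j at h0 ⊢
  generalize etaPow τ = d₁ at n1 ⊢
  generalize etaPow (2 * τ) = d₂ at n2 ⊢
  generalize etaPow (3 * τ) = d₃ at n3 ⊢
  generalize etaPow (6 * τ) = d₆ at n6 ⊢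
  field

lemma ratioV_atkin_lehner (hτ : 0 < τ.im) :
    ratioV ((3 * τ - 2) / (6 * τ - 3)) ^ 24 = ratioY τ ^ 24 := by
  obtain ⟨n1, n2, n3, n6⟩ := etaPow_scales_ne_zero hτ
  have h0 := two_mul_sub_one_ne_zero hτ
  rw [ratioY_pow, ratioV_pow, etaPow_atkin_lehner hτ, etaPow_two_mul_atkin_lehner hτ,
    etaPow_three_mul_atkin_lehner hτ, etaPow_six_mul_atkin_lehner hτ, cubicA_atkin_lehner hτ,
    cubicA_two_mul_atkin_lehner hτ,
    show Complex.I * √3 * (2 * τ - 1) * cubicA τ +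
        2 * (-Complex.I * √3 * (2 * τ - 1) * cubicA (2 * τ)) =
      -Complex.I * √3 * ((2 * τ - 1) * (2 * cubicA (2 * τ) - cubicA τ)) by ring, mul_pow,
    neg_I_mul_sqrt_three_pow]
  generalize 2 * cubicA (2 * τ) - cubicA τ = P
  generalize 2 * τ - 1 = j at h0 ⊢
  generalize etaPow τ = d₁ at n1 ⊢
  generalize etaPow (2 * τ) = d₂ at n2 ⊢
  generalize etaPow (3 * τ) = d₃ at n3 ⊢
  generalize etaPow (6 * τ) = d₆ at n6 ⊢
  field

lemma scales_add_one (hτ : 0 < τ.im) :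
    etaPow (τ + 1) = etaPow τ ∧ etaPow (2 * (τ + 1)) = etaPow (2 * τ) ∧
    etaPow (3 * (τ + 1)) = etaPow (3 * τ) ∧ etaPow (6 * (τ + 1)) = etaPow (6 * τ) ∧
    cubicA (τ + 1) = cubicA τ ∧ cubicA (2 * (τ + 1)) = cubicA (2 * τ) :=
  have h : ∀ z : ℂ, 0 < z.im → etaPow (z + 1) = etaPow z := fun _ => etaPow_add_one
  have h' : ∀ z : ℂ, 0 < z.im → cubicA (z + 1) = cubicA z := fun z _ => cubicA_add_one z
  ⟨h τ hτ, add_int_of_add_one h (n := 2) two_pos hτ, add_int_of_add_one h (n := 3) three_pos hτ,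
    add_int_of_add_one h (n := 6) (by norm_num) hτ, h' τ hτ,
    add_int_of_add_one h' (n := 2) two_pos hτ⟩

lemma ratios_add_one (hτ : 0 < τ.im) :
    ratioX (τ + 1) ^ 24 = ratioX τ ^ 24 ∧ ratioY (τ + 1) ^ 24 = ratioY τ ^ 24 ∧
    ratioZ (τ + 1) ^ 24 = ratioZ τ ^ 24 ∧ ratioV (τ + 1) ^ 24 = ratioV τ ^ 24 := by
  obtain ⟨h1, h2, h3, h6, h4, h5⟩ := scales_add_one hτ
  simp only [ratioX_pow, ratioY_pow, ratioZ_pow, ratioV_pow, h1, h2, h3, h6, h4, h5, and_self]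

end Transform

/-! ### The linear relations between theta functions and eta quotients -/

lemma etaPow_mul_isTheta {n : ℕ} (hn : 0 < n) :
    (fun τ => etaPow (n * τ)) =Θ[cuspFilter] fun τ => nome τ ^ n := by
  have := etaPow_isTheta
  refine ⟨(this.1.comp_tendsto (tendsto_nat_mul_cuspFilter hn)).congr_right fun τ => ?_,
    (this.2.comp_tendsto (tendsto_nat_mul_cuspFilter hn)).congr_left fun τ => ?_⟩ <;>
  exact nome_nat_mul n τ

lemma etaPow_two_mul_isTheta : (fun τ => etaPow (2 * τ)) =Θ[cuspFilter] fun τ => nome τ ^ 2 :=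
  etaPow_mul_isTheta (n := 2) two_pos

lemma etaPow_three_mul_isTheta : (fun τ => etaPow (3 * τ)) =Θ[cuspFilter] fun τ => nome τ ^ 3 :=
  etaPow_mul_isTheta (n := 3) three_pos

lemma etaPow_six_mul_isTheta : (fun τ => etaPow (6 * τ)) =Θ[cuspFilter] fun τ => nome τ ^ 6 :=
  etaPow_mul_isTheta (n := 6) (by norm_num)

lemma nome_pow_isBigO_nome {n : ℕ} (hn : 0 < n) :
    (fun τ => nome τ ^ n) =O[cuspFilter] nome := by
  obtain ⟨k, rfl⟩ := Nat.exists_eq_succ_of_ne_zero hn.ne'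
  have h := ((tendsto_nome.pow k).isBigO_one ℂ).mul (isBigO_refl nome cuspFilter)
  simpa [pow_succ] using h

lemma comp_mul_sub_one_isBigO {f : ℂ → ℂ} (hf : (fun τ => f τ - 1) =O[cuspFilter] nome) {n : ℕ}
    (hn : 0 < n) : (fun τ => f (n * τ) - 1) =O[cuspFilter] nome :=
  ((hf.comp_tendsto (tendsto_nat_mul_cuspFilter hn)).congr_right
    fun τ => nome_nat_mul n τ).trans (nome_pow_isBigO_nome hn)

lemma cubicA_two_mul_sub_one_isBigO :
    (fun τ => cubicA (2 * τ) - 1) =O[cuspFilter] nome :=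
  comp_mul_sub_one_isBigO cubicA_sub_one_isBigO (n := 2) two_pos

lemma tendsto_cubicA_two_mul : Tendsto (fun τ => cubicA (2 * τ)) cuspFilter (𝓝 1) :=
  tendsto_cubicA.comp (tendsto_nat_mul_cuspFilter (n := 2) two_pos)

/-- The orders in q balance: 24 + 4 + 9 above against 1 + 36 below. The factor q²⁴ comes from the
cancellation of the constant terms of a(q) and a(q²). -/
lemma ratioX_pow_isBigO : (fun τ => ratioX τ ^ 24) =O[cuspFilter] fun _ => (1 : ℂ) := by
  have h1 : (fun τ => cubicA τ - cubicA (2 * τ)) =O[cuspFilter] nome :=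
    (cubicA_sub_one_isBigO.sub cubicA_two_mul_sub_one_isBigO).congr_left fun τ => by ring
  have h2 := ((h1.pow 24).mul ((etaPow_two_mul_isTheta.1.pow 2).mul
    (etaPow_three_mul_isTheta.1.pow 3))).mul
    (((isTheta_refl (fun _ : ℂ => (6 ^ 24 : ℂ)) cuspFilter).mul
      (etaPow_isTheta.mul (etaPow_six_mul_isTheta.pow 6))).inv.1)
  refine (h2.congr_left fun τ => (ratioX_pow τ).symm).trans ?_
  refine ((isBigO_const_const ((6 ^ 24 : ℂ)⁻¹) one_ne_zero cuspFilter)).congr_left fun τ => ?_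
  have := nome_ne_zero τ
  field

lemma ratioZ_pow_isBigO : (fun τ => ratioZ τ ^ 24) =O[cuspFilter] fun _ => (1 : ℂ) := by
  have h1 : (fun τ => cubicA τ + cubicA (2 * τ)) =O[cuspFilter] fun _ => (1 : ℂ) :=
    (tendsto_cubicA.add tendsto_cubicA_two_mul).isBigO_one ℂ
  have h2 := ((h1.pow 24).mul ((etaPow_isTheta.1.pow 3).mul
    (etaPow_six_mul_isTheta.1.pow 2))).mul
    (((isTheta_refl (fun _ : ℂ => (2 ^ 24 : ℂ)) cuspFilter).mul
      ((etaPow_two_mul_isTheta.pow 6).mul etaPow_three_mul_isTheta)).inv.1)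
  refine (h2.congr_left fun τ => (ratioZ_pow τ).symm).trans ?_
  refine ((isBigO_const_const ((2 ^ 24 : ℂ)⁻¹) one_ne_zero cuspFilter)).congr_left fun τ => ?_
  have := nome_ne_zero τ
  field

lemma ratioV_pow_isBigO : (fun τ => ratioV τ ^ 24) =O[cuspFilter] fun _ => (1 : ℂ) := by
  have h1 : (fun τ => cubicA τ + 2 * cubicA (2 * τ)) =O[cuspFilter] fun _ => (1 : ℂ) :=
    (tendsto_cubicA.add (tendsto_cubicA_two_mul.const_mul 2)).isBigO_one ℂ
  have h2 := ((h1.pow 24).mul ((etaPow_isTheta.1.pow 2).mul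
    (etaPow_six_mul_isTheta.1.pow 3))).mul
    (((isTheta_refl (fun _ : ℂ => (3 ^ 24 : ℂ)) cuspFilter).mul
      (etaPow_two_mul_isTheta.mul (etaPow_three_mul_isTheta.pow 6))).inv.1)
  refine (h2.congr_left fun τ => (ratioV_pow τ).symm).trans ?_
  refine ((isBigO_const_const ((3 ^ 24 : ℂ)⁻¹) one_ne_zero cuspFilter)).congr_left fun τ => ?_
  have := nome_ne_zero τ
  field

lemma tendsto_etaPow_mul_div_nome {n : ℕ} (hn : 0 < n) :
    Tendsto (fun τ => etaPow (n * τ) / nome τ ^ n) cuspFilter (𝓝 1) := by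
  refine (tendsto_etaPow_div_nome.comp (tendsto_nat_mul_cuspFilter hn)).congr fun τ => ?_
  rw [Function.comp_apply, nome_nat_mul]

/-- This is the one ratio whose exact limit at i∞ is needed; for the other three, boundedness
suffices. -/
lemma tendsto_ratioY_pow : Tendsto (fun τ => ratioY τ ^ 24) cuspFilter (𝓝 1) := by
  have t2 := tendsto_etaPow_mul_div_nome (n := 2) two_pos
  have t3 := tendsto_etaPow_mul_div_nome (n := 3) three_pos
  have t6 := tendsto_etaPow_mul_div_nome (n := 6) (by norm_num)
  have h := (((((tendsto_cubicA_two_mul.const_mul 2).sub tendsto_cubicA).pow 24).mul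
    ((t2.pow 3).mul (t3.pow 2))).div ((tendsto_etaPow_div_nome.pow 6).mul t6) (by norm_num))
  norm_num at h
  refine h.congr' (eventually_im_pos.mono fun τ hτ => ?_)
  obtain ⟨n1, n2, n3, n6⟩ := etaPow_scales_ne_zero hτ
  simp only [Pi.div_apply, ratioY_pow]
  have := nome_ne_zero τ
  generalize 2 * cubicA (2 * τ) - cubicA τ = P
  generalize etaPow τ = d₁ at n1 ⊢
  generalize etaPow (2 * τ) = d₂ at n2 ⊢
  generalize etaPow (3 * τ) = d₃ at n3 ⊢
  generalize etaPow (6 * τ) = d₆ at n6 ⊢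
  generalize nome τ = q at this ⊢
  field

lemma differentiableOn_comp_mul {f : ℂ → ℂ} (hf : DifferentiableOn ℂ f {z | 0 < z.im}) {n : ℕ}
    (hn : 0 < n) : DifferentiableOn ℂ (fun τ => f (n * τ)) {z | 0 < z.im} :=
  hf.comp (by fun_prop) fun _ hz => im_mul_pos hn hz

lemma differentiableOn_cubicA_two_mul :
    DifferentiableOn ℂ (fun τ => cubicA (2 * τ)) {z | 0 < z.im} :=
  differentiableOn_comp_mul differentiableOn_cubicA (n := 2) two_pos

lemma eta_scales_ne_zero {τ : ℂ} (hτ : 0 < τ.im) :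
    ModularForm.eta τ ≠ 0 ∧ ModularForm.eta (2 * τ) ≠ 0 ∧ ModularForm.eta (3 * τ) ≠ 0 ∧
      ModularForm.eta (6 * τ) ≠ 0 :=
  ⟨ModularForm.eta_ne_zero hτ, ModularForm.eta_ne_zero (im_two_mul_pos hτ),
    ModularForm.eta_ne_zero (im_three_mul_pos hτ), ModularForm.eta_ne_zero (im_six_mul_pos hτ)⟩

lemma differentiableOn_eta_scales :
    DifferentiableOn ℂ (fun τ => ModularForm.eta (2 * τ)) {z | 0 < z.im} ∧
    DifferentiableOn ℂ (fun τ => ModularForm.eta (3 * τ)) {z | 0 < z.im} ∧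
    DifferentiableOn ℂ (fun τ => ModularForm.eta (6 * τ)) {z | 0 < z.im} :=
  ⟨differentiableOn_comp_mul differentiableOn_eta (n := 2) two_pos,
    differentiableOn_comp_mul differentiableOn_eta (n := 3) three_pos,
    differentiableOn_comp_mul differentiableOn_eta (n := 6) (by norm_num)⟩

lemma etaX_ne_zero {τ : ℂ} (hτ : 0 < τ.im) : etaX τ ≠ 0 := by
  obtain ⟨n1, n2, n3, n6⟩ := eta_scales_ne_zero hτ
  unfold etaX
  positivity

lemma etaY_ne_zero {τ : ℂ} (hτ : 0 < τ.im) : etaY τ ≠ 0 := by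
  obtain ⟨n1, n2, n3, n6⟩ := eta_scales_ne_zero hτ
  unfold etaY
  positivity

lemma etaZ_ne_zero {τ : ℂ} (hτ : 0 < τ.im) : etaZ τ ≠ 0 := by
  obtain ⟨n1, n2, n3, n6⟩ := eta_scales_ne_zero hτ
  unfold etaZ
  positivity

lemma etaV_ne_zero {τ : ℂ} (hτ : 0 < τ.im) : etaV τ ≠ 0 := by
  obtain ⟨n1, n2, n3, n6⟩ := eta_scales_ne_zero hτ
  unfold etaV
  positivity

lemma differentiableOn_ratioX : DifferentiableOn ℂ ratioX {z | 0 < z.im} := by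
  obtain ⟨d2, d3, d6⟩ := differentiableOn_eta_scales
  refine (differentiableOn_cubicA.sub differentiableOn_cubicA_two_mul).div
    (DifferentiableOn.const_mul ((differentiableOn_eta.mul (d6.pow 6)).div
      ((d2.pow 2).mul (d3.pow 3)) fun τ hτ => ?_) 6)
    fun τ hτ => mul_ne_zero (by norm_num) (etaX_ne_zero hτ)
  obtain ⟨n1, n2, n3, n6⟩ := eta_scales_ne_zero hτ
  exact mul_ne_zero (pow_ne_zero _ n2) (pow_ne_zero _ n3)

lemma differentiableOn_ratioY : DifferentiableOn ℂ ratioY {z | 0 < z.im} := by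
  obtain ⟨d2, d3, d6⟩ := differentiableOn_eta_scales
  refine ((differentiableOn_cubicA_two_mul.const_mul 2).sub differentiableOn_cubicA).div
    (((differentiableOn_eta.pow 6).mul d6).div
      ((d2.pow 3).mul (d3.pow 2)) fun τ hτ => ?_) fun τ hτ => etaY_ne_zero hτ
  obtain ⟨n1, n2, n3, n6⟩ := eta_scales_ne_zero hτ
  exact mul_ne_zero (pow_ne_zero _ n2) (pow_ne_zero _ n3)

lemma differentiableOn_ratioZ : DifferentiableOn ℂ ratioZ {z | 0 < z.im} := by
  obtain ⟨d2, d3, d6⟩ := differentiableOn_eta_scales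
  refine (differentiableOn_cubicA.add differentiableOn_cubicA_two_mul).div
    (DifferentiableOn.const_mul (((d2.pow 6).mul d3).div
      ((differentiableOn_eta.pow 3).mul (d6.pow 2)) fun τ hτ => ?_) 2)
    fun τ hτ => mul_ne_zero (by norm_num) (etaZ_ne_zero hτ)
  obtain ⟨n1, n2, n3, n6⟩ := eta_scales_ne_zero hτ
  exact mul_ne_zero (pow_ne_zero _ n1) (pow_ne_zero _ n6)

lemma differentiableOn_ratioV : DifferentiableOn ℂ ratioV {z | 0 < z.im} := by
  obtain ⟨d2, d3, d6⟩ := differentiableOn_eta_scales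
  refine (differentiableOn_cubicA.add (differentiableOn_cubicA_two_mul.const_mul 2)).div
    (DifferentiableOn.const_mul ((d2.mul (d3.pow 6)).div
      ((differentiableOn_eta.pow 2).mul (d6.pow 3)) fun τ hτ => ?_) 3)
    fun τ hτ => mul_ne_zero (by norm_num) (etaV_ne_zero hτ)
  obtain ⟨n1, n2, n3, n6⟩ := eta_scales_ne_zero hτ
  exact mul_ne_zero (pow_ne_zero _ n1) (pow_ne_zero _ n6)

lemma im_fricke_six_pos {τ : ℂ} (hτ : 0 < τ.im) : 0 < (-1 / (6 * τ)).im := by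
  simpa using im_fricke_pos (N := 6) (by norm_num) hτ

lemma im_atkin_lehner_pos {τ : ℂ} (hτ : 0 < τ.im) : 0 < ((3 * τ - 2) / (6 * τ - 3)).im := by
  rw [im_atkin_lehner]
  have := Complex.normSq_pos.2 (two_mul_sub_one_ne_zero hτ)
  positivity

/-- All four ratios have 24th power `1`. -/
lemma ratios_pow_eq_one :
    (∀ τ : ℂ, 0 < τ.im → ratioX τ ^ 24 = 1) ∧ (∀ τ : ℂ, 0 < τ.im → ratioY τ ^ 24 = 1) ∧
    (∀ τ : ℂ, 0 < τ.im → ratioZ τ ^ 24 = 1) ∧ (∀ τ : ℂ, 0 < τ.im → ratioV τ ^ 24 = 1) := by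
  have dX := (differentiableOn_ratioX.pow 24).sub_const 1
  have dY := (differentiableOn_ratioY.pow 24).sub_const 1
  have dZ := (differentiableOn_ratioZ.pow 24).sub_const 1
  have dV := (differentiableOn_ratioV.pow 24).sub_const 1
  -- The individual factors are only permuted by W₆ and W₃; their product is invariant.
  have hprod : ∀ τ : ℂ, 0 < τ.im → (ratioX τ ^ 24 - 1) * (ratioZ τ ^ 24 - 1) *
      ((ratioV τ ^ 24 - 1) * (ratioY τ ^ 24 - 1)) = 0 := by
    intro τ hτ
    refine eq_zero_of_atkin_lehner_six (f := fun τ => (ratioX τ ^ 24 - 1) * (ratioZ τ ^ 24 - 1) *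
      ((ratioV τ ^ 24 - 1) * (ratioY τ ^ 24 - 1))) ((dX.mul dZ).mul (dV.mul dY)) ?_ ?_ ?_ ?_ hτ
    · intro τ hτ
      obtain ⟨h1, h2, h3, h4⟩ := ratios_add_one hτ
      simp only [h1, h2, h3, h4]
    · intro τ hτ
      simp only [ratioX_fricke hτ, ratioY_fricke hτ, ratioZ_fricke hτ, ratioV_fricke hτ]
      ring
    · intro τ hτ
      simp only [ratioX_atkin_lehner hτ, ratioY_atkin_lehner hτ, ratioZ_atkin_lehner hτ,
        ratioV_atkin_lehner hτ]
      ring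
    · have one := isBigO_refl (fun _ : ℂ => (1 : ℂ)) cuspFilter
      have hY : Tendsto (fun τ => ratioY τ ^ 24 - 1) cuspFilter (𝓝 0) := by
        simpa using tendsto_ratioY_pow.sub_const 1
      have hY' : (fun τ => ratioY τ ^ 24 - 1) =o[cuspFilter] fun _ => (1 : ℂ) :=
        (isLittleO_one_iff ℂ).2 hY
      have := ((ratioX_pow_isBigO.sub one).mul (ratioZ_pow_isBigO.sub one)).mul_isLittleO
        ((ratioV_pow_isBigO.sub one).mul_isLittleO hY')
      simp only [mul_one] at this
      exact (isLittleO_one_iff ℂ).1 this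
  -- W₆ exchanges X ↔ Y and Z ↔ V, W₃ exchanges X ↔ Z, so any one identity propagates to the other
  -- three.
  have X_of_Y : (∀ τ : ℂ, 0 < τ.im → ratioY τ ^ 24 = 1) → ∀ τ : ℂ, 0 < τ.im → ratioX τ ^ 24 = 1 :=
    fun h τ hτ => by rw [← ratioY_fricke hτ, h _ (im_fricke_six_pos hτ)]
  have X_of_Z : (∀ τ : ℂ, 0 < τ.im → ratioZ τ ^ 24 = 1) → ∀ τ : ℂ, 0 < τ.im → ratioX τ ^ 24 = 1 :=
    fun h τ hτ => by rw [← ratioZ_atkin_lehner hτ, h _ (im_atkin_lehner_pos hτ)]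
  have Z_of_V : (∀ τ : ℂ, 0 < τ.im → ratioV τ ^ 24 = 1) → ∀ τ : ℂ, 0 < τ.im → ratioZ τ ^ 24 = 1 :=
    fun h τ hτ => by rw [← ratioV_fricke hτ, h _ (im_fricke_six_pos hτ)]
  have hX : ∀ τ : ℂ, 0 < τ.im → ratioX τ ^ 24 = 1 := by
    rcases eq_zero_or_eq_zero_of_mul_eq_zero_im_pos (dX.mul dZ) (dV.mul dY) hprod with h | h
    · rcases eq_zero_or_eq_zero_of_mul_eq_zero_im_pos dX dZ h with h | h
      · exact fun τ hτ => sub_eq_zero.1 (h τ hτ)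
      · exact X_of_Z fun τ hτ => sub_eq_zero.1 (h τ hτ)
    · rcases eq_zero_or_eq_zero_of_mul_eq_zero_im_pos dV dY h with h | h
      · exact X_of_Z (Z_of_V fun τ hτ => sub_eq_zero.1 (h τ hτ))
      · exact X_of_Y fun τ hτ => sub_eq_zero.1 (h τ hτ)
  have hZ : ∀ τ : ℂ, 0 < τ.im → ratioZ τ ^ 24 = 1 :=
    fun τ hτ => by rw [← ratioX_atkin_lehner hτ, hX _ (im_atkin_lehner_pos hτ)]
  exact ⟨hX, fun τ hτ => by rw [← ratioX_fricke hτ, hX _ (im_fricke_six_pos hτ)], hZ,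
    fun τ hτ => by rw [← ratioZ_fricke hτ, hZ _ (im_fricke_six_pos hτ)]⟩

lemma eq_one_of_pow_eq_one_of_isPosReal {f : ℂ → ℂ} {n : ℕ} (hn : n ≠ 0)
    (hf : DifferentiableOn ℂ f {z | 0 < z.im}) (h : ∀ τ : ℂ, 0 < τ.im → f τ ^ n = 1) {y : ℝ}
    (hy : 0 < y) (hpos : IsPosReal (f (Complex.I * y))) {τ : ℂ} (hτ : 0 < τ.im) : f τ = 1 := by
  have him : 0 < (Complex.I * y).im := by simpa using hy
  rw [eq_of_pow_eq_one_im_pos hn hf h hτ him]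
  exact hpos.eq_one_of_pow_eq_one hn (h _ him)

lemma isPosReal_eta_scales {y : ℝ} (hy : 0 < y) :
    IsPosReal (ModularForm.eta (2 * (Complex.I * y))) ∧
    IsPosReal (ModularForm.eta (3 * (Complex.I * y))) ∧
    IsPosReal (ModularForm.eta (6 * (Complex.I * y))) := by
  have h : ∀ n : ℝ, 0 < n → IsPosReal (ModularForm.eta (n * (Complex.I * y))) := fun n hn => by
    have := isPosReal_eta (mul_pos hn hy)
    convert this using 2
    push_cast
    ring
  exact ⟨by simpa using h 2 two_pos, by simpa using h 3 three_pos,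
    by simpa using h 6 (by norm_num)⟩

lemma isPosReal_etaX {y : ℝ} (hy : 0 < y) : IsPosReal (etaX (Complex.I * y)) :=
  have ⟨h2, h3, h6⟩ := isPosReal_eta_scales hy
  ((isPosReal_eta hy).mul (h6.pow 6)).div ((h2.pow 2).mul (h3.pow 3))

lemma isPosReal_etaY {y : ℝ} (hy : 0 < y) : IsPosReal (etaY (Complex.I * y)) :=
  have ⟨h2, h3, h6⟩ := isPosReal_eta_scales hy
  (((isPosReal_eta hy).pow 6).mul h6).div ((h2.pow 3).mul (h3.pow 2))

lemma isPosReal_etaZ {y : ℝ} (hy : 0 < y) : IsPosReal (etaZ (Complex.I * y)) :=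
  have ⟨h2, h3, h6⟩ := isPosReal_eta_scales hy
  ((h2.pow 6).mul h3).div (((isPosReal_eta hy).pow 3).mul (h6.pow 2))

lemma isPosReal_etaV {y : ℝ} (hy : 0 < y) : IsPosReal (etaV (Complex.I * y)) :=
  have ⟨h2, h3, h6⟩ := isPosReal_eta_scales hy
  (h2.mul (h3.pow 6)).div (((isPosReal_eta hy).pow 2).mul (h6.pow 3))

lemma cubicA_two_mul_I (y : ℝ) : cubicA (2 * (Complex.I * y)) = cubicAImag (2 * y) := by
  rw [← cubicA_I_mul]
  push_cast
  ring_nf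

theorem cubicA_sub_eq {τ : ℂ} (hτ : 0 < τ.im) : cubicA τ - cubicA (2 * τ) = 6 * etaX τ := by
  have hpos : IsPosReal (ratioX (Complex.I * (1 : ℝ))) := by
    refine IsPosReal.div ⟨_, sub_pos.2 (cubicAImag_lt one_pos (by norm_num : (1 : ℝ) < 2 * 1)), ?_⟩
      ((IsPosReal.ofNat 6).mul (isPosReal_etaX one_pos))
    rw [cubicA_two_mul_I, cubicA_I_mul]
    push_cast
    rfl
  have := eq_one_of_pow_eq_one_of_isPosReal (by norm_num) differentiableOn_ratioX
    ratios_pow_eq_one.1 one_pos hpos hτ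
  rwa [ratioX, div_eq_one_iff_eq (mul_ne_zero (by norm_num) (etaX_ne_zero hτ))] at this

theorem two_mul_cubicA_sub_eq {τ : ℂ} (hτ : 0 < τ.im) :
    2 * cubicA (2 * τ) - cubicA τ = etaY τ := by
  -- The sign of this difference is not visible termwise, but it tends to 1 as y grows; one point
  -- suffices, the ratio being constant.
  obtain ⟨y, hy, hy'⟩ : ∃ y : ℝ, 0 < y ∧ 0 < 2 * cubicAImag (2 * y) - cubicAImag y := by
    have h : Tendsto (fun y => 2 * cubicAImag (2 * y) - cubicAImag y) atTop (𝓝 (2 * 1 - 1)) :=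
      ((tendsto_cubicAImag.comp (tendsto_id.const_mul_atTop two_pos)).const_mul 2).sub
        tendsto_cubicAImag
    obtain ⟨y, h1, h2⟩ := ((eventually_gt_atTop 0).and
      (h.eventually (lt_mem_nhds (by norm_num : (0 : ℝ) < 2 * 1 - 1)))).exists
    exact ⟨y, h1, h2⟩
  have hpos : IsPosReal (ratioY (Complex.I * y)) := by
    refine IsPosReal.div ⟨_, hy', ?_⟩ (isPosReal_etaY hy)
    rw [cubicA_two_mul_I, cubicA_I_mul]
    push_cast
    rfl
  have := eq_one_of_pow_eq_one_of_isPosReal (by norm_num) differentiableOn_ratioY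
    ratios_pow_eq_one.2.1 hy hpos hτ
  rwa [ratioY, div_eq_one_iff_eq (etaY_ne_zero hτ)] at this

theorem cubicA_add_eq {τ : ℂ} (hτ : 0 < τ.im) : cubicA τ + cubicA (2 * τ) = 2 * etaZ τ := by
  have hpos : IsPosReal (ratioZ (Complex.I * (1 : ℝ))) := by
    refine IsPosReal.div (IsPosReal.add (isPosReal_cubicA one_pos)
      ⟨_, cubicAImag_pos (by norm_num : (0 : ℝ) < 2 * 1), cubicA_two_mul_I 1⟩)
      ((IsPosReal.ofNat 2).mul (isPosReal_etaZ one_pos))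
  have := eq_one_of_pow_eq_one_of_isPosReal (by norm_num) differentiableOn_ratioZ
    ratios_pow_eq_one.2.2.1 one_pos hpos hτ
  rwa [ratioZ, div_eq_one_iff_eq (mul_ne_zero (by norm_num) (etaZ_ne_zero hτ))] at this

theorem cubicA_add_two_mul_eq {τ : ℂ} (hτ : 0 < τ.im) :
    cubicA τ + 2 * cubicA (2 * τ) = 3 * etaV τ := by
  have hpos : IsPosReal (ratioV (Complex.I * (1 : ℝ))) := by
    refine IsPosReal.div (IsPosReal.add (isPosReal_cubicA one_pos) ((IsPosReal.ofNat 2).mul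
      ⟨_, cubicAImag_pos (by norm_num : (0 : ℝ) < 2 * 1), cubicA_two_mul_I 1⟩))
      ((IsPosReal.ofNat 3).mul (isPosReal_etaV one_pos))
  have := eq_one_of_pow_eq_one_of_isPosReal (by norm_num) differentiableOn_ratioV
    ratios_pow_eq_one.2.2.2 one_pos hpos hτ
  rwa [ratioV, div_eq_one_iff_eq (mul_ne_zero (by norm_num) (etaV_ne_zero hτ))] at this

/-! ### The cubic theta functions of level three -/

lemma im_fricke_three_pos {τ : ℂ} (hτ : 0 < τ.im) : 0 < (-1 / (3 * τ)).im := by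
  simpa using im_fricke_pos (N := 3) (by norm_num) hτ

lemma cubicA_neg_inv {τ : ℂ} (hτ : 0 < τ.im) :
    cubicA (-1 / τ) = -Complex.I * √3 * (τ / 3) * cubicA (τ / 3) := by
  rw [← cubicA_fricke (im_div_three_pos hτ)]
  congr 2
  ring

/-- W sends 3τ to −1/τ, where a transforms to its value at τ/3; so W exchanges b and c, the eta
quotients being exchanged likewise. -/
lemma cubicB_fricke {τ : ℂ} (hτ : 0 < τ.im) :
    cubicB (-1 / (3 * τ)) = -Complex.I * √3 * τ * cubicC τ := by
  have h0 := ne_zero_of_im_pos hτ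
  have e : 3 * (-1 / (3 * τ)) = -1 / τ := by field_simp
  rw [cubicB, cubicC, cubicA_fricke hτ, e, cubicA_neg_inv hτ]
  ring

lemma cubicC_fricke {τ : ℂ} (hτ : 0 < τ.im) :
    cubicC (-1 / (3 * τ)) = -Complex.I * √3 * τ * cubicB τ := by
  have h0 := ne_zero_of_im_pos hτ
  have e : -1 / (3 * τ) / 3 = -1 / (3 * (3 * τ)) := by field_simp
  rw [cubicB, cubicC, cubicA_fricke hτ, e, cubicA_fricke (im_three_mul_pos hτ)]
  ring

/-- The quotient of `b(q)` and `η(τ)³ / η(3τ)`. -/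
noncomputable def ratioB (τ : ℂ) : ℂ :=
  cubicB τ * ModularForm.eta (3 * τ) / ModularForm.eta τ ^ 3

/-- The quotient of `c(q)` and `3 η(3τ)³ / η(τ)`. -/
noncomputable def ratioC (τ : ℂ) : ℂ :=
  cubicC τ * ModularForm.eta τ / (3 * ModularForm.eta (3 * τ) ^ 3)

lemma ratioB_pow (τ : ℂ) :
    ratioB τ ^ 24 = cubicB τ ^ 24 * etaPow (3 * τ) / etaPow τ ^ 3 := by
  simp only [ratioB, etaPow, div_pow, mul_pow, ← pow_mul, Nat.reduceMul]

lemma ratioC_pow (τ : ℂ) :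
    ratioC τ ^ 24 = cubicC τ ^ 24 * etaPow τ / (3 ^ 24 * etaPow (3 * τ) ^ 3) := by
  simp only [ratioC, etaPow, div_pow, mul_pow, ← pow_mul, Nat.reduceMul]

lemma etaPow_fricke_three {τ : ℂ} (hτ : 0 < τ.im) :
    etaPow (-1 / (3 * τ)) = (3 * τ) ^ 12 * etaPow (3 * τ) ∧
    etaPow (3 * (-1 / (3 * τ))) = τ ^ 12 * etaPow τ := by
  have h1 := etaPow_scale_fricke (N := 3) (d := 1) (e := 3) rfl one_pos (by norm_num) hτ
  have h3 := etaPow_scale_fricke (N := 3) (d := 3) (e := 1) rfl three_pos (by norm_num) hτ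
  simp only [Nat.cast_one, Nat.cast_ofNat, one_mul] at h1 h3
  exact ⟨h1, h3⟩

lemma ratioB_fricke {τ : ℂ} (hτ : 0 < τ.im) : ratioB (-1 / (3 * τ)) ^ 24 = ratioC τ ^ 24 := by
  obtain ⟨e1, e3⟩ := etaPow_fricke_three hτ
  obtain ⟨n1, -, n3, -⟩ := etaPow_scales_ne_zero hτ
  have h0 := ne_zero_of_im_pos hτ
  rw [ratioB_pow, ratioC_pow, e1, e3, cubicB_fricke hτ, mul_pow, mul_pow, neg_I_mul_sqrt_three_pow]
  generalize etaPow τ = d₁ at n1 ⊢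
  generalize etaPow (3 * τ) = d₃ at n3 ⊢
  field

lemma ratioC_fricke {τ : ℂ} (hτ : 0 < τ.im) : ratioC (-1 / (3 * τ)) ^ 24 = ratioB τ ^ 24 := by
  obtain ⟨e1, e3⟩ := etaPow_fricke_three hτ
  obtain ⟨n1, -, n3, -⟩ := etaPow_scales_ne_zero hτ
  have h0 := ne_zero_of_im_pos hτ
  rw [ratioB_pow, ratioC_pow, e1, e3, cubicC_fricke hτ, mul_pow, mul_pow, neg_I_mul_sqrt_three_pow]
  generalize etaPow τ = d₁ at n1 ⊢
  generalize etaPow (3 * τ) = d₃ at n3 ⊢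
  field

lemma cubicC_pow_add_one {τ : ℂ} (hτ : 0 < τ.im) : cubicC (τ + 1) ^ 24 = cubicC τ ^ 24 := by
  rw [cubicC_add_one hτ, mul_pow, ← Complex.exp_nat_mul,
    show ((24 : ℕ) : ℂ) * (2 * Real.pi * Complex.I / 3) = (8 : ℕ) * (2 * Real.pi * Complex.I) by
      push_cast; ring, Complex.exp_nat_mul_two_pi_mul_I, one_mul]

lemma cubicB_add_one {τ : ℂ} : cubicB (τ + 1) = cubicB τ := by
  have : cubicA (3 * (τ + 1)) = cubicA (3 * τ) := by
    rw [show 3 * (τ + 1) = 3 * τ + 1 + 1 + 1 by ring]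
    simp only [cubicA_add_one]
  rw [cubicB, cubicB, cubicA_add_one, this]

lemma differentiableOn_cubicA_three_mul :
    DifferentiableOn ℂ (fun τ => cubicA (3 * τ)) {z | 0 < z.im} :=
  differentiableOn_comp_mul differentiableOn_cubicA (n := 3) three_pos

lemma differentiableOn_ratioB : DifferentiableOn ℂ ratioB {z | 0 < z.im} := by
  obtain ⟨-, d3, -⟩ := differentiableOn_eta_scales
  exact ((((differentiableOn_cubicA_three_mul.const_mul 3).sub differentiableOn_cubicA).div_const
    2).mul d3).div (differentiableOn_eta.pow 3) fun τ hτ =>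
      pow_ne_zero 3 (eta_scales_ne_zero hτ).1

lemma differentiableOn_ratioC : DifferentiableOn ℂ ratioC {z | 0 < z.im} := by
  obtain ⟨-, d3, -⟩ := differentiableOn_eta_scales
  have h : DifferentiableOn ℂ (fun τ => cubicA (τ / 3)) {z | 0 < z.im} :=
    differentiableOn_cubicA.comp (by fun_prop) fun _ hz => im_div_three_pos hz
  exact ((((h.sub differentiableOn_cubicA).div_const 2).mul differentiableOn_eta)).div
    (DifferentiableOn.const_mul (d3.pow 3) 3) fun τ hτ =>
      mul_ne_zero (by norm_num) (pow_ne_zero 3 (eta_scales_ne_zero hτ).2.2.1)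

lemma tendsto_cubicB : Tendsto cubicB cuspFilter (𝓝 1) := by
  have h : Tendsto (fun τ => cubicA (3 * τ)) cuspFilter (𝓝 1) :=
    tendsto_cubicA.comp (tendsto_nat_mul_cuspFilter (n := 3) three_pos)
  have := ((h.const_mul 3).sub tendsto_cubicA).div_const 2
  norm_num at this
  exact this

lemma tendsto_ratioB_pow : Tendsto (fun τ => ratioB τ ^ 24) cuspFilter (𝓝 1) := by
  have t3 := tendsto_etaPow_mul_div_nome (n := 3) three_pos
  have h := ((tendsto_cubicB.pow 24).mul t3).div (tendsto_etaPow_div_nome.pow 3) (by norm_num)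
  norm_num at h
  refine h.congr' (eventually_im_pos.mono fun τ hτ => ?_)
  obtain ⟨n1, -, n3, -⟩ := etaPow_scales_ne_zero hτ
  simp only [Pi.div_apply, ratioB_pow]
  have := nome_ne_zero τ
  generalize etaPow τ = d₁ at n1 ⊢
  generalize etaPow (3 * τ) = d₃ at n3 ⊢
  field

lemma cubicC_isBigO : cubicC =O[cuspFilter] fun τ => nome (τ / 3) := by
  have h1 : (fun τ => cubicA (τ / 3) - 1) =O[cuspFilter] fun τ => nome (τ / 3) :=
    cubicA_sub_one_isBigO.comp_tendsto (tendsto_div_nat_cuspFilter (n := 3) three_pos)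
  have h2 : nome =O[cuspFilter] fun τ => nome (τ / 3) := by
    have := (nome_pow_isBigO_nome (n := 3) three_pos).comp_tendsto
      (tendsto_div_nat_cuspFilter (n := 3) three_pos)
    refine this.congr_left fun τ => ?_
    simp only [Function.comp_apply]
    rw [← nome_nat_mul]
    congr 1
    push_cast
    ring
  refine ((h1.sub (cubicA_sub_one_isBigO.trans h2)).const_mul_left (1 / 2)).congr_left fun τ => ?_
  rw [cubicC]
  ring

/-- As c = O(q^(1/3)), the orders in q balance: 8 + 1 against 9. -/
lemma ratioC_pow_isBigO : (fun τ => ratioC τ ^ 24) =O[cuspFilter] fun _ => (1 : ℂ) := by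
  have h2 := ((cubicC_isBigO.pow 24).mul etaPow_isTheta.1).mul
    (((isTheta_refl (fun _ : ℂ => (3 ^ 24 : ℂ)) cuspFilter).mul
      (etaPow_three_mul_isTheta.pow 3)).inv.1)
  refine (h2.congr_left fun τ => (ratioC_pow τ).symm).trans ?_
  refine ((isBigO_const_const ((3 ^ 24 : ℂ)⁻¹) one_ne_zero cuspFilter)).congr_left fun τ => ?_
  have e : nome τ = nome (τ / 3) ^ 3 := by
    rw [← nome_nat_mul]
    congr 1
    push_cast
    ring
  have := nome_ne_zero (τ / 3)
  rw [e]
  generalize nome (τ / 3) = q at this ⊢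
  field

/-- The argument of `ratios_pow_eq_one` with two ratios exchanged by the Fricke involution; b
supplies the factor tending to 0. -/
lemma ratios_three_pow_eq_one :
    (∀ τ : ℂ, 0 < τ.im → ratioB τ ^ 24 = 1) ∧ ∀ τ : ℂ, 0 < τ.im → ratioC τ ^ 24 = 1 := by
  have dB := (differentiableOn_ratioB.pow 24).sub_const 1
  have dC := (differentiableOn_ratioC.pow 24).sub_const 1
  have hprod : ∀ τ : ℂ, 0 < τ.im → (ratioC τ ^ 24 - 1) * (ratioB τ ^ 24 - 1) = 0 := by
    intro τ hτ
    refine eq_zero_of_fricke_three (f := fun τ => (ratioC τ ^ 24 - 1) * (ratioB τ ^ 24 - 1))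
      (dC.mul dB) ?_ ?_ ?_ hτ
    · intro τ hτ
      obtain ⟨h1, -, h3, -⟩ := scales_add_one hτ
      simp only [ratioB_pow, ratioC_pow, cubicB_add_one, cubicC_pow_add_one hτ, h1, h3]
    · intro τ hτ
      simp only [ratioB_fricke hτ, ratioC_fricke hτ]
      ring
    · have one := isBigO_refl (fun _ : ℂ => (1 : ℂ)) cuspFilter
      have hB : (fun τ => ratioB τ ^ 24 - 1) =o[cuspFilter] fun _ => (1 : ℂ) :=
        (isLittleO_one_iff ℂ).2 (by simpa using tendsto_ratioB_pow.sub_const 1)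
      have := (ratioC_pow_isBigO.sub one).mul_isLittleO hB
      simp only [mul_one] at this
      exact (isLittleO_one_iff ℂ).1 this
  rcases eq_zero_or_eq_zero_of_mul_eq_zero_im_pos dC dB hprod with h | h
  · have hC : ∀ τ : ℂ, 0 < τ.im → ratioC τ ^ 24 = 1 := fun τ hτ => sub_eq_zero.1 (h τ hτ)
    exact ⟨fun τ hτ => by rw [← ratioC_fricke hτ, hC _ (im_fricke_three_pos hτ)], hC⟩
  · have hB : ∀ τ : ℂ, 0 < τ.im → ratioB τ ^ 24 = 1 := fun τ hτ => sub_eq_zero.1 (h τ hτ)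
    exact ⟨hB, fun τ hτ => by rw [← ratioB_fricke hτ, hB _ (im_fricke_three_pos hτ)]⟩

theorem cubicB_eq {τ : ℂ} (hτ : 0 < τ.im) :
    cubicB τ = ModularForm.eta τ ^ 3 / ModularForm.eta (3 * τ) := by
  obtain ⟨y, hy, hy'⟩ : ∃ y : ℝ, 0 < y ∧ 0 < (3 * cubicAImag (3 * y) - cubicAImag y) / 2 := by
    have h : Tendsto (fun y => (3 * cubicAImag (3 * y) - cubicAImag y) / 2) atTop
        (𝓝 ((3 * 1 - 1) / 2)) :=
      (((tendsto_cubicAImag.comp (tendsto_id.const_mul_atTop three_pos)).const_mul 3).sub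
        tendsto_cubicAImag).div_const 2
    obtain ⟨y, h1, h2⟩ := ((eventually_gt_atTop 0).and
      (h.eventually (lt_mem_nhds (by norm_num : (0 : ℝ) < (3 * 1 - 1) / 2)))).exists
    exact ⟨y, h1, h2⟩
  have hpos : IsPosReal (ratioB (Complex.I * y)) := by
    refine IsPosReal.div (IsPosReal.mul ⟨_, hy', ?_⟩ (isPosReal_eta_scales hy).2.1)
      ((isPosReal_eta hy).pow 3)
    rw [cubicB, show (3 : ℂ) * (Complex.I * y) = Complex.I * ((3 * y : ℝ) : ℂ) by push_cast; ring,
      cubicA_I_mul, cubicA_I_mul]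
    push_cast
    rfl
  have := eq_one_of_pow_eq_one_of_isPosReal (by norm_num) differentiableOn_ratioB
    ratios_three_pow_eq_one.1 hy hpos hτ
  obtain ⟨n1, -, n3, -⟩ := eta_scales_ne_zero hτ
  rw [ratioB, div_eq_one_iff_eq (pow_ne_zero 3 n1)] at this
  rw [eq_div_iff n3, this]

theorem cubicC_eq {τ : ℂ} (hτ : 0 < τ.im) :
    cubicC τ = 3 * ModularForm.eta (3 * τ) ^ 3 / ModularForm.eta τ := by
  have hpos : IsPosReal (ratioC (Complex.I * (1 : ℝ))) := by
    refine IsPosReal.div (IsPosReal.mul ?_ (isPosReal_eta one_pos))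
      ((IsPosReal.ofNat 3).mul ((isPosReal_eta_scales one_pos).2.1.pow 3))
    refine IsPosReal.div ?_ (IsPosReal.ofNat 2)
    have := isPosReal_cubicA_sub (x := 1 / 3) (y := 1) (by norm_num) (by norm_num)
    convert this using 3
    push_cast
    ring
  have := eq_one_of_pow_eq_one_of_isPosReal (by norm_num) differentiableOn_ratioC
    ratios_three_pow_eq_one.2 one_pos hpos hτ
  obtain ⟨n1, -, n3, -⟩ := eta_scales_ne_zero hτ
  rw [ratioC, div_eq_one_iff_eq (mul_ne_zero (by norm_num) (pow_ne_zero 3 n3))] at this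
  rw [eq_div_iff n1, this]

/-! ### Eisenstein series of weight two and the cubic theta functions -/

lemma mul_sub_const_isBigO {f g : ℂ → ℂ} {a b : ℂ} (hf : (fun τ => f τ - a) =O[cuspFilter] nome)
    (hg : (fun τ => g τ - b) =O[cuspFilter] nome) :
    (fun τ => f τ * g τ - a * b) =O[cuspFilter] nome := by
  have hg1 : g =O[cuspFilter] fun _ => (1 : ℂ) := by
    have := (hg.trans (tendsto_nome.isBigO_one ℂ)).add
      (isBigO_const_const b (one_ne_zero (α := ℂ)) cuspFilter)
    simpa using this
  have h := hf.mul hg1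
  simp only [mul_one] at h
  have h' := h.add (hg.const_mul_left a)
  exact h'.congr_left fun τ => by ring

/-- The Eisenstein series `3 E₂(3τ) - E₂(τ)`. -/
noncomputable def eisThree (τ : ℂ) : ℂ := 3 * eisE2 (3 * τ) - eisE2 τ

/-- The Eisenstein series `2 E₂(2τ) - E₂(τ)`. -/
noncomputable def eisTwo (τ : ℂ) : ℂ := 2 * eisE2 (2 * τ) - eisE2 τ

lemma eisE2_scale_fricke {N d e : ℕ} (hN : d * e = N) (hd : 0 < d) (he : 0 < e) {τ : ℂ}
    (hτ : 0 < τ.im) :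
    eisE2 (d * (-1 / (N * τ))) = (e * τ) ^ 2 * eisE2 (e * τ) + quasiPeriod * (e * τ) := by
  rw [← eisE2_neg_inv (im_mul_pos he hτ), ← hN]
  congr 1
  have := ne_zero_of_im_pos hτ
  have hd' : (d : ℂ) ≠ 0 := by exact_mod_cast hd.ne'
  push_cast
  field_simp

/-- The quasi-period terms of 3E₂(3τ) and E₂(τ) are equal and cancel; the same happens in every
combination N E₂(Nτ) − E₂(τ). -/
lemma eisThree_fricke {τ : ℂ} (hτ : 0 < τ.im) :
    eisThree (-1 / (3 * τ)) = -3 * τ ^ 2 * eisThree τ := by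
  have h1 := eisE2_scale_fricke (N := 3) (d := 1) (e := 3) rfl one_pos (by norm_num) hτ
  have h3 := eisE2_scale_fricke (N := 3) (d := 3) (e := 1) rfl three_pos (by norm_num) hτ
  simp only [Nat.cast_one, Nat.cast_ofNat, one_mul] at h1 h3
  rw [eisThree, eisThree, h1, h3]
  ring

lemma eisE2_mul_sub_one_isBigO {n : ℕ} (hn : 0 < n) :
    (fun τ => eisE2 (n * τ) - 1) =O[cuspFilter] nome :=
  comp_mul_sub_one_isBigO eisE2_sub_one_isBigO hn

lemma differentiableOn_eisE2_mul {n : ℕ} (hn : 0 < n) :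
    DifferentiableOn ℂ (fun τ => eisE2 (n * τ)) {z | 0 < z.im} :=
  differentiableOn_comp_mul differentiableOn_eisE2 hn

theorem eisThree_eq {τ : ℂ} (hτ : 0 < τ.im) : eisThree τ = 2 * cubicA τ ^ 2 := by
  set D : ℂ → ℂ := fun τ => eisThree τ - 2 * cubicA τ ^ 2 with hD
  have dD : DifferentiableOn ℂ D {z | 0 < z.im} :=
    (((differentiableOn_eisE2_mul (n := 3) three_pos).const_mul 3).sub differentiableOn_eisE2).sub
      ((differentiableOn_cubicA.pow 2).const_mul 2)
  have hO : D =O[cuspFilter] nome := by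
    have h3 := eisE2_mul_sub_one_isBigO (n := 3) three_pos
    have hA := mul_sub_const_isBigO cubicA_sub_one_isBigO cubicA_sub_one_isBigO
    refine (((h3.const_mul_left 3).sub eisE2_sub_one_isBigO).sub
      (hA.const_mul_left 2)).congr_left fun τ => ?_
    simp only [hD, eisThree]
    push_cast
    ring
  -- D has weight 2, so D¹² and η(τ)²⁴η(3τ)²⁴ both have weight 24 and the quotient is invariant. It
  -- is O(q¹²/q⁴) at i∞, hence tends to 0.
  have key : D τ ^ 12 / (etaPow τ * etaPow (3 * τ)) = 0 := by
    refine eq_zero_of_fricke_three (f := fun τ => D τ ^ 12 / (etaPow τ * etaPow (3 * τ)))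
      ((dD.pow 12).div (differentiableOn_etaPow.mul
        (differentiableOn_comp_mul differentiableOn_etaPow (n := 3) three_pos)) fun τ hτ =>
        mul_ne_zero (etaPow_scales_ne_zero hτ).1 (etaPow_scales_ne_zero hτ).2.2.1) ?_ ?_ ?_ hτ
    · intro τ hτ
      obtain ⟨h1, -, h3, -, h4, -⟩ := scales_add_one hτ
      have h5 : eisE2 (3 * (τ + 1)) = eisE2 (3 * τ) :=
        add_int_of_add_one (fun _ => eisE2_add_one) (n := 3) three_pos hτ
      simp only [hD, eisThree, h1, h3, h4, h5, eisE2_add_one hτ]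
    · intro τ hτ
      obtain ⟨e1, e3⟩ := etaPow_fricke_three hτ
      obtain ⟨n1, -, n3, -⟩ := etaPow_scales_ne_zero hτ
      have h0 := ne_zero_of_im_pos hτ
      have hDτ : D (-1 / (3 * τ)) = -3 * τ ^ 2 * D τ := by
        simp only [hD]
        rw [eisThree_fricke hτ, cubicA_fricke hτ, mul_pow, mul_pow, neg_I_mul_sqrt_three_sq]
        ring
      simp only [hDτ, e1, e3]
      generalize etaPow τ = d₁ at n1 ⊢
      generalize etaPow (3 * τ) = d₃ at n3 ⊢
      generalize D τ = P
      field
    · have h := (hO.pow 12).mul (etaPow_isTheta.mul etaPow_three_mul_isTheta).inv.1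
      refine h.trans_tendsto ?_
      refine (by simpa using tendsto_nome.pow 8 : Tendsto _ cuspFilter (𝓝 (0 : ℂ))).congr fun τ => ?_
      have := nome_ne_zero τ
      field
  have hne := etaPow_scales_ne_zero hτ
  rw [div_eq_zero_iff, or_iff_left (mul_ne_zero hne.1 hne.2.2.1)] at key
  exact sub_eq_zero.1 (eq_zero_of_pow_eq_zero key)

lemma eisTwo_fricke {τ : ℂ} (hτ : 0 < τ.im) :
    eisTwo (-1 / (6 * τ)) = -18 * τ ^ 2 * eisTwo (3 * τ) ∧
    eisTwo (3 * (-1 / (6 * τ))) = -2 * τ ^ 2 * eisTwo τ := by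
  have h1 := eisE2_scale_fricke (N := 6) (d := 1) (e := 6) rfl one_pos (by norm_num) hτ
  have h2 := eisE2_scale_fricke (N := 6) (d := 2) (e := 3) rfl two_pos (by norm_num) hτ
  have h3 := eisE2_scale_fricke (N := 6) (d := 3) (e := 2) rfl three_pos (by norm_num) hτ
  have h6 := eisE2_scale_fricke (N := 6) (d := 6) (e := 1) rfl (by norm_num) one_pos hτ
  simp only [Nat.cast_one, Nat.cast_ofNat, one_mul] at h1 h2 h3 h6
  have e : ∀ z : ℂ, 2 * (3 * z) = 6 * z := fun z => by ring
  constructor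
  · rw [eisTwo, eisTwo, h1, h2, e]
    ring
  · rw [eisTwo, eisTwo, e, h3, h6]
    ring

/-- The same four SL(2, ℤ) matrices as for the discriminant; the quasi-period terms cancel within
each combination. -/
lemma eisTwo_atkin_lehner {τ : ℂ} (hτ : 0 < τ.im) :
    eisTwo ((3 * τ - 2) / (6 * τ - 3)) = 9 * (2 * τ - 1) ^ 2 * eisTwo (3 * τ) ∧
    eisTwo (3 * ((3 * τ - 2) / (6 * τ - 3))) = (2 * τ - 1) ^ 2 * eisTwo τ := by
  have hj := two_mul_sub_one_ne_zero hτ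
  have hd : 6 * τ - 3 = 3 * (2 * τ - 1) := by ring
  have h1 := eisE2_moebius (a := 1) (b := -2) (c := 2) (d := -3) (by norm_num) (im_three_mul_pos hτ)
  have h2 := eisE2_moebius (a := 1) (b := -4) (c := 1) (d := -3) (by norm_num) (im_six_mul_pos hτ)
  have h3 := eisE2_moebius (a := 3) (b := -2) (c := 2) (d := -1) (by norm_num) hτ
  have h6 := eisE2_moebius (a := 3) (b := -4) (c := 1) (d := -1) (by norm_num) (im_two_mul_pos hτ)
  push_cast at h1 h2 h3 h6
  have a1 : (1 * (3 * τ) + -2) / (2 * (3 * τ) + -3) = (3 * τ - 2) / (6 * τ - 3) := by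
    congr 1 <;> ring
  have a2 : (1 * (6 * τ) + -4) / (1 * (6 * τ) + -3) = 2 * ((3 * τ - 2) / (6 * τ - 3)) := by
    rw [← mul_div_assoc]
    congr 1 <;> ring
  have a3 : (3 * τ + -2) / (2 * τ + -1) = 3 * ((3 * τ - 2) / (6 * τ - 3)) := by
    rw [hd, ← sub_eq_add_neg, ← sub_eq_add_neg]
    generalize 2 * τ - 1 = j at hj ⊢
    field
  have a6 : (3 * (2 * τ) + -4) / (1 * (2 * τ) + -1) = 2 * (3 * ((3 * τ - 2) / (6 * τ - 3))) := by
    rw [hd, one_mul, ← sub_eq_add_neg (2 * τ)]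
    generalize 2 * τ - 1 = j at hj ⊢
    field
  rw [a1] at h1
  rw [a2] at h2
  rw [a3] at h3
  rw [a6] at h6
  constructor
  · rw [eisTwo, eisTwo, h1, h2, show 2 * (3 * τ) = 6 * τ by ring]
    ring
  · rw [eisTwo, eisTwo, h3, h6]
    ring

/-- `2 E₂(2τ) - E₂(τ)` and `2 E₂(6τ) - E₂(3τ)` as quadratic forms in `a(q)` and `a(q²)`. -/
theorem eisTwo_eq {τ : ℂ} (hτ : 0 < τ.im) :
    eisTwo τ = cubicA τ ^ 2 + 2 * cubicA τ * cubicA (2 * τ) - 2 * cubicA (2 * τ) ^ 2 ∧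
    3 * eisTwo (3 * τ) = 2 * cubicA (2 * τ) ^ 2 + 2 * cubicA τ * cubicA (2 * τ) - cubicA τ ^ 2 := by
  set F : ℂ → ℂ := fun τ => eisTwo τ -
    (cubicA τ ^ 2 + 2 * cubicA τ * cubicA (2 * τ) - 2 * cubicA (2 * τ) ^ 2) with hF
  set G : ℂ → ℂ := fun τ => 3 * eisTwo (3 * τ) -
    (2 * cubicA (2 * τ) ^ 2 + 2 * cubicA τ * cubicA (2 * τ) - cubicA τ ^ 2) with hG
  have e6 : ∀ z : ℂ, 2 * (3 * z) = ((6 : ℕ) : ℂ) * z := fun z => by push_cast; ring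
  have dA := differentiableOn_cubicA
  have dB := differentiableOn_cubicA_two_mul
  have dE : DifferentiableOn ℂ eisTwo {z | 0 < z.im} :=
    ((differentiableOn_eisE2_mul (n := 2) two_pos).const_mul 2).sub differentiableOn_eisE2
  have dF : DifferentiableOn ℂ F {z | 0 < z.im} :=
    dE.sub (((dA.pow 2).add ((dA.const_mul 2).mul dB)).sub ((dB.pow 2).const_mul 2))
  have dG : DifferentiableOn ℂ G {z | 0 < z.im} :=
    ((differentiableOn_comp_mul dE (n := 3) three_pos).const_mul 3).sub
      ((((dB.pow 2).const_mul 2).add ((dA.const_mul 2).mul dB)).sub (dA.pow 2))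
  have oA := cubicA_sub_one_isBigO
  have oB := cubicA_two_mul_sub_one_isBigO
  have oAA := mul_sub_const_isBigO oA oA
  have oAB := mul_sub_const_isBigO oA oB
  have oBB := mul_sub_const_isBigO oB oB
  have oF : F =O[cuspFilter] nome := by
    refine ((((eisE2_mul_sub_one_isBigO (n := 2) two_pos).const_mul_left 2).sub
      eisE2_sub_one_isBigO).sub ((oAA.add (oAB.const_mul_left 2)).sub
      (oBB.const_mul_left 2))).congr_left fun τ => ?_
    simp only [hF, eisTwo]
    push_cast
    ring
  have oG : G =O[cuspFilter] nome := by
    refine ((((eisE2_mul_sub_one_isBigO (n := 6) (by norm_num)).const_mul_left 6).sub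
      ((eisE2_mul_sub_one_isBigO (n := 3) three_pos).const_mul_left 3)).sub
      (((oBB.const_mul_left 2).add (oAB.const_mul_left 2)).sub oAA)).congr_left fun τ => ?_
    simp only [hG, eisTwo, e6]
    push_cast
    ring
  -- W₆ and W₃ exchange the two defects F and G up to automorphy factors, so the product FG is what
  -- the Liouville principle can treat.
  have F_fricke : ∀ τ : ℂ, 0 < τ.im → F (-1 / (6 * τ)) = -6 * τ ^ 2 * G τ := by
    intro τ hτ
    simp only [hF, hG]
    rw [(eisTwo_fricke hτ).1, cubicA_fricke_six hτ, cubicA_two_mul_fricke_six hτ]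
    linear_combination (-(4 * τ ^ 2 * cubicA (2 * τ) ^ 2 + 4 * τ ^ 2 * cubicA τ * cubicA (2 * τ)
      - 2 * τ ^ 2 * cubicA τ ^ 2)) * neg_I_mul_sqrt_three_sq
  have G_fricke : ∀ τ : ℂ, 0 < τ.im → G (-1 / (6 * τ)) = -6 * τ ^ 2 * F τ := by
    intro τ hτ
    simp only [hF, hG]
    rw [(eisTwo_fricke hτ).2, cubicA_fricke_six hτ, cubicA_two_mul_fricke_six hτ]
    linear_combination (-(2 * τ ^ 2 * cubicA τ ^ 2 + 4 * τ ^ 2 * cubicA τ * cubicA (2 * τ)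
      - 4 * τ ^ 2 * cubicA (2 * τ) ^ 2)) * neg_I_mul_sqrt_three_sq
  have key : ∀ τ : ℂ, 0 < τ.im → F τ * G τ = 0 := by
    intro τ hτ
    -- FG has weight 4, so its 12th power matches the four discriminants, of total weight 48. At i∞
    -- the quotient is O(q²⁴/q¹²).
    have h : (F τ * G τ) ^ 12 /
        (etaPow τ * etaPow (2 * τ) * etaPow (3 * τ) * etaPow (6 * τ)) = 0 := by
      refine eq_zero_of_atkin_lehner_six (f := fun τ => (F τ * G τ) ^ 12 /
        (etaPow τ * etaPow (2 * τ) * etaPow (3 * τ) * etaPow (6 * τ)))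
        (((dF.mul dG).pow 12).div (((differentiableOn_etaPow.mul
          (differentiableOn_comp_mul differentiableOn_etaPow (n := 2) two_pos)).mul
          (differentiableOn_comp_mul differentiableOn_etaPow (n := 3) three_pos)).mul
          (differentiableOn_comp_mul differentiableOn_etaPow (n := 6) (by norm_num)))
          fun τ hτ => ?_) ?_ ?_ ?_ ?_ hτ
      · obtain ⟨n1, n2, n3, n6⟩ := etaPow_scales_ne_zero hτ
        exact mul_ne_zero (mul_ne_zero (mul_ne_zero n1 n2) n3) n6
      · intro τ hτ
        obtain ⟨h1, h2, h3, h6, h4, h5⟩ := scales_add_one hτ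
        have p : ∀ n : ℕ, 0 < n → eisE2 (n * (τ + 1)) = eisE2 (n * τ) := fun n hn =>
          add_int_of_add_one (fun _ => eisE2_add_one) hn hτ
        have p2 := p 2 two_pos
        have p3 := p 3 three_pos
        have p6 := p 6 (by norm_num)
        push_cast at p2 p3
        simp only [hF, hG, eisTwo, e6, h1, h2, h3, h4, h5, h6, p2, p3, p6, eisE2_add_one hτ]
      · intro τ hτ
        obtain ⟨e1, e2, e3, e6⟩ := etaPow_fricke_six hτ
        obtain ⟨n1, n2, n3, n6⟩ := etaPow_scales_ne_zero hτ
        have h0 := ne_zero_of_im_pos hτ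
        simp only [F_fricke τ hτ, G_fricke τ hτ, e1, e2, e3, e6]
        generalize etaPow τ = d₁ at n1 ⊢
        generalize etaPow (2 * τ) = d₂ at n2 ⊢
        generalize etaPow (3 * τ) = d₃ at n3 ⊢
        generalize etaPow (6 * τ) = d₆ at n6 ⊢
        generalize F τ = P
        generalize G τ = Q
        field
      · intro τ hτ
        obtain ⟨n1, n2, n3, n6⟩ := etaPow_scales_ne_zero hτ
        have h0 := two_mul_sub_one_ne_zero hτ
        have hFτ : F ((3 * τ - 2) / (6 * τ - 3)) = 3 * (2 * τ - 1) ^ 2 * G τ := by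
          simp only [hF, hG]
          rw [(eisTwo_atkin_lehner hτ).1, cubicA_atkin_lehner hτ, cubicA_two_mul_atkin_lehner hτ]
          linear_combination (-((2 * τ - 1) ^ 2 * cubicA τ ^ 2
            - 2 * (2 * τ - 1) ^ 2 * cubicA τ * cubicA (2 * τ)
            - 2 * (2 * τ - 1) ^ 2 * cubicA (2 * τ) ^ 2)) * neg_I_mul_sqrt_three_sq
        have hGτ : G ((3 * τ - 2) / (6 * τ - 3)) = 3 * (2 * τ - 1) ^ 2 * F τ := by
          simp only [hF, hG]
          rw [(eisTwo_atkin_lehner hτ).2, cubicA_atkin_lehner hτ, cubicA_two_mul_atkin_lehner hτ]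
          linear_combination (-(2 * (2 * τ - 1) ^ 2 * cubicA (2 * τ) ^ 2
            - 2 * (2 * τ - 1) ^ 2 * cubicA τ * cubicA (2 * τ)
            - (2 * τ - 1) ^ 2 * cubicA τ ^ 2)) * neg_I_mul_sqrt_three_sq
        simp only [hFτ, hGτ, etaPow_atkin_lehner hτ, etaPow_two_mul_atkin_lehner hτ,
          etaPow_three_mul_atkin_lehner hτ, etaPow_six_mul_atkin_lehner hτ]
        generalize etaPow τ = d₁ at n1 ⊢
        generalize etaPow (2 * τ) = d₂ at n2 ⊢
        generalize etaPow (3 * τ) = d₃ at n3 ⊢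
        generalize etaPow (6 * τ) = d₆ at n6 ⊢
        generalize F τ = P
        generalize G τ = Q
        generalize 2 * τ - 1 = j at h0 ⊢
        field
      · have h := ((oF.mul oG).pow 12).mul (((etaPow_isTheta.mul etaPow_two_mul_isTheta).mul
          etaPow_three_mul_isTheta).mul etaPow_six_mul_isTheta).inv.1
        refine h.trans_tendsto ?_
        refine (by simpa using tendsto_nome.pow 12 :
          Tendsto _ cuspFilter (𝓝 (0 : ℂ))).congr fun τ => ?_
        have := nome_ne_zero τ
        field
    obtain ⟨n1, n2, n3, n6⟩ := etaPow_scales_ne_zero hτ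
    rw [div_eq_zero_iff, or_iff_left (mul_ne_zero (mul_ne_zero (mul_ne_zero n1 n2) n3) n6)] at h
    exact eq_zero_of_pow_eq_zero h
  -- One of F, G vanishes identically, and the Fricke relation transfers this to the other.
  have hFG : (∀ τ : ℂ, 0 < τ.im → F τ = 0) ∧ ∀ τ : ℂ, 0 < τ.im → G τ = 0 := by
    have hne : ∀ τ : ℂ, 0 < τ.im → -6 * τ ^ 2 ≠ 0 := fun τ hτ =>
      mul_ne_zero (by norm_num) (pow_ne_zero 2 (ne_zero_of_im_pos hτ))
    rcases eq_zero_or_eq_zero_of_mul_eq_zero_im_pos dF dG key with h | h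
    · exact ⟨h, fun τ hτ => (mul_eq_zero.1 ((F_fricke τ hτ).symm.trans
        (h _ (im_fricke_six_pos hτ)))).resolve_left (hne τ hτ)⟩
    · exact ⟨fun τ hτ => (mul_eq_zero.1 ((G_fricke τ hτ).symm.trans
        (h _ (im_fricke_six_pos hτ)))).resolve_left (hne τ hτ), h⟩
  exact ⟨sub_eq_zero.1 (hFG.1 τ hτ), sub_eq_zero.1 (hFG.2 τ hτ)⟩

/-! ### Hecke's trick: the summand and its integrals along horizontal lines. -/

/-- The function `w ↦ w⁻² |w|^(-2 s)`. -/
noncomputable def heckeTerm (s w : ℂ) : ℂ :=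
  (w ^ 2)⁻¹ * Complex.exp (-(2 * s * (Real.log ‖w‖ : ℝ)))

lemma norm_exp_hecke (s : ℂ) (x : ℝ) :
    ‖Complex.exp (-(2 * s * (x : ℝ)))‖ = Real.exp (-(2 * s.re * x)) := by
  rw [Complex.norm_exp]
  simp

/-- The factor |w|^(−2s) is at most 1 if y ≥ 1 and at most y⁻² otherwise; the sum covers both cases
uniformly in s. -/
lemma exp_hecke_le {s : ℂ} (h0 : 0 ≤ s.re) (h1 : s.re ≤ 1) {y : ℝ} (hy : 0 < y) {w : ℂ}
    (hw : y ≤ ‖w‖) :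
    ‖Complex.exp (-(2 * s * (Real.log ‖w‖ : ℝ)))‖ ≤ 1 + (y ^ 2)⁻¹ := by
  rw [norm_exp_hecke]
  have hl : Real.log y ≤ Real.log ‖w‖ := Real.log_le_log hy hw
  have hp : 0 < (y ^ 2)⁻¹ := by positivity
  rcases le_or_gt 0 (Real.log y) with h | h
  · have : Real.exp (-(2 * s.re * Real.log ‖w‖)) ≤ 1 := by
      rw [Real.exp_le_one_iff]
      have : 0 ≤ s.re * Real.log ‖w‖ := mul_nonneg h0 (h.trans hl)
      linarith
    linarith
  · have e : (y ^ 2)⁻¹ = Real.exp (-(2 * Real.log y)) := by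
      rw [Real.exp_neg, two_mul, Real.exp_add, Real.exp_log hy, sq]
    have : Real.exp (-(2 * s.re * Real.log ‖w‖)) ≤ (y ^ 2)⁻¹ := by
      rw [e, Real.exp_le_exp]
      nlinarith
    linarith

lemma norm_heckeTerm_le {s : ℂ} (h0 : 0 ≤ s.re) (h1 : s.re ≤ 1) {y : ℝ} (hy : 0 < y) {w : ℂ}
    (hw : y ≤ ‖w‖) : ‖heckeTerm s w‖ ≤ (1 + (y ^ 2)⁻¹) * (‖w‖ ^ 2)⁻¹ := by
  rw [heckeTerm, norm_mul, norm_inv, norm_pow, mul_comm]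
  gcongr
  exact exp_hecke_le h0 h1 hy hw

lemma norm_add_real_sq (w : ℂ) (t : ℝ) : ‖w + t‖ ^ 2 = (w.re + t) ^ 2 + w.im ^ 2 := by
  rw [Complex.sq_norm, Complex.normSq_apply]
  simp
  ring

lemma abs_im_le_norm_add (w : ℂ) (t : ℝ) : |w.im| ≤ ‖w + t‖ := by
  simpa using Complex.abs_im_le_norm (w + t)

lemma norm_add_real_pos {w : ℂ} (hw : w.im ≠ 0) (t : ℝ) : 0 < ‖w + t‖ :=
  (abs_pos.mpr hw).trans_le (abs_im_le_norm_add w t)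

lemma add_real_ne_zero {w : ℂ} (hw : w.im ≠ 0) (t : ℝ) : w + t ≠ 0 :=
  norm_pos_iff.mp (norm_add_real_pos hw t)

lemma hasDerivAt_log_norm {w : ℂ} (hw : w.im ≠ 0) (t : ℝ) :
    HasDerivAt (fun t : ℝ => Real.log ‖w + t‖) ((w.re + t) / ‖w + t‖ ^ 2) t := by
  have e : (fun t : ℝ => Real.log ‖w + t‖) =
      fun t : ℝ => Real.log ((w.re + t) ^ 2 + w.im ^ 2) / 2 := by
    funext u
    rw [← norm_add_real_sq, Real.log_pow]
    push_cast
    ring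
  rw [e, norm_add_real_sq]
  have hp : (w.re + t) ^ 2 + w.im ^ 2 ≠ 0 := by
    rw [← norm_add_real_sq]
    exact pow_ne_zero _ (norm_add_real_pos hw t).ne'
  have h := (((((hasDerivAt_id t).const_add w.re).pow 2).add_const (w.im ^ 2)).log
    (by simpa using hp)).div_const 2
  refine h.congr_deriv ?_
  simp
  field_simp

lemma hasDerivAt_exp_hecke (s : ℂ) {w : ℂ} (hw : w.im ≠ 0) (t : ℝ) :
    HasDerivAt (fun t : ℝ => Complex.exp (-(2 * s * (Real.log ‖w + t‖ : ℝ))))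
      (Complex.exp (-(2 * s * (Real.log ‖w + t‖ : ℝ))) *
        -(2 * s * (((w.re + t) / ‖w + t‖ ^ 2 : ℝ) : ℂ))) t :=
  (((hasDerivAt_log_norm hw t).ofReal_comp.const_mul (2 * s)).neg).cexp

lemma hasDerivAt_add_real (w : ℂ) (t : ℝ) : HasDerivAt (fun t : ℝ => w + (t : ℂ)) 1 t :=
  (Complex.ofRealCLM.hasDerivAt (x := t)).const_add w

lemma hasDerivAt_heckeTerm (s : ℂ) {w : ℂ} (hw : w.im ≠ 0) (t : ℝ) :
    HasDerivAt (fun t : ℝ => heckeTerm s (w + t))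
      (heckeTerm s (w + t) *
        (-2 * (w + t)⁻¹ - 2 * s * (((w.re + t) / ‖w + t‖ ^ 2 : ℝ) : ℂ))) t := by
  have h0 := add_real_ne_zero hw t
  have h := (((hasDerivAt_add_real w t).pow 2).inv (pow_ne_zero 2 h0)).mul
    (hasDerivAt_exp_hecke s hw t)
  refine h.congr_deriv ?_
  simp only [heckeTerm, Pi.pow_apply, Pi.inv_apply]
  generalize Complex.exp _ = E
  field_simp
  simp
  ring

lemma abs_re_div_le {w : ℂ} (hw : w.im ≠ 0) (t : ℝ) :
    |(w.re + t) / ‖w + t‖ ^ 2| ≤ ‖w + t‖⁻¹ := by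
  have hp := norm_add_real_pos hw t
  have : |w.re + t| ≤ ‖w + t‖ := by simpa using Complex.abs_re_le_norm (w + t)
  rw [abs_div, abs_of_nonneg (sq_nonneg ‖w + t‖), div_le_iff₀ (by positivity)]
  calc _ ≤ _ := this
    _ = _ := by field_simp

lemma norm_deriv_heckeTerm_le {s : ℂ} (h0 : 0 ≤ s.re) (h1 : ‖s‖ ≤ 1) {y : ℝ} (hy : 0 < y)
    {w : ℂ} (hw : y ≤ |w.im|) (t : ℝ) :
    ‖heckeTerm s (w + t) *
      (-2 * (w + t)⁻¹ - 2 * s * (((w.re + t) / ‖w + t‖ ^ 2 : ℝ) : ℂ))‖ ≤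
      4 * (1 + (y ^ 2)⁻¹) * (‖w + t‖ ^ 3)⁻¹ := by
  have hw0 : w.im ≠ 0 := by rintro h; simp [h] at hw; linarith
  have hp := norm_add_real_pos hw0 t
  have hs : s.re ≤ 1 := (Complex.re_le_norm s).trans h1
  have hf := norm_heckeTerm_le h0 hs hy (hw.trans (abs_im_le_norm_add w t))
  have hd : ‖-2 * (w + t)⁻¹ - 2 * s * (((w.re + t) / ‖w + t‖ ^ 2 : ℝ) : ℂ)‖ ≤
      4 * ‖w + t‖⁻¹ := by
    refine (norm_sub_le _ _).trans ?_
    rw [norm_mul, norm_mul, norm_mul, Complex.norm_real, Real.norm_eq_abs, norm_inv]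
    have h3 := abs_re_div_le hw0 t
    have : ‖s‖ * |(w.re + t) / ‖w + t‖ ^ 2| ≤ 1 * ‖w + t‖⁻¹ := by gcongr
    norm_num
    norm_num at this
    linarith
  rw [norm_mul]
  calc _ ≤ _ := mul_le_mul hf hd (norm_nonneg _) (by positivity)
    _ = _ := by field_simp

lemma norm_le_mul_norm_add_real {y : ℝ} (hy : 0 < y) {w : ℂ} (hw : y ≤ |w.im|) {t : ℝ}
    (ht : t ∈ Set.Icc (0 : ℝ) 1) : ‖w‖ ≤ (1 + y⁻¹) * ‖w + t‖ := by
  have h1 : ‖w‖ ≤ ‖w + t‖ + 1 := by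
    have := norm_sub_le (w + t) t
    rw [add_sub_cancel_right, Complex.norm_real, Real.norm_of_nonneg ht.1] at this
    linarith [ht.2]
  have h2 : 1 ≤ y⁻¹ * ‖w + t‖ := by
    rw [inv_mul_eq_div, le_div_iff₀ hy]
    linarith [abs_im_le_norm_add w t]
  linarith

lemma continuous_heckeTerm_add (s : ℂ) {w : ℂ} (hw : w.im ≠ 0) :
    Continuous fun t : ℝ => heckeTerm s (w + t) :=
  continuous_iff_continuousAt.mpr fun t => (hasDerivAt_heckeTerm s hw t).continuousAt

/-- By the mean value inequality, replacing a term by its average over a unit step costs only the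
size |w|⁻³ of the derivative. That is summable over the lattice even at s = 0. -/
lemma norm_heckeTerm_sub_integral_le {s : ℂ} (h0 : 0 ≤ s.re) (h1 : ‖s‖ ≤ 1) {y : ℝ}
    (hy : 0 < y) {w : ℂ} (hw : y ≤ |w.im|) :
    ‖heckeTerm s w - ∫ t in (0 : ℝ)..1, heckeTerm s (w + t)‖ ≤
      4 * (1 + (y ^ 2)⁻¹) * (1 + y⁻¹) ^ 3 * (‖w‖ ^ 3)⁻¹ := by
  have hw0 : w.im ≠ 0 := by rintro h; simp [h] at hw; linarith
  have hwp : 0 < ‖w‖ := by simpa using norm_add_real_pos hw0 0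
  have e : heckeTerm s w - ∫ t in (0 : ℝ)..1, heckeTerm s (w + t) =
      ∫ t in (0 : ℝ)..1, (heckeTerm s w - heckeTerm s (w + t)) := by
    rw [intervalIntegral.integral_sub (by simp)
      ((continuous_heckeTerm_add s hw0).intervalIntegrable _ _)]
    simp
  rw [e]
  have hb : ∀ u ∈ Set.Icc (0 : ℝ) 1, ‖heckeTerm s (w + u) *
      (-2 * (w + u)⁻¹ - 2 * s * (((w.re + u) / ‖w + u‖ ^ 2 : ℝ) : ℂ))‖ ≤
      4 * (1 + (y ^ 2)⁻¹) * (1 + y⁻¹) ^ 3 * (‖w‖ ^ 3)⁻¹ := by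
    intro u hu
    refine (norm_deriv_heckeTerm_le h0 h1 hy hw u).trans ?_
    have hp := norm_add_real_pos hw0 u
    have h3 : ‖w‖ ^ 3 ≤ ((1 + y⁻¹) * ‖w + u‖) ^ 3 := by
      gcongr
      exact norm_le_mul_norm_add_real hy hw hu
    have : (‖w + u‖ ^ 3)⁻¹ ≤ (1 + y⁻¹) ^ 3 * (‖w‖ ^ 3)⁻¹ := by
      rw [inv_le_iff_one_le_mul₀ (by positivity), mul_pow] at *
      rw [mul_right_comm, ← div_eq_mul_inv, le_div_iff₀ (by positivity)]
      linarith
    rw [mul_assoc _ ((1 + y⁻¹) ^ 3)]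
    gcongr
  have := intervalIntegral.norm_integral_le_of_norm_le_const (a := 0) (b := 1)
    (f := fun t : ℝ => heckeTerm s w - heckeTerm s (w + t))
    (C := 4 * (1 + (y ^ 2)⁻¹) * (1 + y⁻¹) ^ 3 * (‖w‖ ^ 3)⁻¹) ?_
  · simpa using this
  · intro t ht
    rw [Set.uIoc_of_le zero_le_one] at ht
    have hm := (convex_Icc (0 : ℝ) 1).norm_image_sub_le_of_norm_hasDerivWithin_le
      (fun u _ => (hasDerivAt_heckeTerm s hw0 u).hasDerivWithinAt) hb
      (x := t) (y := 0) ⟨ht.1.le, ht.2⟩ ⟨le_rfl, zero_le_one⟩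
    simp only [Complex.ofReal_zero, add_zero, zero_sub, norm_neg] at hm
    refine hm.trans ?_
    rw [Real.norm_of_nonneg ht.1.le]
    exact mul_le_of_le_one_right (by positivity) ht.2

lemma norm_I_add_sq (t : ℝ) : ‖Complex.I + t‖ ^ 2 = 1 + t ^ 2 := by
  rw [norm_add_real_sq]
  simp
  ring

lemma one_le_norm_I_add (t : ℝ) : 1 ≤ ‖Complex.I + t‖ := by
  simpa using abs_im_le_norm_add Complex.I t

lemma I_im_ne_zero : Complex.I.im ≠ 0 := by simp

lemma norm_exp_hecke_I_le {s : ℂ} (h0 : 0 ≤ s.re) (t : ℝ) :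
    ‖Complex.exp (-(2 * s * (Real.log ‖Complex.I + t‖ : ℝ)))‖ ≤ 1 := by
  rw [norm_exp_hecke, Real.exp_le_one_iff]
  have := mul_nonneg h0 (Real.log_nonneg (one_le_norm_I_add t))
  linarith

lemma continuous_exp_hecke_I (s : ℂ) :
    Continuous fun t : ℝ => Complex.exp (-(2 * s * (Real.log ‖Complex.I + t‖ : ℝ))) :=
  continuous_iff_continuousAt.mpr fun t =>
    (hasDerivAt_exp_hecke s I_im_ne_zero t).continuousAt

lemma continuous_I_add_inv : Continuous fun t : ℝ => (Complex.I + t)⁻¹ :=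
  (continuous_const.add Complex.continuous_ofReal).inv₀
    fun t => add_real_ne_zero I_im_ne_zero t

lemma integrable_heckeTerm_I {s : ℂ} (h0 : 0 ≤ s.re) :
    MeasureTheory.Integrable fun t : ℝ => heckeTerm s (Complex.I + t) := by
  refine integrable_inv_one_add_sq.mono'
    (continuous_heckeTerm_add s I_im_ne_zero).aestronglyMeasurable (MeasureTheory.ae_of_all _ fun t => ?_)
  rw [heckeTerm, norm_mul, norm_inv, norm_pow, norm_I_add_sq]
  exact mul_le_of_le_one_right (by positivity) (norm_exp_hecke_I_le h0 t)

/-- The integrand arising from `heckeTerm` on a horizontal line by integration by parts. -/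
noncomputable def heckeKernel (s : ℂ) (t : ℝ) : ℂ :=
  ((t / (1 + t ^ 2) : ℝ) : ℂ) *
    ((Complex.I + t)⁻¹ * Complex.exp (-(2 * s * (Real.log ‖Complex.I + t‖ : ℝ))))

lemma continuous_heckeKernel (s : ℂ) : Continuous (heckeKernel s) := by
  refine Continuous.mul ?_ (continuous_I_add_inv.mul (continuous_exp_hecke_I s))
  refine Complex.continuous_ofReal.comp (continuous_id.div (by fun_prop) fun t => ?_)
  positivity

lemma norm_heckeKernel_le {s : ℂ} (h0 : 0 ≤ s.re) (t : ℝ) :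
    ‖heckeKernel s t‖ ≤ (1 + t ^ 2)⁻¹ := by
  have h1 : |t| ≤ ‖Complex.I + t‖ := by simpa using Complex.abs_re_le_norm (Complex.I + t)
  have hp : 0 < ‖Complex.I + t‖ := one_pos.trans_le (one_le_norm_I_add t)
  rw [heckeKernel, norm_mul, norm_mul, norm_inv, Complex.norm_real, Real.norm_eq_abs, abs_div,
    abs_of_pos (by positivity : 0 < 1 + t ^ 2)]
  calc |t| / (1 + t ^ 2) * (‖Complex.I + t‖⁻¹ * _)
      ≤ ‖Complex.I + t‖ / (1 + t ^ 2) * (‖Complex.I + t‖⁻¹ * 1) := by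
        gcongr
        exact norm_exp_hecke_I_le h0 t
    _ = _ := by field_simp

lemma integrable_heckeKernel {s : ℂ} (h0 : 0 ≤ s.re) :
    MeasureTheory.Integrable (heckeKernel s) :=
  integrable_inv_one_add_sq.mono' (continuous_heckeKernel s).aestronglyMeasurable
    (MeasureTheory.ae_of_all _ (norm_heckeKernel_le h0))

lemma tendsto_inv_norm_I_add {l : Filter ℝ} (hl : Tendsto (fun t : ℝ => |t|) l atTop) :
    Tendsto (fun t : ℝ => ‖Complex.I + t‖⁻¹) l (𝓝 0) :=
  tendsto_inv_atTop_zero.comp (tendsto_atTop_mono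
    (fun t => by simpa using Complex.abs_re_le_norm (Complex.I + t)) hl)

/-- Integration by parts against (i + t)⁻¹|i + t|^(−2s), which vanishes at both ends, extracts a
factor s. This zero will meet the pole of ζ(1 + 2s). -/
lemma integral_heckeTerm_I {s : ℂ} (h0 : 0 ≤ s.re) :
    ∫ t : ℝ, heckeTerm s (Complex.I + t) = -(2 * s) * ∫ t : ℝ, heckeKernel s t := by
  have hd : ∀ t : ℝ, HasDerivAt (fun t : ℝ => (Complex.I + t)⁻¹ *
      Complex.exp (-(2 * s * (Real.log ‖Complex.I + t‖ : ℝ))))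
      (-(heckeTerm s (Complex.I + t)) - 2 * s * heckeKernel s t) t := by
    intro t
    have h0 := add_real_ne_zero I_im_ne_zero t
    refine (((hasDerivAt_add_real Complex.I t).inv h0).mul
      (hasDerivAt_exp_hecke s I_im_ne_zero t)).congr_deriv ?_
    rw [norm_I_add_sq, Complex.I_re, zero_add]
    simp only [heckeTerm, heckeKernel, Pi.inv_apply]
    ring
  have hi := (integrable_heckeTerm_I h0)
  have hk := (integrable_heckeKernel h0).const_mul (2 * s)
  have ht : ∀ l : Filter ℝ, Tendsto (fun t : ℝ => |t|) l atTop →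
      Tendsto (fun t : ℝ => (Complex.I + t)⁻¹ *
        Complex.exp (-(2 * s * (Real.log ‖Complex.I + t‖ : ℝ)))) l (𝓝 0) := fun l hl => by
    refine squeeze_zero_norm (fun t => ?_) (tendsto_inv_norm_I_add hl)
    rw [norm_mul, norm_inv]
    exact mul_le_of_le_one_right (by positivity) (norm_exp_hecke_I_le h0 t)
  have h := MeasureTheory.integral_of_hasDerivAt_of_tendsto hd (hi.neg.sub hk)
    (ht _ tendsto_abs_atBot_atTop) (ht _ tendsto_abs_atTop_atTop)
  rw [MeasureTheory.integral_sub (by exact hi.neg) hk, MeasureTheory.integral_neg,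
    MeasureTheory.integral_const_mul] at h
  linear_combination -h

lemma tendsto_integral_heckeKernel :
    Tendsto (fun s : ℂ => ∫ t : ℝ, heckeKernel s t) (𝓝[{s : ℂ | 0 < s.re}] 0)
      (𝓝 (∫ t : ℝ, heckeKernel 0 t)) := by
  refine MeasureTheory.tendsto_integral_filter_of_dominated_convergence
    (fun t : ℝ => (1 + t ^ 2)⁻¹) ?_ ?_ integrable_inv_one_add_sq ?_
  · exact Eventually.of_forall fun s => (continuous_heckeKernel s).aestronglyMeasurable
  · filter_upwards [self_mem_nhdsWithin] with s hs
    exact MeasureTheory.ae_of_all _ (norm_heckeKernel_le (le_of_lt hs))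
  · refine MeasureTheory.ae_of_all _ fun t => ?_
    have : Continuous fun s => heckeKernel s t := by
      unfold heckeKernel
      fun_prop
    exact (this.tendsto 0).mono_left nhdsWithin_le_nhds

lemma heckeTerm_mul (s : ℂ) {a : ℝ} (ha : a ≠ 0) {w : ℂ} (hw : w ≠ 0) :
    heckeTerm s (a * w) =
      ((a ^ 2)⁻¹ : ℝ) * Complex.exp (-(2 * s * (Real.log |a| : ℝ))) * heckeTerm s w := by
  rw [heckeTerm, heckeTerm, norm_mul, Complex.norm_real, Real.norm_eq_abs,
    Real.log_mul (abs_ne_zero.mpr ha) (norm_ne_zero_iff.mpr hw)]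
  push_cast
  rw [mul_add, neg_add, Complex.exp_add, mul_pow, mul_inv]
  ring

lemma heckeTerm_smul_I (s : ℂ) {a : ℝ} (ha : a ≠ 0) (t : ℝ) :
    heckeTerm s (a * Complex.I + (a * t : ℝ)) =
      ((a ^ 2)⁻¹ : ℝ) * Complex.exp (-(2 * s * (Real.log |a| : ℝ))) *
        heckeTerm s (Complex.I + t) := by
  rw [← heckeTerm_mul s ha (add_real_ne_zero I_im_ne_zero t)]
  congr 1
  push_cast
  ring

lemma integrable_heckeTerm_line {s : ℂ} (h0 : 0 ≤ s.re) {w : ℂ} (hw : w.im ≠ 0) :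
    MeasureTheory.Integrable fun t : ℝ => heckeTerm s (w + t) := by
  have h : MeasureTheory.Integrable fun t : ℝ => heckeTerm s (w.im * Complex.I + (t : ℝ)) := by
    refine (MeasureTheory.integrable_comp_mul_left_iff
      (fun t : ℝ => heckeTerm s (w.im * Complex.I + (t : ℝ))) hw).mp ?_
    simp only [heckeTerm_smul_I s hw]
    exact (integrable_heckeTerm_I h0).const_mul _
  convert h.comp_add_right w.re using 3 with t
  apply Complex.ext <;> simp [add_comm]

/-- Translation by Re w and scaling by Im w reduce every line to Im = 1. The absolute value allows
lines below the real axis. -/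
lemma integral_heckeTerm_line {s : ℂ} (h0 : 0 ≤ s.re) {w : ℂ} (hw : w.im ≠ 0) :
    ∫ t : ℝ, heckeTerm s (w + t) =
      (|w.im|⁻¹ : ℝ) * Complex.exp (-(2 * s * (Real.log |w.im| : ℝ))) *
        (-(2 * s) * ∫ t : ℝ, heckeKernel s t) := by
  have h := MeasureTheory.Measure.integral_comp_mul_left
    (fun t : ℝ => heckeTerm s (w.im * Complex.I + (t : ℝ))) w.im
  simp only [heckeTerm_smul_I s hw] at h
  rw [MeasureTheory.integral_const_mul, integral_heckeTerm_I h0] at h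
  have e : ∫ t : ℝ, heckeTerm s (w + t) =
      ∫ t : ℝ, heckeTerm s (w.im * Complex.I + (t : ℝ)) := by
    rw [← MeasureTheory.integral_add_right_eq_self
      (fun t : ℝ => heckeTerm s (w.im * Complex.I + (t : ℝ))) w.re]
    refine MeasureTheory.integral_congr_ae (MeasureTheory.ae_of_all _ fun t => ?_)
    refine congrArg (heckeTerm s) ?_
    apply Complex.ext <;> simp [add_comm]
  rw [e]
  have ha : ((|w.im| : ℝ) : ℂ) ≠ 0 := by exact_mod_cast abs_ne_zero.mpr hw
  rw [abs_inv, Complex.real_smul, ← sq_abs w.im] at h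
  generalize (∫ t : ℝ, heckeTerm s (w.im * Complex.I + (t : ℝ))) = X at h ⊢
  push_cast at h ⊢
  have h2 : X = ((|w.im| : ℝ) : ℂ) * (((|w.im| : ℝ) : ℂ)⁻¹ * X) := by field_simp
  rw [h2, ← h]
  field_simp

/-! ### The lattice sum and its limit as s tends to 0. -/

lemma heckeTerm_zero_right (s : ℂ) : heckeTerm s 0 = 0 := by simp [heckeTerm]

lemma heckeTerm_zero_left (w : ℂ) : heckeTerm 0 w = (w ^ 2)⁻¹ := by simp [heckeTerm]

lemma norm_heckeTerm {s : ℂ} (hs : 0 ≤ s.re) (w : ℂ) : ‖heckeTerm s w‖ = ‖w‖ ^ (-(2 + 2 * s.re)) := by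
  rcases eq_or_ne w 0 with rfl | hw
  · rw [heckeTerm_zero_right, norm_zero, Real.zero_rpow (by linarith)]
  · have hp := norm_pos_iff.mpr hw
    rw [heckeTerm, norm_mul, norm_exp_hecke, norm_inv, norm_pow, neg_add, Real.rpow_add hp,
      Real.rpow_neg hp.le, Real.rpow_two, Real.rpow_def_of_pos hp]
    congr 2
    ring

lemma lattice_im (τ : ℂ) (p : ℤ × ℤ) : ((p.1 : ℂ) * τ + p.2).im = p.1 * τ.im := by simp

lemma lattice_im_ne_zero {τ : ℂ} (hτ : 0 < τ.im) {p : ℤ × ℤ} (hp : p.1 ≠ 0) :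
    ((p.1 : ℂ) * τ + p.2).im ≠ 0 := by
  rw [lattice_im]
  exact mul_ne_zero (by exact_mod_cast hp) hτ.ne'

lemma im_le_abs_lattice_im {τ : ℂ} (hτ : 0 < τ.im) {p : ℤ × ℤ} (hp : p.1 ≠ 0) :
    τ.im ≤ |((p.1 : ℂ) * τ + p.2).im| := by
  rw [lattice_im, abs_mul, abs_of_pos hτ]
  have : (1 : ℝ) ≤ |(p.1 : ℝ)| := by exact_mod_cast Int.one_le_abs hp
  nlinarith

lemma summable_norm_lattice_rpow {τ : ℂ} (hτ : 0 < τ.im) {k : ℝ} (hk : 2 < k) :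
    Summable fun p : ℤ × ℤ => ‖(p.1 : ℂ) * τ + p.2‖ ^ (-k) := by
  have h := ((EisensteinSeries.summable_one_div_norm_rpow hk).mul_left
    (EisensteinSeries.r ⟨τ, hτ⟩ ^ (-k)))
  have h2 : Summable fun x : Fin 2 → ℤ => ‖(x 0 : ℂ) * τ + x 1‖ ^ (-k) :=
    Summable.of_nonneg_of_le (fun x => by positivity)
      (fun x => EisensteinSeries.summand_bound ⟨τ, hτ⟩ (by linarith) x) h
  exact (finTwoArrowEquiv ℤ).symm.summable_iff.mpr h2

lemma summable_heckeTerm {τ : ℂ} (hτ : 0 < τ.im) {s : ℂ} (hs : 0 < s.re) :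
    Summable fun p : ℤ × ℤ => heckeTerm s ((p.1 : ℂ) * τ + p.2) := by
  refine Summable.of_norm ?_
  simp only [norm_heckeTerm hs.le]
  exact summable_norm_lattice_rpow hτ (by linarith)

/-- The unit interval integral of `heckeTerm` to the right of a lattice point off the real
line. -/
noncomputable def heckeInterval (s τ : ℂ) (p : ℤ × ℤ) : ℂ :=
  if p.1 = 0 then 0 else ∫ t in (0 : ℝ)..1, heckeTerm s ((p.1 : ℂ) * τ + p.2 + t)

/-- The dominating function for `heckeTerm - heckeInterval`. -/
noncomputable def heckeBound (τ : ℂ) (p : ℤ × ℤ) : ℝ :=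
  (if p.1 = 0 then 2 * ((p.2 : ℝ) ^ 2)⁻¹ else 0) +
    4 * (1 + (τ.im ^ 2)⁻¹) * (1 + τ.im⁻¹) ^ 3 * ‖(p.1 : ℂ) * τ + p.2‖ ^ (-3 : ℝ)

lemma summable_heckeBound {τ : ℂ} (hτ : 0 < τ.im) : Summable (heckeBound τ) := by
  refine Summable.add ?_ ((summable_norm_lattice_rpow hτ (by norm_num)).mul_left _)
  have hi : Function.Injective fun n : ℤ => ((0, n) : ℤ × ℤ) := fun a b h => by simpa using h
  refine (hi.summable_iff fun p hp => ?_).mp ?_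
  · rw [if_neg]
    rintro h
    exact hp ⟨p.2, by rw [← h]⟩
  · have := (Real.summable_one_div_int_pow (p := 2)).mpr (by norm_num)
    simpa [Function.comp_def] using this.mul_left 2

lemma norm_heckeTerm_sub_heckeInterval_le {τ : ℂ} (hτ : 0 < τ.im) {s : ℂ} (h0 : 0 ≤ s.re)
    (h1 : ‖s‖ ≤ 1) (p : ℤ × ℤ) :
    ‖heckeTerm s ((p.1 : ℂ) * τ + p.2) - heckeInterval s τ p‖ ≤ heckeBound τ p := by
  rw [heckeInterval, heckeBound]
  split_ifs with hp
  · rw [hp, sub_zero, Int.cast_zero, zero_mul, zero_add]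
    have hn : 0 ≤ 4 * (1 + (τ.im ^ 2)⁻¹) * (1 + τ.im⁻¹) ^ 3 * ‖(p.2 : ℂ)‖ ^ (-3 : ℝ) := by
      positivity
    refine le_trans ?_ (le_add_of_nonneg_right hn)
    rcases eq_or_ne p.2 0 with h | h
    · rw [h, Int.cast_zero, heckeTerm_zero_right]
      simp
    · have hb : (1 : ℝ) ≤ ‖(p.2 : ℂ)‖ := by
        rw [Complex.norm_intCast]
        exact_mod_cast Int.one_le_abs h
      have := norm_heckeTerm_le h0 ((Complex.re_le_norm s).trans h1) one_pos hb
      rw [Complex.norm_intCast, sq_abs] at this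
      norm_num at this ⊢
      exact this
  · rw [zero_add]
    refine (norm_heckeTerm_sub_integral_le h0 h1 hτ (im_le_abs_lattice_im hτ hp)).trans ?_
    rw [Real.rpow_neg (norm_nonneg _)]
    norm_num

lemma summable_heckeTerm_sub_heckeInterval {τ : ℂ} (hτ : 0 < τ.im) {s : ℂ} (h0 : 0 ≤ s.re)
    (h1 : ‖s‖ ≤ 1) :
    Summable fun p : ℤ × ℤ => heckeTerm s ((p.1 : ℂ) * τ + p.2) - heckeInterval s τ p :=
  (summable_heckeBound hτ).of_norm_bounded (norm_heckeTerm_sub_heckeInterval_le hτ h0 h1)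

/-- For m ≠ 0 the unit intervals of a row tile a whole horizontal line. The real row was given no
integrals, since it passes through 0 and converges on its own. -/
lemma hasSum_heckeInterval {τ : ℂ} (hτ : 0 < τ.im) {s : ℂ} (h0 : 0 ≤ s.re) (m : ℤ) :
    HasSum (fun n : ℤ => heckeInterval s τ (m, n))
      (if m = 0 then 0 else (|m * τ.im|⁻¹ : ℝ) *
        Complex.exp (-(2 * s * (Real.log |m * τ.im| : ℝ))) *
          (-(2 * s) * ∫ t : ℝ, heckeKernel s t)) := by
  simp only [heckeInterval]
  split_ifs with hm
  · exact hasSum_zero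
  · have hw : ((m : ℂ) * τ).im ≠ 0 := by
      simpa using lattice_im_ne_zero hτ (p := (m, 0)) hm
    have h := (integrable_heckeTerm_line h0 hw).hasSum_intervalIntegral_comp_add_int
    rw [integral_heckeTerm_line h0 hw] at h
    have e : ((m : ℂ) * τ).im = m * τ.im := by simp
    rw [e] at h
    have e2 : ∀ (n : ℤ) (t : ℝ), (m : ℂ) * τ + n + t = m * τ + ((t + n : ℝ) : ℂ) := by
      intro n t
      push_cast
      ring
    simpa only [e2] using h

/-- The integers split into n ≥ 0 and −(n + 1); the term at 0 vanishes on both sides because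
0^(1+2s) = 0 and 1/0 = 0. -/
lemma hasSum_int_abs_cpow {s : ℂ} (hs : 0 < s.re) :
    HasSum (fun m : ℤ => if m = 0 then 0 else
      ((|(m : ℝ)|⁻¹ : ℝ) : ℂ) * Complex.exp (-(2 * s * (Real.log |(m : ℝ)| : ℝ))))
      (2 * riemannZeta (1 + 2 * s)) := by
  have hre : 1 < (1 + 2 * s).re := by simp; linarith
  have hne : 1 + 2 * s ≠ 0 := by
    intro h
    rw [h] at hre
    norm_num at hre
  have h1 : HasSum (fun n : ℕ => 1 / (n : ℂ) ^ (1 + 2 * s)) (riemannZeta (1 + 2 * s)) := by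
    rw [zeta_eq_tsum_one_div_nat_cpow hre]
    exact (Complex.summable_one_div_nat_cpow.mpr hre).hasSum
  have h2 : HasSum (fun n : ℕ => 1 / ((n + 1 : ℕ) : ℂ) ^ (1 + 2 * s))
      (riemannZeta (1 + 2 * s)) := by
    have := (hasSum_nat_add_iff' 1).mpr h1
    simpa [Complex.zero_cpow hne] using this
  have key : ∀ n : ℕ, n ≠ 0 → ((|(n : ℝ)|⁻¹ : ℝ) : ℂ) *
      Complex.exp (-(2 * s * (Real.log |(n : ℝ)| : ℝ))) = 1 / (n : ℂ) ^ (1 + 2 * s) := by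
    intro n hn
    have hn' : (n : ℂ) ≠ 0 := by exact_mod_cast hn
    rw [Complex.cpow_add _ _ hn', Complex.cpow_one, Complex.cpow_def_of_ne_zero hn', one_div,
      mul_inv, ← Complex.exp_neg, Nat.abs_cast, ← Complex.natCast_log]
    push_cast
    ring_nf
  have main : ∀ F : ℤ → ℂ, (∀ n : ℕ, F n = 1 / (n : ℂ) ^ (1 + 2 * s)) →
      (∀ n : ℕ, F (-(n + 1)) = 1 / ((n + 1 : ℕ) : ℂ) ^ (1 + 2 * s)) →
      HasSum F (2 * riemannZeta (1 + 2 * s)) := by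
    intro F hF hF'
    rw [two_mul]
    simp only [← hF] at h1
    simp only [← hF'] at h2
    exact h1.of_nat_of_neg_add_one h2
  refine main _ (fun n => ?_) fun n => ?_
  · rcases eq_or_ne n 0 with rfl | hn
    · simp [Complex.zero_cpow hne]
    · rw [if_neg (by exact_mod_cast hn), ← key n hn]
      norm_cast
  · rw [if_neg (by omega), ← key _ n.succ_ne_zero]
    have : |(((-((n : ℤ) + 1) : ℤ)) : ℝ)| = |((n + 1 : ℕ) : ℝ)| := by
      push_cast
      rw [abs_neg]
    rw [this]

/-- The lattice sum is a part that remains summable at s = 0 plus the integrals, which are summed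
row by row to a multiple of s ζ(1 + 2s). -/
lemma tsum_heckeTerm {τ : ℂ} (hτ : 0 < τ.im) {s : ℂ} (h0 : 0 < s.re) (h1 : ‖s‖ ≤ 1) :
    ∑' p : ℤ × ℤ, heckeTerm s ((p.1 : ℂ) * τ + p.2) =
      ∑' p : ℤ × ℤ, (heckeTerm s ((p.1 : ℂ) * τ + p.2) - heckeInterval s τ p) +
      (τ.im⁻¹ : ℝ) * Complex.exp (-(2 * s * (Real.log τ.im : ℝ))) *
        (-(2 * s) * ∫ t : ℝ, heckeKernel s t) * (2 * riemannZeta (1 + 2 * s)) := by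
  have hS := (summable_heckeTerm hτ h0).hasSum
  have hD := (summable_heckeTerm_sub_heckeInterval hτ h0.le h1).hasSum
  have h := hS.sub hD
  simp only [sub_sub_cancel] at h
  have h2 := h.prod_fiberwise (hasSum_heckeInterval hτ h0.le)
  have h3 := (hasSum_int_abs_cpow h0).mul_left ((τ.im⁻¹ : ℝ) *
    Complex.exp (-(2 * s * (Real.log τ.im : ℝ))) * (-(2 * s) * ∫ t : ℝ, heckeKernel s t))
  have e := h2.tsum_eq.symm.trans ((tsum_congr fun m => ?_).trans h3.tsum_eq)
  · linear_combination e
  · split_ifs with hm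
    · simp
    · have hm' : |(m : ℝ)| ≠ 0 := by exact_mod_cast abs_ne_zero.mpr hm
      rw [abs_mul, abs_of_pos hτ, Real.log_mul hm' hτ.ne', mul_inv]
      push_cast
      rw [mul_add, neg_add, Complex.exp_add]
      ring

lemma continuous_heckeTerm_left (w : ℂ) : Continuous fun s => heckeTerm s w := by
  unfold heckeTerm
  fun_prop

lemma continuous_heckeInterval_left {τ : ℂ} (hτ : 0 < τ.im) (p : ℤ × ℤ) :
    Continuous fun s => heckeInterval s τ p := by
  unfold heckeInterval
  split_ifs with hp
  · exact continuous_const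
  · refine intervalIntegral.continuous_parametric_intervalIntegral_of_continuous' ?_ 0 1
    have hw := lattice_im_ne_zero hτ hp
    have hc : Continuous fun q : ℂ × ℝ => (p.1 : ℂ) * τ + p.2 + (q.2 : ℂ) := by fun_prop
    have h0 : ∀ q : ℂ × ℝ, (p.1 : ℂ) * τ + p.2 + (q.2 : ℂ) ≠ 0 :=
      fun q => add_real_ne_zero hw q.2
    unfold heckeTerm
    refine ((hc.pow 2).inv₀ fun q => pow_ne_zero 2 (h0 q)).mul (Complex.continuous_exp.comp ?_)
    exact ((continuous_const.mul continuous_fst).mul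
      (Complex.continuous_ofReal.comp (hc.norm.log fun q => norm_ne_zero_iff.mpr (h0 q)))).neg

lemma eventually_norm_le_one : ∀ᶠ s : ℂ in 𝓝[{s : ℂ | 0 < s.re}] 0, 0 < s.re ∧ ‖s‖ ≤ 1 := by
  filter_upwards [self_mem_nhdsWithin,
    mem_nhdsWithin_of_mem_nhds (Metric.closedBall_mem_nhds (0 : ℂ) one_pos)] with s hs hb
  exact ⟨hs, by simpa using hb⟩

lemma tendsto_tsum_heckeTerm_sub {τ : ℂ} (hτ : 0 < τ.im) :
    Tendsto (fun s => ∑' p : ℤ × ℤ, (heckeTerm s ((p.1 : ℂ) * τ + p.2) - heckeInterval s τ p))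
      (𝓝[{s : ℂ | 0 < s.re}] 0)
      (𝓝 (∑' p : ℤ × ℤ, (heckeTerm 0 ((p.1 : ℂ) * τ + p.2) - heckeInterval 0 τ p))) := by
  refine tendsto_tsum_of_dominated_convergence (summable_heckeBound hτ) (fun p => ?_) ?_
  · exact (((continuous_heckeTerm_left _).sub (continuous_heckeInterval_left hτ p)).tendsto 0).mono_left
      nhdsWithin_le_nhds
  · filter_upwards [eventually_norm_le_one] with s hs
    exact norm_heckeTerm_sub_heckeInterval_le hτ hs.1.le hs.2

/-- At s = 0 the row integrals vanish, so the absolutely convergent double sum of differences has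
the same row sums as the Eisenstein-ordered series defining E₂. -/
lemma tsum_heckeTerm_zero_sub {τ : ℂ} (hτ : 0 < τ.im) :
    ∑' p : ℤ × ℤ, (heckeTerm 0 ((p.1 : ℂ) * τ + p.2) - heckeInterval 0 τ p) =
      2 * riemannZeta 2 * eisE2 τ := by
  have h := (summable_heckeTerm_sub_heckeInterval hτ (s := 0) (by simp) (by simp)).hasSum
  have hrow : ∀ m : ℤ, HasSum (fun n : ℤ => heckeTerm 0 ((m : ℂ) * τ + n) - heckeInterval 0 τ (m, n))
      (EisensteinSeries.e2Summand m ⟨τ, hτ⟩) := by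
    intro m
    have h1 := (EisensteinSeries.e2Summand_summable m ⟨τ, hτ⟩).hasSum
    have h2 := hasSum_heckeInterval hτ (s := 0) (by simp) m
    have h3 := h1.sub h2
    simp only [mul_zero, neg_zero, zero_mul, ite_self, sub_zero] at h3
    convert! h3 using 3 with n
    simp [heckeTerm_zero_left, EisensteinSeries.eisSummand]
  have h4 := h.prod_fiberwise hrow
  -- The series `G2` sums the rows over symmetric intervals; the row sums converge unconditionally
  -- here, so the two totals agree.
  rw [← h4.tsum_eq, eisE2, UpperHalfPlane.ofComplex_apply_of_im_pos hτ, EisensteinSeries.E2,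
    Pi.smul_apply, EisensteinSeries.G2, smul_eq_mul,
    tsum_eq_of_summable_unconditional (L := SummationFilter.symmetricIcc ℤ) h4.summable]
  have : riemannZeta 2 ≠ 0 := riemannZeta_ne_zero_of_one_lt_re (by norm_num)
  field_simp

lemma nonholEisenstein_two_eq {τ : ℂ} (hτ : 0 < τ.im) {s : ℂ} (hs : 0 < s.re) :
    nonholEisenstein 2 s τ = 1 / 2 * (Complex.exp (s * (Real.log τ.im : ℝ)) *
      ∑' p : ℤ × ℤ, heckeTerm s ((p.1 : ℂ) * τ + p.2)) := by
  rw [nonholEisenstein]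
  congr 1
  have hf : ∀ p : {p : ℤ × ℤ // p ≠ (0, 0)},
      (1 / ((p.1.1 : ℂ) * τ + (p.1.2 : ℂ)) ^ 2) *
      ((τ.im : ℂ) ^ s / ((‖(p.1.1 : ℂ) * τ + (p.1.2 : ℂ)‖ : ℝ) : ℂ) ^ (2 * s)) =
      (fun p : ℤ × ℤ => Complex.exp (s * (Real.log τ.im : ℝ)) *
        heckeTerm s ((p.1 : ℂ) * τ + p.2)) p.1 := by
    intro p
    have hs0 : 2 * s ≠ 0 := by
      intro h
      have : s = 0 := by simpa using h
      simp [this] at hs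
    have hy : (τ.im : ℂ) ≠ 0 := by exact_mod_cast hτ.ne'
    beta_reduce
    rcases eq_or_ne ((p.1.1 : ℂ) * τ + (p.1.2 : ℂ)) 0 with h0 | h0
    · rw [h0, heckeTerm_zero_right]
      simp
    · have hn : ((‖(p.1.1 : ℂ) * τ + (p.1.2 : ℂ)‖ : ℝ) : ℂ) ≠ 0 := by
        exact_mod_cast norm_ne_zero_iff.mpr h0
      rw [heckeTerm, Complex.cpow_def_of_ne_zero hy, Complex.cpow_def_of_ne_zero hn,
        ← Complex.ofReal_log hτ.le, ← Complex.ofReal_log (norm_nonneg _), Complex.exp_neg,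
        mul_comm s, mul_comm (2 * s)]
      ring
  -- The origin may be added to the sum since the term there is 0 by the convention 0⁻¹ = 0.
  have hsub := tsum_subtype_eq_of_support_subset (s := {p : ℤ × ℤ | p ≠ (0, 0)})
    (f := fun p : ℤ × ℤ => Complex.exp (s * (Real.log τ.im : ℝ)) *
      heckeTerm s ((p.1 : ℂ) * τ + p.2)) (by
      rintro p hp rfl
      exact hp (by simp [heckeTerm_zero_right]))
  exact ((tsum_congr hf).trans hsub).trans tsum_mul_left

lemma tendsto_mul_riemannZeta :
    Tendsto (fun s : ℂ => 2 * s * riemannZeta (1 + 2 * s)) (𝓝[{s : ℂ | 0 < s.re}] 0) (𝓝 1) := by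
  have h : Tendsto (fun s : ℂ => 1 + 2 * s) (𝓝[{s : ℂ | 0 < s.re}] 0) (𝓝[≠] 1) := by
    refine tendsto_nhdsWithin_iff.mpr ⟨?_, ?_⟩
    · have : Continuous fun s : ℂ => 1 + 2 * s := by fun_prop
      simpa using (this.tendsto 0).mono_left nhdsWithin_le_nhds
    · filter_upwards [self_mem_nhdsWithin] with s hs h
      have : s = 0 := by simpa using h
      simp [this] at hs
  refine (riemannZeta_residue_one.comp h).congr fun s => ?_
  simp

/-- The zero of the line integral cancels the pole of ζ(1 + 2s), leaving a constant over Im τ. The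
value of that constant plays no role later. -/
lemma tendsto_nonholEisenstein_two {τ : ℂ} (hτ : 0 < τ.im) :
    Tendsto (fun s => nonholEisenstein 2 s τ) (𝓝[{s : ℂ | 0 < s.re}] 0)
      (𝓝 (riemannZeta 2 * eisE2 τ - (∫ t : ℝ, heckeKernel 0 t) / τ.im)) := by
  have hc : ∀ c : ℂ, Tendsto (fun s : ℂ => Complex.exp (c * s)) (𝓝[{s : ℂ | 0 < s.re}] 0)
      (𝓝 1) := by
    intro c
    have : Continuous fun s : ℂ => Complex.exp (c * s) := by fun_prop
    simpa using (this.tendsto 0).mono_left nhdsWithin_le_nhds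
  have h := ((hc (Real.log τ.im : ℝ)).mul ((tendsto_tsum_heckeTerm_sub hτ).add
    ((((hc (-(2 * (Real.log τ.im : ℝ)))).mul tendsto_mul_riemannZeta).mul
      tendsto_integral_heckeKernel).const_mul (-2 * (τ.im : ℂ)⁻¹)))).const_mul (1 / 2)
  rw [tsum_heckeTerm_zero_sub hτ] at h
  have hl : riemannZeta 2 * eisE2 τ - (∫ t : ℝ, heckeKernel 0 t) / τ.im =
      1 / 2 * (1 * (2 * riemannZeta 2 * eisE2 τ +
        -2 * (τ.im : ℂ)⁻¹ * (1 * 1 * ∫ t : ℝ, heckeKernel 0 t))) := by ring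
  rw [hl]
  refine h.congr' ?_
  filter_upwards [eventually_norm_le_one] with s hs
  rw [nonholEisenstein_two_eq hτ hs.1, tsum_heckeTerm hτ hs.1 hs.2]
  generalize ∑' p : ℤ × ℤ, (heckeTerm s ((p.1 : ℂ) * τ + p.2) - heckeInterval s τ p) = D
  push_cast
  ring_nf

instance : (𝓝[{s : ℂ | 0 < s.re}] (0 : ℂ)).NeBot := by
  rw [← mem_closure_iff_nhdsWithin_neBot, Complex.closure_setOfPred_lt_re]
  simp

lemma G2star_eq {τ : ℂ} (hτ : 0 < τ.im) :
    G2star τ = riemannZeta 2 * eisE2 τ - (∫ t : ℝ, heckeKernel 0 t) / τ.im :=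
  (tendsto_nonholEisenstein_two hτ).limUnder_eq

lemma G2level_eq {N : ℕ} (hN : N ≠ 0) {τ : ℂ} (hτ : 0 < τ.im) :
    G2level N τ = riemannZeta 2 * (N * eisE2 (N * τ) - eisE2 τ) := by
  have hN' : (0 : ℝ) < N := by exact_mod_cast Nat.pos_of_ne_zero hN
  have him : ((N : ℂ) * τ).im = N * τ.im := by simp
  have hy : (τ.im : ℂ) ≠ 0 := by exact_mod_cast hτ.ne'
  have hNc : (N : ℂ) ≠ 0 := by exact_mod_cast hN
  rw [G2level, G2star_eq hτ, G2star_eq (by rw [him]; positivity), him]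
  push_cast
  field_simp
  ring

/-! ### The function u₆ as a theta quotient, and the two Eisenstein ratios. -/

lemma G2level_two {τ : ℂ} (hτ : 0 < τ.im) : G2level 2 τ = riemannZeta 2 * eisTwo τ := by
  simpa [eisTwo] using G2level_eq two_ne_zero hτ

lemma G2level_three {τ : ℂ} (hτ : 0 < τ.im) : G2level 3 τ = riemannZeta 2 * eisThree τ := by
  simpa [eisThree] using G2level_eq three_ne_zero hτ

/-- Solving the first two linear relations gives a(q²) = 6X + Y and a(q) = 12X + Y, where X/Y =
η(2τ)η(6τ)⁵/(η(τ)⁵η(3τ)). -/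
lemma u6Num_u6Den_eq {τ : ℂ} (hτ : 0 < τ.im) : ∃ c : ℂ, c ≠ 0 ∧
    u6Num τ = c * cubicA (2 * τ) ∧ u6Den τ = c * cubicA τ := by
  obtain ⟨h1, h2, h3, h6⟩ := eta_scales_ne_zero hτ
  have hX := cubicA_sub_eq hτ
  have hY := two_mul_cubicA_sub_eq hτ
  have hY0 := etaY_ne_zero hτ
  refine ⟨ModularForm.eta τ ^ 5 * ModularForm.eta (3 * τ) / etaY τ,
    div_ne_zero (mul_ne_zero (pow_ne_zero 5 h1) h3) hY0, ?_, ?_⟩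
  · have e : cubicA (2 * τ) = 6 * etaX τ + etaY τ := by linear_combination hX + hY
    rw [etaY] at hY0
    rw [e, u6Num, etaX, etaY]
    clear e hX hY
    generalize ModularForm.eta (2 * τ) = e2 at *
    generalize ModularForm.eta (3 * τ) = e3 at *
    generalize ModularForm.eta (6 * τ) = e6 at *
    generalize ModularForm.eta τ = e1 at *
    field_simp
  · have e : cubicA τ = 12 * etaX τ + etaY τ := by linear_combination 2 * hX + hY
    rw [etaY] at hY0
    rw [e, u6Den, etaX, etaY]
    clear e hX hY
    generalize ModularForm.eta (2 * τ) = e2 at *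
    generalize ModularForm.eta (3 * τ) = e3 at *
    generalize ModularForm.eta (6 * τ) = e6 at *
    generalize ModularForm.eta τ = e1 at *
    field_simp

lemma u6Den_ne_zero_iff {τ : ℂ} (hτ : 0 < τ.im) : u6Den τ ≠ 0 ↔ cubicA τ ≠ 0 := by
  obtain ⟨c, hc, -, h⟩ := u6Num_u6Den_eq hτ
  rw [h, mul_ne_zero_iff]
  exact and_iff_right hc

lemma u6_eq {τ : ℂ} (hτ : 0 < τ.im) : u6 τ = cubicA (2 * τ) / cubicA τ := by
  obtain ⟨c, hc, h, h'⟩ := u6Num_u6Den_eq hτ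
  rw [u6, h, h', mul_div_mul_left _ _ hc]

theorem G2level_two_ratio {τ : ℂ} (hτ : 0 < τ.im) (hd : u6Den τ ≠ 0) (hG : G2level 2 τ ≠ 0) :
    6 * u6 τ ^ 2 - 6 * u6 τ - 3 ≠ 0 ∧
      G2level 2 (3 * τ) / G2level 2 τ =
        (-2 * u6 τ ^ 2 - 2 * u6 τ + 1) / (6 * u6 τ ^ 2 - 6 * u6 τ - 3) := by
  rw [u6Den_ne_zero_iff hτ] at hd
  obtain ⟨e1, e3⟩ := eisTwo_eq hτ
  rw [G2level_two hτ, mul_ne_zero_iff] at hG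
  obtain ⟨hz, hE⟩ := hG
  have hx : 6 * u6 τ ^ 2 - 6 * u6 τ - 3 = -3 * eisTwo τ / cubicA τ ^ 2 := by
    rw [u6_eq hτ, e1]
    field_simp
    ring
  have hx' : -2 * u6 τ ^ 2 - 2 * u6 τ + 1 = -3 * eisTwo (3 * τ) / cubicA τ ^ 2 := by
    rw [neg_mul 3 (eisTwo _), e3, u6_eq hτ]
    field_simp
    ring
  rw [hx, hx', G2level_two hτ, G2level_two (im_three_mul_pos hτ)]
  refine ⟨div_ne_zero (mul_ne_zero (by norm_num) hE) (pow_ne_zero 2 hd), ?_⟩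
  field_simp

theorem G2level_three_ratio {τ : ℂ} (hτ : 0 < τ.im) (hG : G2level 3 τ ≠ 0) :
    G2level 3 (2 * τ) / G2level 3 τ = u6 τ ^ 2 := by
  rw [G2level_three hτ, mul_ne_zero_iff] at hG
  rw [G2level_three hτ, G2level_three (im_two_mul_pos hτ), mul_div_mul_left _ _ hG.1,
    eisThree_eq hτ, eisThree_eq (im_two_mul_pos hτ), u6_eq hτ, div_pow]
  exact mul_div_mul_left _ _ two_ne_zero

/-! ### The modular equation between u₆(τ) and u₆(3τ). -/

lemma cubicB_ne_zero {τ : ℂ} (hτ : 0 < τ.im) : cubicB τ ≠ 0 := by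
  obtain ⟨h1, -, h3, -⟩ := eta_scales_ne_zero hτ
  rw [cubicB_eq hτ]
  exact div_ne_zero (pow_ne_zero 3 h1) h3

lemma cubicB_two_mul_eq {τ : ℂ} (hτ : 0 < τ.im) :
    cubicB (2 * τ) = ModularForm.eta (2 * τ) ^ 3 / ModularForm.eta (6 * τ) := by
  rw [cubicB_eq (im_two_mul_pos hτ), ← mul_assoc]
  norm_num

lemma cubicB_sq {τ : ℂ} (hτ : 0 < τ.im) :
    cubicB τ ^ 2 = cubicB (2 * τ) * (2 * cubicA (2 * τ) - cubicA τ) := by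
  obtain ⟨h1, h2, h3, h6⟩ := eta_scales_ne_zero hτ
  rw [two_mul_cubicA_sub_eq hτ, cubicB_eq hτ, cubicB_two_mul_eq hτ, etaY]
  generalize ModularForm.eta (2 * τ) = e2 at *
  generalize ModularForm.eta (3 * τ) = e3 at *
  generalize ModularForm.eta (6 * τ) = e6 at *
  generalize ModularForm.eta τ = e1 at *
  field_simp

lemma cubicB_two_mul_sq {τ : ℂ} (hτ : 0 < τ.im) :
    2 * cubicB (2 * τ) ^ 2 = cubicB τ * (cubicA τ + cubicA (2 * τ)) := by
  obtain ⟨h1, h2, h3, h6⟩ := eta_scales_ne_zero hτ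
  rw [cubicA_add_eq hτ, cubicB_eq hτ, cubicB_two_mul_eq hτ, etaZ]
  generalize ModularForm.eta (2 * τ) = e2 at *
  generalize ModularForm.eta (3 * τ) = e3 at *
  generalize ModularForm.eta (6 * τ) = e6 at *
  generalize ModularForm.eta τ = e1 at *
  field_simp

theorem u6_modular_equation {τ : ℂ} (hτ : 0 < τ.im) (hd : u6Den τ ≠ 0) (hd' : u6Den (3 * τ) ≠ 0)
    {x y : ℂ} (hx : x = u6 τ) (hy : y = u6 (3 * τ)) :
    16 * x ^ 3 * y ^ 3 - 12 * (x ^ 3 * y + x * y ^ 3) + 12 * x ^ 2 * y ^ 2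
      - 5 * (x ^ 3 - y ^ 3) - 3 * (x ^ 2 * y - x * y ^ 2) - 6 * (x ^ 2 + y ^ 2)
      + 6 * x * y + 2 = 0 := by
  have h3 := im_three_mul_pos hτ
  rw [u6Den_ne_zero_iff hτ] at hd
  rw [u6Den_ne_zero_iff h3] at hd'
  rw [u6_eq hτ] at hx
  rw [u6_eq h3] at hy
  have hb := cubicB_ne_zero hτ
  have hg := cubicB_ne_zero (im_two_mul_pos hτ)
  have e1 := cubicB_sq hτ
  have e2 := cubicB_two_mul_sq hτ
  have e3 : 3 * cubicA (3 * τ) = cubicA τ + 2 * cubicB τ := by rw [cubicB]; ring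
  have e6 : 3 * cubicA (2 * (3 * τ)) = cubicA (2 * τ) + 2 * cubicB (2 * τ) := by
    rw [cubicB, mul_left_comm 2 3 τ]; ring
  generalize cubicA (2 * (3 * τ)) = B' at *
  generalize cubicA (3 * τ) = A' at *
  generalize cubicB (2 * τ) = γ at *
  generalize cubicB τ = β at *
  generalize cubicA (2 * τ) = B at *
  generalize cubicA τ = A at *
  -- With β = b(q) and γ = b(q²), the linear forms 2B − A and A + B become monomials in β, γ. Hence
  -- A, B, and through b also A', B', are rational in β and γ.
  have f1 : 2 * B - A = β ^ 2 / γ := by rw [e1]; field_simp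
  have f2 : A + B = 2 * γ ^ 2 / β := by rw [e2]; field_simp
  have hA : A = (4 * γ ^ 3 - β ^ 3) / (3 * β * γ) := by
    have : A = (2 * (A + B) - (2 * B - A)) / 3 := by ring
    rw [this, f1, f2]
    field_simp
    ring
  have hB : B = (2 * γ ^ 3 + β ^ 3) / (3 * β * γ) := by
    have : B = ((A + B) + (2 * B - A)) / 3 := by ring
    rw [this, f1, f2]
    field_simp
  have hA' : A' = (4 * γ ^ 3 - β ^ 3 + 6 * β ^ 2 * γ) / (9 * β * γ) := by
    have : A' = (A + 2 * β) / 3 := by linear_combination e3 / 3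
    rw [this, hA]
    field_simp
    ring
  have hB' : B' = (2 * γ ^ 3 + β ^ 3 + 6 * β * γ ^ 2) / (9 * β * γ) := by
    have : B' = (B + 2 * γ) / 3 := by linear_combination e6 / 3
    rw [this, hB]
    field_simp
    ring
  have hx2 : x = (2 * γ ^ 3 + β ^ 3) / (4 * γ ^ 3 - β ^ 3) := by
    rw [hx, hA, hB, div_div_div_cancel_right₀ (by simp [hb, hg])]
  have hy2 : y = (2 * γ ^ 3 + β ^ 3 + 6 * β * γ ^ 2) /
      (4 * γ ^ 3 - β ^ 3 + 6 * β ^ 2 * γ) := by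
    rw [hy, hA', hB', div_div_div_cancel_right₀ (by simp [hb, hg])]
  have nP : 4 * γ ^ 3 - β ^ 3 ≠ 0 := fun h => hd (by rw [hA, h, zero_div])
  have nQ : 4 * γ ^ 3 - β ^ 3 + 6 * β ^ 2 * γ ≠ 0 := fun h => hd' (by rw [hA', h, zero_div])
  have hN : x * (4 * γ ^ 3 - β ^ 3) = 2 * γ ^ 3 + β ^ 3 := by rw [hx2, div_mul_cancel₀ _ nP]
  have hM : y * (4 * γ ^ 3 - β ^ 3 + 6 * β ^ 2 * γ) = 2 * γ ^ 3 + β ^ 3 + 6 * β * γ ^ 2 := by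
    rw [hy2, div_mul_cancel₀ _ nQ]
  -- The denominators stay opaque while the equation is multiplied by P³Q³; only then are they
  -- expanded, leaving a polynomial identity in β and γ.
  obtain ⟨P, hP⟩ : ∃ P, P = 4 * γ ^ 3 - β ^ 3 := ⟨_, rfl⟩
  obtain ⟨Q, hQ⟩ : ∃ Q, Q = 4 * γ ^ 3 - β ^ 3 + 6 * β ^ 2 * γ := ⟨_, rfl⟩
  rw [← hP] at nP hN
  rw [← hQ] at nQ hM
  refine (mul_eq_zero.mp ?_).resolve_right
    (mul_ne_zero (pow_ne_zero 3 nP) (pow_ne_zero 3 nQ) : P ^ 3 * Q ^ 3 ≠ 0)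
  have e : ∀ N M : ℂ, x * P = N → y * Q = M →
      (16 * x ^ 3 * y ^ 3 - 12 * (x ^ 3 * y + x * y ^ 3) + 12 * x ^ 2 * y ^ 2
      - 5 * (x ^ 3 - y ^ 3) - 3 * (x ^ 2 * y - x * y ^ 2) - 6 * (x ^ 2 + y ^ 2)
      + 6 * x * y + 2) * (P ^ 3 * Q ^ 3) =
      16 * N ^ 3 * M ^ 3 - 12 * (N ^ 3 * M * Q ^ 2 + N * M ^ 3 * P ^ 2) + 12 * N ^ 2 * M ^ 2 * P * Q
      - 5 * (N ^ 3 * Q ^ 3 - M ^ 3 * P ^ 3) - 3 * (N ^ 2 * M * P * Q ^ 2 - N * M ^ 2 * P ^ 2 * Q)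
      - 6 * (N ^ 2 * P * Q ^ 3 + M ^ 2 * P ^ 3 * Q) + 6 * N * M * P ^ 2 * Q ^ 2
      + 2 * P ^ 3 * Q ^ 3 := by
    rintro _ _ rfl rfl
    ring
  rw [e _ _ hN hM, hP, hQ]
  ring

/-! ### Cubic relations for b and c, and the special values. -/

lemma cubicB_cube {τ : ℂ} (hτ : 0 < τ.im) :
    2 * cubicB τ ^ 3 = (2 * cubicA (2 * τ) - cubicA τ) ^ 2 * (cubicA τ + cubicA (2 * τ)) := by
  have e1 := cubicB_sq hτ
  have e2 := cubicB_two_mul_sq hτ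
  -- The two quadratic relations are combined to eliminate b(q²); the nonzero factors b(q) and
  -- b(q²)² are cancelled.
  refine mul_left_cancel₀ (cubicB_ne_zero hτ) ?_
  refine mul_left_cancel₀ (pow_ne_zero 2 (cubicB_ne_zero (im_two_mul_pos hτ))) ?_
  generalize cubicB (2 * τ) = γ at *
  generalize cubicB τ = β at *
  linear_combination (2 * γ ^ 2 * (β ^ 2 + γ * (2 * cubicA (2 * τ) - cubicA τ))) * e1 +
    γ ^ 2 * (2 * cubicA (2 * τ) - cubicA τ) ^ 2 * e2

/-- In terms of the eta quotients X and V, the product 54XV² collapses to 54η(3τ)⁹/η(τ)³. -/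
lemma cubicC_cube {τ : ℂ} (hτ : 0 < τ.im) :
    2 * cubicC τ ^ 3 =
      (cubicA τ - cubicA (2 * τ)) * (cubicA τ + 2 * cubicA (2 * τ)) ^ 2 := by
  obtain ⟨h1, h2, h3, h6⟩ := eta_scales_ne_zero hτ
  rw [cubicA_sub_eq hτ, cubicA_add_two_mul_eq hτ, cubicC_eq hτ, etaX, etaV]
  generalize ModularForm.eta (2 * τ) = e2 at *
  generalize ModularForm.eta (3 * τ) = e3 at *
  generalize ModularForm.eta (6 * τ) = e6 at *
  generalize ModularForm.eta τ = e1 at *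
  field_simp
  norm_num

lemma cubicC_two_mul_cube {τ : ℂ} (hτ : 0 < τ.im) :
    4 * cubicC (2 * τ) ^ 3 =
      (cubicA τ - cubicA (2 * τ)) ^ 2 * (cubicA τ + 2 * cubicA (2 * τ)) := by
  obtain ⟨h1, h2, h3, h6⟩ := eta_scales_ne_zero hτ
  rw [cubicA_sub_eq hτ, cubicA_add_two_mul_eq hτ, cubicC_eq (im_two_mul_pos hτ), etaX, etaV,
    show 3 * (2 * τ) = 6 * τ by ring]
  generalize ModularForm.eta (2 * τ) = e2 at *
  generalize ModularForm.eta (3 * τ) = e3 at *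
  generalize ModularForm.eta (6 * τ) = e6 at *
  generalize ModularForm.eta τ = e1 at *
  field_simp
  norm_num

/-- The values of `u₆` on the imaginary axis, between `1 / 2` and `1`. -/
lemma u6_I_mul {y : ℝ} (hy : 0 < y) : u6Den (Complex.I * y) ≠ 0 ∧ ∃ x : ℝ,
    u6 (Complex.I * y) = x ∧ 1 / 2 < x ∧ x < 1 ∧ cubicAImag (2 * y) = x * cubicAImag y := by
  have hτ : 0 < (Complex.I * y).im := by simpa using hy
  have ha := cubicAImag_pos hy
  have hb := cubicAImag_lt hy (by linarith : y < 2 * y)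
  refine ⟨?_, cubicAImag (2 * y) / cubicAImag y, ?_, ?_, ?_, ?_⟩
  · rw [u6Den_ne_zero_iff hτ, cubicA_I_mul]
    exact_mod_cast ha.ne'
  · rw [u6_eq hτ, cubicA_I_mul, cubicA_two_mul_I]
    push_cast
    rfl
  -- The lower bound 1/2 is the positivity of 2a(q²) − a(q), which is an eta quotient.
  · obtain ⟨r, hr, h⟩ := isPosReal_etaY hy
    rw [← two_mul_cubicA_sub_eq hτ, cubicA_I_mul, cubicA_two_mul_I] at h
    have h' : 2 * cubicAImag (2 * y) - cubicAImag y = r := by exact_mod_cast h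
    rw [lt_div_iff₀ ha]
    linarith
  · rwa [div_lt_one ha]
  · field_simp

lemma cubicAImag_fricke {y : ℝ} (hy : 0 < y) :
    cubicAImag (1 / (3 * y)) = √3 * y * cubicAImag y := by
  have h := cubicA_fricke (τ := Complex.I * y) (by simpa using hy)
  have hy' : (y : ℂ) ≠ 0 := by exact_mod_cast hy.ne'
  have e : -1 / (3 * (Complex.I * y)) = Complex.I * ((1 / (3 * y) : ℝ) : ℂ) := by
    push_cast
    field_simp
    rw [Complex.I_sq]
  have e' : -Complex.I * √3 * (Complex.I * y) = ((√3 * y : ℝ) : ℂ) := by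
    push_cast
    linear_combination (-(√3 : ℂ) * y) * Complex.I_sq
  rw [e, e', cubicA_I_mul, cubicA_I_mul] at h
  exact_mod_cast h

lemma sqrt_three_bounds : (√3 : ℝ) ^ 2 = 3 ∧ 1 < √3 ∧ √3 < 2 := by
  refine ⟨Real.sq_sqrt (by norm_num), ?_, ?_⟩
  · exact Real.lt_sqrt_of_sq_lt (by norm_num)
  · exact (Real.sqrt_lt' two_pos).mpr (by norm_num)

lemma rpow_mul_sqrt_two : 0 < (3 : ℝ) ^ (3 / 4 : ℝ) * √2 ∧
    ((3 : ℝ) ^ (3 / 4 : ℝ) * √2) ^ 2 = 6 * √3 := by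
  refine ⟨by positivity, ?_⟩
  rw [mul_pow, Real.sq_sqrt two_pos.le, ← Real.rpow_natCast, ← Real.rpow_mul (by norm_num)]
  have : (3 / 4 : ℝ) * (2 : ℕ) = 1 + 1 / 2 := by norm_num
  rw [this, Real.rpow_add three_pos, Real.rpow_one, ← Real.sqrt_eq_rpow]
  ring

/-- Here 3τ = −1/(3τ), so b(q) = (√3 − 1)a(q)/2 and the cubic relation for b is an equation for u₆.
-/
theorem u6_I_div_three : u6Den (Complex.I / 3) ≠ 0 ∧
    u6 (Complex.I / 3) = (((3 : ℝ) ^ (3 / 4 : ℝ) * √2 + 1 - √3) / 4 : ℝ) := by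
  have hy : (0 : ℝ) < 1 / 3 := by norm_num
  have e : Complex.I / 3 = Complex.I * ((1 / 3 : ℝ) : ℂ) := by push_cast; ring
  have hτ : 0 < (Complex.I * ((1 / 3 : ℝ) : ℂ)).im := by simp
  rw [e]
  obtain ⟨hd, x, hx, hx1, hx2, hb⟩ := u6_I_mul hy
  refine ⟨hd, ?_⟩
  rw [hx]
  congr 1
  obtain ⟨hs, hs1, hs2⟩ := sqrt_three_bounds
  obtain ⟨ht0, ht⟩ := rpow_mul_sqrt_two
  have ha := cubicAImag_pos hy
  have hf := cubicAImag_fricke hy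
  have hc := cubicB_cube hτ
  have e3 : 3 * (Complex.I * ((1 / 3 : ℝ) : ℂ)) = Complex.I * ((1 / (3 * (1 / 3)) : ℝ) : ℂ) := by
    push_cast; ring
  rw [cubicB, e3, cubicA_two_mul_I, cubicA_I_mul, cubicA_I_mul, hf, hb] at hc
  have hc' : 2 * ((3 * (√3 * (1 / 3) * cubicAImag (1 / 3)) - cubicAImag (1 / 3)) / 2) ^ 3 =
      (2 * (x * cubicAImag (1 / 3)) - cubicAImag (1 / 3)) ^ 2 *
        (cubicAImag (1 / 3) + x * cubicAImag (1 / 3)) := by exact_mod_cast hc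
  generalize cubicAImag (1 / 3) = a at ha hc'
  generalize (3 : ℝ) ^ (3 / 4 : ℝ) * √2 = t at *
  generalize √3 = s at *
  have h1 : (s - 1) ^ 3 / 4 = (2 * x - 1) ^ 2 * (1 + x) := by
    refine mul_left_cancel₀ (pow_ne_zero 3 ha.ne') ?_
    linear_combination hc'
  -- With t² = 6√3 the cubic splits into three linear factors. The roots (√3 − 1)/2 and (1 − √3 −
  -- t)/4 are below 1/2.
  have h2 : (2 * x - (s - 1)) * ((4 * x - 1 + s - t) * (4 * x - 1 + s + t)) = 0 := by
    linear_combination -8 * h1 + (-2 * x + s - 1) * ht + (-6 * x + s + 3) * hs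
  have h3 : 2 * x - (s - 1) ≠ 0 := by linarith
  have h4 : 4 * x - 1 + s + t ≠ 0 := by linarith
  have h5 := (mul_eq_zero.mp ((mul_eq_zero.mp h2).resolve_left h3)).resolve_right h4
  linarith

/-- Here τ/3 = −1/(3τ), so c(q) = (√3 − 1)a(q)/2 and the cubic relation for c is used. -/
theorem u6_I : u6Den Complex.I ≠ 0 ∧
    u6 Complex.I = (((3 : ℝ) ^ (3 / 4 : ℝ) * √2 - 1 + √3) / 4 : ℝ) := by
  have hy : (0 : ℝ) < 1 := one_pos
  have e : Complex.I = Complex.I * ((1 : ℝ) : ℂ) := by simp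
  have hτ : 0 < (Complex.I * ((1 : ℝ) : ℂ)).im := by simp
  rw [e]
  obtain ⟨hd, x, hx, hx1, hx2, hb⟩ := u6_I_mul hy
  refine ⟨hd, ?_⟩
  rw [hx]
  congr 1
  obtain ⟨hs, hs1, hs2⟩ := sqrt_three_bounds
  obtain ⟨ht0, ht⟩ := rpow_mul_sqrt_two
  have ha := cubicAImag_pos hy
  have hf := cubicAImag_fricke hy
  have hc := cubicC_cube hτ
  have e3 : Complex.I * ((1 : ℝ) : ℂ) / 3 = Complex.I * ((1 / (3 * 1) : ℝ) : ℂ) := by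
    push_cast; ring
  rw [cubicC, e3, cubicA_two_mul_I, cubicA_I_mul, cubicA_I_mul, hf, hb] at hc
  have hc' : 2 * ((√3 * 1 * cubicAImag 1 - cubicAImag 1) / 2) ^ 3 =
      (cubicAImag 1 - x * cubicAImag 1) *
        (cubicAImag 1 + 2 * (x * cubicAImag 1)) ^ 2 := by exact_mod_cast hc
  generalize cubicAImag 1 = a at ha hc'
  generalize (3 : ℝ) ^ (3 / 4 : ℝ) * √2 = t at *
  generalize √3 = s at *
  have h1 : (s - 1) ^ 3 / 4 = (1 - x) * (1 + 2 * x) ^ 2 := by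
    refine mul_left_cancel₀ (pow_ne_zero 3 ha.ne') ?_
    linear_combination hc'
  have h2 : (2 * x + (s - 1)) * ((4 * x + 1 - s - t) * (4 * x + 1 - s + t)) = 0 := by
    linear_combination 8 * h1 + (-2 * x - s + 1) * ht + (-6 * x - s - 3) * hs
  have h3 : 2 * x + (s - 1) ≠ 0 := by linarith
  have h4 : 4 * x + 1 - s + t ≠ 0 := by linarith
  have h5 := (mul_eq_zero.mp ((mul_eq_zero.mp h2).resolve_left h3)).resolve_right h4
  linarith

theorem u6_I_div_sqrt_two : u6Den (Complex.I / (√2 : ℝ)) ≠ 0 ∧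
    u6 (Complex.I / (√2 : ℝ)) = 1 / 5 + 3 * (√6 : ℝ) / 10 := by
  have h2p : (0 : ℝ) < √2 := Real.sqrt_pos.mpr two_pos
  have hy : (0 : ℝ) < 1 / √2 := by positivity
  have e : Complex.I / (√2 : ℝ) = Complex.I * ((1 / √2 : ℝ) : ℂ) := by push_cast; ring
  have hτ : 0 < (Complex.I * ((1 / √2 : ℝ) : ℂ)).im := by simp
  rw [e]
  obtain ⟨hd, x, hx, hx1, hx2, hb⟩ := u6_I_mul hy
  refine ⟨hd, ?_⟩
  have goal : x = 1 / 5 + 3 * √6 / 10 := by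
    have h22 : √2 ^ 2 = 2 := Real.sq_sqrt two_pos.le
    have h66 : √6 ^ 2 = 6 := Real.sq_sqrt (by norm_num)
    have h6 : √6 = √3 * √2 := by rw [← Real.sqrt_mul (by norm_num)]; norm_num
    have h6b : 7 / 3 < √6 := Real.lt_sqrt_of_sq_lt (by norm_num)
    have ha := cubicAImag_pos hy
    have hf := cubicAImag_fricke hy
    have hc := cubicC_two_mul_cube hτ
    -- Since 2τ² = −1, the point 2τ/3 is the Fricke image −1/(3τ), and c(q²) becomes a combination
    -- of a(q) and a(q²).
    have e3 : 2 * (Complex.I * ((1 / √2 : ℝ) : ℂ)) / 3 =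
        Complex.I * ((1 / (3 * (1 / √2)) : ℝ) : ℂ) := by
      have : 2 * (1 / √2) / 3 = 1 / (3 * (1 / √2)) := by
        field_simp
        linarith
      rw [← this]
      push_cast
      ring
    have hr : √3 * (1 / √2) = √6 / 2 := by
      rw [h6]
      field_simp
      linear_combination -h22
    rw [cubicC, e3, cubicA_two_mul_I, cubicA_I_mul, cubicA_I_mul, hf, hb, hr] at hc
    have hc' : 4 * ((√6 / 2 * cubicAImag (1 / √2) - x * cubicAImag (1 / √2)) / 2) ^ 3 =
        (cubicAImag (1 / √2) - x * cubicAImag (1 / √2)) ^ 2 *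
          (cubicAImag (1 / √2) + 2 * (x * cubicAImag (1 / √2))) := by exact_mod_cast hc
    generalize cubicAImag (1 / √2) = a at ha hc'
    generalize √6 = w at *
    have h1 : (w / 2 - x) ^ 3 = 2 * (1 - x) ^ 2 * (1 + 2 * x) := by
      refine mul_left_cancel₀ (pow_ne_zero 3 ha.ne') ?_
      linear_combination 2 * hc'
    have h2 : (x - (1 / 5 + 3 * w / 10)) * (5 * x * (x - 1) + (7 / 2 - 3 * w / 2)) = 0 := by
      linear_combination -h1 + (-(3 / 4) * x + 9 / 20 + w / 8) * h66
    -- The quadratic cofactor is negative on (0, 1), because √6 > 7/3.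
    have h3 : 5 * x * (x - 1) + (7 / 2 - 3 * w / 2) ≠ 0 := by nlinarith
    linarith [(mul_eq_zero.mp h2).resolve_right h3]
  rw [hx, goal]
  push_cast
  rfl

theorem u6_sqrt_neg_fifteen : u6Den ((3 + (√15 : ℝ) * Complex.I) / 6) ≠ 0 ∧
    u6 ((3 + (√15 : ℝ) * Complex.I) / 6) = (√5 : ℝ) / 2 := by
  obtain ⟨τ, hdef⟩ : ∃ τ : ℂ, τ = (3 + (√15 : ℝ) * Complex.I) / 6 := ⟨_, rfl⟩
  rw [← hdef]
  have h15 : 0 < √15 := Real.sqrt_pos.mpr (by norm_num)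
  have h15c : ((√15 : ℝ) : ℂ) ^ 2 = 15 := by
    exact_mod_cast Real.sq_sqrt (show (0 : ℝ) ≤ 15 by norm_num)
  have hsc : ((√15 : ℝ) : ℂ) = √3 * √5 := by
    rw [← Complex.ofReal_mul, ← Real.sqrt_mul (by norm_num)]
    norm_num
  have hτ : 0 < τ.im := by
    have : τ = ((1 / 2 : ℝ) : ℂ) + ((√15 / 6 : ℝ) : ℂ) * Complex.I := by
      rw [hdef]; push_cast; ring
    rw [this]
    simp
  have hτ0 := ne_zero_of_im_pos hτ
  have hq : 3 * τ ^ 2 = 3 * τ - 2 := by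
    rw [hdef]
    linear_combination (Complex.I ^ 2 / 12) * h15c + 15 / 12 * Complex.I_sq
  -- This root of the quadratic relation fixes the sign of √5 in the final value.
  have hI : Complex.I * (4 - 3 * τ) = (√15 : ℝ) * τ := by
    rw [hdef]
    linear_combination (-(√15 : ℝ) / 2 : ℂ) * Complex.I_sq + (-Complex.I / 6) * h15c
  have h2 : 0 < (τ / 2).im := by
    rw [show τ / 2 = τ / ((2 : ℝ) : ℂ) by push_cast; rfl, Complex.div_ofReal_im]
    positivity
  -- By 3τ² = 3τ − 2, the point (τ + 1)/2 is −1/(3τ) + 1 and τ is −1/(3 · τ/2) + 1. Both terms of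
  -- the Hecke relation are thus multiples of a(q).
  have e1 : cubicA ((τ + 1) / 2) = -Complex.I * √3 * τ * cubicA τ := by
    rw [← cubicA_fricke hτ, ← cubicA_add_one (-1 / (3 * τ))]
    congr 1
    field_simp
    linear_combination hq
  have e2 : cubicA τ = -Complex.I * √3 * (τ / 2) * cubicA (τ / 2) := by
    rw [← cubicA_fricke h2, ← cubicA_sub_one τ]
    congr 1
    field_simp
    linear_combination hq
  have e3 := two_mul_cubicA_two_mul hτ
  have hB : 2 * cubicA (2 * τ) = √5 * cubicA τ := by
    have hk : Complex.I * √3 * τ ≠ 0 := mul_ne_zero (mul_ne_zero Complex.I_ne_zero (by simp)) hτ0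
    refine mul_left_cancel₀ hk ?_
    rw [e3, e1]
    linear_combination 2 * e2 - (√3 : ℂ) ^ 2 * τ ^ 2 * cubicA τ * Complex.I_sq +
      τ ^ 2 * cubicA τ * sqrt_three_sq + cubicA τ * hq + Complex.I * τ * cubicA τ * hsc +
      cubicA τ * Complex.I * hI - (4 - 3 * τ) * cubicA τ * Complex.I_sq
  -- If a(q) vanished, so would a(q²) by `hB`, and then the eta quotient a(q) − a(q²) = 6X, which
  -- has no zeros.
  have hA : cubicA τ ≠ 0 := by
    intro h
    have hX := cubicA_sub_eq hτ
    rw [h, mul_zero] at hB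
    rw [h, (mul_eq_zero.mp hB).resolve_left two_ne_zero, sub_zero] at hX
    exact etaX_ne_zero hτ ((mul_eq_zero.mp hX.symm).resolve_left (by norm_num))
  refine ⟨(u6Den_ne_zero_iff hτ).mpr hA, ?_⟩
  rw [u6_eq hτ, div_eq_div_iff hA two_ne_zero]
  linear_combination hB

theorem mainTheorem10 :
    -- the ratio of `G_{2,2}(3 τ)` and `G_{2,2}(τ)`
    (∀ τ : ℂ, 0 < τ.im → u6Den τ ≠ 0 → G2level 2 τ ≠ 0 →
      6 * u6 τ ^ 2 - 6 * u6 τ - 3 ≠ 0 ∧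
      G2level 2 (3 * τ) / G2level 2 τ =
        (-2 * u6 τ ^ 2 - 2 * u6 τ + 1) / (6 * u6 τ ^ 2 - 6 * u6 τ - 3)) ∧
    -- the ratio of `G_{2,3}(2 τ)` and `G_{2,3}(τ)`
    (∀ τ : ℂ, 0 < τ.im → u6Den τ ≠ 0 → G2level 3 τ ≠ 0 →
      G2level 3 (2 * τ) / G2level 3 τ = u6 τ ^ 2) ∧
    -- the modular equation between `x = u₆(τ)` and `y = u₆(3 τ)`
    (∀ τ : ℂ, 0 < τ.im → u6Den τ ≠ 0 → u6Den (3 * τ) ≠ 0 →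
      ∀ x y : ℂ, x = u6 τ → y = u6 (3 * τ) →
        16 * x ^ 3 * y ^ 3 - 12 * (x ^ 3 * y + x * y ^ 3) + 12 * x ^ 2 * y ^ 2
          - 5 * (x ^ 3 - y ^ 3) - 3 * (x ^ 2 * y - x * y ^ 2) - 6 * (x ^ 2 + y ^ 2)
          + 6 * x * y + 2 = 0) ∧
    -- the special values
    (u6Den ((3 + (√15 : ℝ) * Complex.I) / 6) ≠ 0 ∧
      u6 ((3 + (√15 : ℝ) * Complex.I) / 6) = (√5 : ℝ) / 2) ∧
    (u6Den (Complex.I / (√2 : ℝ)) ≠ 0 ∧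
      u6 (Complex.I / (√2 : ℝ)) = 1 / 5 + 3 * (√6 : ℝ) / 10) ∧
    (u6Den Complex.I ≠ 0 ∧
      u6 Complex.I = (((3 : ℝ) ^ (3 / 4 : ℝ) * √2 - 1 + √3) / 4 : ℝ)) ∧
    (u6Den (Complex.I / 3) ≠ 0 ∧
      u6 (Complex.I / 3) = (((3 : ℝ) ^ (3 / 4 : ℝ) * √2 + 1 - √3) / 4 : ℝ)) :=
  ⟨fun _ hτ hd hG => G2level_two_ratio hτ hd hG, fun _ hτ _ hG => G2level_three_ratio hτ hG,
    fun _ hτ hd hd' _ _ hx hy => u6_modular_equation hτ hd hd' hx hy,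
    u6_sqrt_neg_fifteen, u6_I_div_sqrt_two, u6_I, u6_I_div_three⟩
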